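/- Let $d\ge 1$ and $k\ge 1$ be integers and $s_0\in\mathbb R$. Equip the unit cube $[0,1]^d$ with the toroidal metric $\mathsf{dist}(x,y)=\min_{z\in\mathbb Z^d}\|x-y+z\|$, where $\|\cdot\|$ is the Euclidean norm, and let $B_r(x)=\{y\in[0,1]^d:\mathsf{dist}(x,y)\le r\}$. Let $(a_n)_{n\ge1}$ be a real sequence with $$a_n\to\infty,\qquad a_n-\log n-(k-1)\log\log n\to-\infty \qquad (n\to\infty),$$ and put $$b_n=n\,a_n^{k-1}e^{-a_n},\qquad r_n(s_0)=\Big(\frac{a_n+s_0}{n\theta_d}\Big)^{1/d},$$ where $\theta_d$ is the volume of the Euclidean unit ball in $\mathbb R^d$ (so $b_n\to\infty$, and $r_n(s_0)$ is well defined for all large $n$). For each $n\ge1$ let $\mathcal P_n$ be a homogeneous Poisson point process on $[0,1]^d$ with intensity $n$, and let $\mathcal B_n=\{X_1,\dots,X_n\}$ be a binomial point process, where $X_1,X_2,\dots$ are independent and uniformly distributed on $[0,1]^d$. Let $$T_{k,n}=\sum_{X\in\mathcal P_n}\mathbf 1\big\{\mathcal P_n\big(B_{r_n(s_0)}(X)\big)\le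 k\big\},\qquad T^{\mathsf B}_{k,n}=\sum_{X\in\mathcal B_n}\mathbf 1\big\{\mathcal B_n\big(B_{r_n(s_0)}(X)\big)\le k\big\},$$ that is, the number of points whose closed $r_n(s_0)$-ball contains at most $k$ points, the center included. Then $(T_{k,n}/b_n)_{n\ge1}$ satisfies the large deviation principle on $\mathbb R$ with speed $b_n$ and rate function $$I_k(x)=\begin{cases}x\log(x/\alpha_k)-x+\alpha_k,&x\ge0,\\ \infty,&x<0,\end{cases}\qquad \alpha_k=\frac{e^{-s_0}}{(k-1)!}$$ (with $0\log 0=0$). That is, $I_k:\mathbb R\to[0,\infty]$ is lower semicontinuous, and for all open $G\subset\mathbb R$ and closed $F\subset\mathbb R$, $$-\inf_{x\in G}I_k(x)\le\liminf_{n\to\infty}\frac1{b_n}\log\mathbb P\Big(\frac{T_{k,n}}{b_n}\in G\Big),\qquad \limsup_{n\to\infty}\frac1{b_n}\log\mathbb P\Big(\frac{T_{k,n}}{b_n}\in F\Big)\le-\inf_{x\in F}I_k(x).$$ Furthermore, $(T^{\mathsf B}_{k,n}/b_n)_{n\ge1}$ satisfies the same large deviation principle. -/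

import Mathlib

open MeasureTheory ProbabilityTheory Filter Topology
open scoped ENNReal NNReal

namespace KNNBalls

noncomputable section

/-- The unit cube `[0,1]^d`; its `volume` is Lebesgue measure on the cube. -/
abbrev Cube (d : ℕ) : Type := Fin d → unitInterval

/-- The toroidal metric `min_{z ∈ ℤ^d} ‖x - y + z‖` on `[0,1]^d`, with `‖·‖` the Euclidean norm. -/
def torusDist {d : ℕ} (x y : Cube d) : ℝ :=
  ⨅ z : Fin d → ℤ, ‖WithLp.toLp 2 (fun i => (x i : ℝ) - (y i : ℝ) + (z i : ℝ))‖

/-- The closed ball of radius `r` around `x` in the toroidal metric. -/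
def torusBall {d : ℕ} (x : Cube d) (r : ℝ) : Set (Cube d) :=
  {y | torusDist x y ≤ r}

/-- A point measure: a sum of at most countably many Dirac masses. -/
def IsPointMeasure {E : Type*} [MeasurableSpace E] (m : Measure E) : Prop :=
  ∃ (I : Set ℕ) (x : I → E), m = Measure.sum (fun i : I => Measure.dirac (x i))

/-- `η` is a Poisson point process on `E` with intensity measure `Λ`, under the probability
measure `P`: a random point measure whose value at each measurable set `A` of finite intensity is
Poisson distributed with mean `Λ A`, and whose values at disjoint measurable sets are
independent. -/
structure IsPoissonProcess {Ω E : Type*} [MeasurableSpace Ω] [MeasurableSpace E]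
    (P : Measure Ω) (Λ : Measure E) (η : Ω → Measure E) : Prop where
  measurable : Measurable η
  pointMeasure : ∀ ω, IsPointMeasure (η ω)
  poisson : ∀ A : Set E, MeasurableSet A → Λ A ≠ ∞ →
    P.map (fun ω => η ω A) =
      (poissonMeasure (Λ A).toNNReal).map (fun j : ℕ => (j : ℝ≥0∞))
  indep : ∀ (m : ℕ) (A : Fin m → Set E), (∀ i, MeasurableSet (A i)) →
    Pairwise (fun i j => Disjoint (A i) (A j)) →
    iIndepFun (fun i ω => η ω (A i)) P

/-- `X 0, X 1, …` are independent and uniformly distributed on `[0,1]^d`. -/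
structure IsIIDUniform {Ω : Type*} [MeasurableSpace Ω] {d : ℕ}
    (P : Measure Ω) (X : ℕ → Ω → Cube d) : Prop where
  measurable : ∀ i, Measurable (X i)
  uniform : ∀ i, P.map (X i) = volume
  indep : iIndepFun X P

/-- The binomial point process made of the first `n` of the given random points. -/
def binomialProcess {Ω : Type*} {d : ℕ} (X : ℕ → Ω → Cube d) (n : ℕ) (ω : Ω) :
    Measure (Cube d) :=
  ∑ i ∈ Finset.range n, Measure.dirac (X i ω)

/-- The volume of the Euclidean unit ball in `ℝ^d`. -/
def unitBallVolume (d : ℕ) : ℝ :=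
  (volume (Metric.closedBall (0 : EuclideanSpace ℝ (Fin d)) 1)).toReal

/-- The radius `((a_n + s₀) / (n θ_d))^{1/d}`. -/
def radius (d : ℕ) (a : ℕ → ℝ) (s₀ : ℝ) (n : ℕ) : ℝ :=
  ((a n + s₀) / ((n : ℝ) * unitBallVolume d)) ^ (1 / (d : ℝ))

/-- The scaling constants `b_n = n a_n^{k-1} e^{-a_n}`. -/
def scaling (k : ℕ) (a : ℕ → ℝ) (n : ℕ) : ℝ :=
  (n : ℝ) * a n ^ (k - 1) * Real.exp (-a n)

/-- The number (with multiplicity) of points `x` of the point measure `m` such that the closed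
toroidal ball of radius `r` around `x` has at most `k` points of `m`, the point `x` included. -/
def lowDegreeCount {d : ℕ} (k : ℕ) (r : ℝ) (m : Measure (Cube d)) : ℝ :=
  (m {x | m (torusBall x r) ≤ (k : ℝ≥0∞)}).toReal

/-- The sequence `μ` of measures (laws) satisfies the large deviation principle with speed
`b n → ∞` and rate function `I` (lower semicontinuous, with values in `[0,∞]`). -/
structure SatisfiesLDP {S : Type*} [TopologicalSpace S] [MeasurableSpace S]
    (μ : ℕ → Measure S) (b : ℕ → ℝ) (I : S → EReal) : Prop where
  speed : Tendsto b atTop atTop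
  nonneg : ∀ x, 0 ≤ I x
  lsc : LowerSemicontinuous I
  lower : ∀ G : Set S, IsOpen G →
    -(⨅ x ∈ G, I x) ≤ liminf (fun n => ENNReal.log (μ n G) / (b n : EReal)) atTop
  upper : ∀ F : Set S, IsClosed F →
    limsup (fun n => ENNReal.log (μ n F) / (b n : EReal)) atTop ≤ -(⨅ x ∈ F, I x)

/-- `x log (x / α) - x + α` for `x ≥ 0` (equal to `α` at `x = 0`), and `∞` for `x < 0`. -/
def poissonRate (α : ℝ) (x : ℝ) : EReal :=
  if 0 ≤ x then ((x * Real.log (x / α) - x + α : ℝ) : EReal) else ⊤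

end

end KNNBalls

/-!
Write `T` for the number of low-degree points, `u = n θ r ^ d = a n + s₀` for the mean number of
points in a ball, and `α = exp (-s₀) / (k - 1)!`. The theorem holds because the low-degree points
behave like a Poisson number of nearly independent points. More precisely, both for the Poisson and
for the binomial process
`log E exp (t T) = α (exp t - 1) b n + o(b n)` for every real `t`, and the limit is the logarithmic
moment generating function of the Poisson distribution with mean `α`. It is finite and smooth
everywhere, so the Gärtner–Ellis theorem, proved here in this special case
(`HasPoissonLogMGF.satisfiesLDP`), gives the large deviation principle with its Legendre transform
as rate function.

*Poisson process.* A Poisson process of finite intensity measure `Λ` has the law `poissonLaw Λ`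
(`IsPoissonProcess.map_eq_poissonLaw`), a mixture of the laws of finite tuples of points, for which
the Mecke formula and the independence over disjoint sets are proved by induction on the number of
points. The Mecke formula writes the derivative `E [T exp (t T)]` as an integral over `x` of the
exponential moment of the process with a point inserted at `x`, restricted to the event that `x`
has fewer than `k` neighbours. On this event the inserted point contributes `exp t`, and the
other low-degree points hardly notice what happens in the ball of `x`. A point `y` whose status is
affected lies within distance `2 r` of `x`; either `y` is within `ε r` of `x`, which has small
probability because of the small volume (and because `x` then has one neighbour less at its
disposal), or the ball of `y` contains a crescent outside the ball of `x` whose volume is a fixed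
fraction of the volume of the ball and in which fewer than `k` points fall
(`lintegral_fewerThan_nearLowCount_le`). Since a ball of radius `3 r` contains a bounded number of
low-degree points, the weight `exp (t T)` changes the probability of such local events by at most a
constant factor (`lintegral_mul_exp_le_of_local`). Hence
`E [T exp (t T)] = n P(Poisson(u) < k) exp t E [exp (t T)] (1 + o(1))`
(`lintegral_fewerThan_expCount_add`, `integral_lowDegreeCount_mul_exp`), and integrating in `t`
gives `exists_abs_log_integral_exp_le`. The mean `n P(Poisson(u) < k)` is asymptotic to `α b n`
(`tendsto_mul_poissonLower_div_scaling`).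

*Binomial process.* Put `K = n / (a n) ^ 2` and let `N` be Poisson with mean `n - K`. A deviation of
`N` from its mean by more than `K` has probability at most `2 exp (-K ^ 2 / (4 n))`, which is
superexponentially small at speed `b n` (`poissonMeasure_deviation_le`,
`eventually_mul_scaling_le`). Otherwise `N ≤ n`, and the `n` points arise from the `N` points by
adding at most `2 K` further uniform ones. An additional point `y` changes `T` by at most its
bounded `influence`: the indicator that `y` is of low degree plus the number of low-degree points
near `y`. The mean of this over `y` is `V + θ r ^ d T`, where `V` is the volume of the set of
low-degree locations (`integral_influence`). So the further points multiply the exponential moment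
by `exp (± C K (V + θ r ^ d T))` at most (`lintegral_tupleLaw_expCount_le`). Here
`K θ r ^ d` tends to zero, so that the second term amounts to a small change of `t`, and the first
term is negligible because `V` has mean `P(Poisson(u) ≤ k)`, which is of order `a n b n / n`
(`abs_log_integral_exp_lowVolume_le`). Averaging over `N` reduces the binomial process to the
Poisson process of intensity `n - K`, to which the first part applies
(`eventually_lintegral_tupleLaw_expCount`).
-/

namespace KNNBalls

/-! ### The Gärtner–Ellis theorem for a Poisson limit -/

section LargeDeviations

/-- An exponential upper bound on the masses bounds the upper logarithmic rate. -/
theorem limsup_log_div_le {u : ℕ → ℝ≥0∞} {b : ℕ → ℝ} (hb : Tendsto b atTop atTop) {c : ℝ}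
    (h : ∀ᶠ n in atTop, u n ≤ ENNReal.ofReal (Real.exp (b n * c))) :
    limsup (fun n => ENNReal.log (u n) / (b n : EReal)) atTop ≤ (c : EReal) := by
  refine limsup_le_of_le (by isBoundedDefault) ?_
  filter_upwards [h, hb.eventually_gt_atTop 0] with n hn hbn
  have hlog : ENNReal.log (u n) ≤ ((b n * c : ℝ) : EReal) := by
    refine (ENNReal.log_monotone hn).trans_eq ?_
    rw [ENNReal.log_ofReal_of_pos (Real.exp_pos _), Real.log_exp]
  refine (EReal.div_le_div_right_of_nonneg (by exact_mod_cast hbn.le) hlog).trans_eq ?_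
  rw [← EReal.coe_div, mul_div_cancel_left₀ _ hbn.ne']

theorem le_liminf_log_div {u : ℕ → ℝ≥0∞} {b : ℕ → ℝ} (hb : Tendsto b atTop atTop) {c : ℝ}
    (h : ∀ᶠ n in atTop, ENNReal.ofReal (Real.exp (b n * c)) ≤ u n) :
    (c : EReal) ≤ liminf (fun n => ENNReal.log (u n) / (b n : EReal)) atTop := by
  refine le_liminf_of_le (by isBoundedDefault) ?_
  filter_upwards [h, hb.eventually_gt_atTop 0] with n hn hbn
  have hlog : ((b n * c : ℝ) : EReal) ≤ ENNReal.log (u n) := by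
    refine Eq.trans_le ?_ (ENNReal.log_monotone hn)
    rw [ENNReal.log_ofReal_of_pos (Real.exp_pos _), Real.log_exp]
  refine Eq.trans_le ?_ (EReal.div_le_div_right_of_nonneg (by exact_mod_cast hbn.le) hlog)
  rw [← EReal.coe_div, mul_div_cancel_left₀ _ hbn.ne']

/-- The scaled logarithmic moment generating functions of the laws `μ n` at speed `b n` converge
to `t ↦ α (e^t - 1)`, the logarithmic moment generating function of the Poisson distribution. -/
def HasPoissonLogMGF (μ : ℕ → Measure ℝ) (b : ℕ → ℝ) (α : ℝ) : Prop :=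
  ∀ t ε : ℝ, 0 < ε → ∀ᶠ n in atTop,
    ENNReal.ofReal (Real.exp (b n * (α * (Real.exp t - 1) - ε))) ≤
      ∫⁻ y, ENNReal.ofReal (Real.exp (t * (b n * y))) ∂(μ n) ∧
    ∫⁻ y, ENNReal.ofReal (Real.exp (t * (b n * y))) ∂(μ n) ≤
      ENNReal.ofReal (Real.exp (b n * (α * (Real.exp t - 1) + ε)))

/-- Chernoff's bound for the measure tilted by `exp (t b y)`. -/
theorem setLIntegral_exp_le {ν : Measure ℝ} {S : Set ℝ} {s t x b : ℝ} (hb : 0 ≤ b)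
    (hS : MeasurableSet S) (hx : ∀ y ∈ S, 0 ≤ s * (y - x)) :
    ∫⁻ y in S, ENNReal.ofReal (Real.exp (t * (b * y))) ∂ν ≤
      ENNReal.ofReal (Real.exp (-(s * (b * x)))) *
        ∫⁻ y, ENNReal.ofReal (Real.exp ((t + s) * (b * y))) ∂ν := by
  rw [← lintegral_const_mul _ (by fun_prop)]
  refine (setLIntegral_mono' hS fun y hy => ?_).trans (setLIntegral_le_lintegral _ _)
  rw [← ENNReal.ofReal_mul (by positivity), ← Real.exp_add]
  refine ENNReal.ofReal_le_ofReal (Real.exp_le_exp.2 ?_)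
  nlinarith [mul_nonneg hb (hx y hy)]

/-- The Chernoff bound, in the limit. -/
theorem HasPoissonLogMGF.eventually_tail_le {μ : ℕ → Measure ℝ} {b : ℕ → ℝ} {α : ℝ}
    (h : HasPoissonLogMGF μ b α) (hb : Tendsto b atTop atTop) {S : Set ℝ} {t x c : ℝ}
    (hS : MeasurableSet S) (hx : ∀ y ∈ S, 0 ≤ t * (y - x))
    (hc : α * (Real.exp t - 1) - t * x < c) :
    ∀ᶠ n in atTop, μ n S ≤ ENNReal.ofReal (Real.exp (b n * c)) := by
  filter_upwards [h t (c - (α * (Real.exp t - 1) - t * x)) (by linarith),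
    hb.eventually_ge_atTop 0] with n hn hbn
  have h1 := setLIntegral_exp_le (ν := μ n) (t := 0) hbn hS hx
  simp only [zero_mul, Real.exp_zero, ENNReal.ofReal_one, setLIntegral_one, zero_add] at h1
  refine h1.trans ((mul_le_mul_right hn.2 _).trans ?_)
  rw [← ENNReal.ofReal_mul (by positivity), ← Real.exp_add]
  refine ENNReal.ofReal_le_ofReal (Real.exp_le_exp.2 (le_of_eq ?_))
  ring

theorem poissonRate_of_nonneg {α x : ℝ} (hx : 0 ≤ x) :
    poissonRate α x = ((x * Real.log (x / α) - x + α : ℝ) : EReal) := if_pos hx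

theorem poissonRate_of_neg {α x : ℝ} (hx : x < 0) : poissonRate α x = ⊤ := if_neg hx.not_ge

theorem mul_log_div_sub_add_nonneg {α x : ℝ} (hα : 0 < α) (hx : 0 ≤ x) :
    0 ≤ x * Real.log (x / α) - x + α := by
  rcases hx.eq_or_lt with rfl | hx
  · simpa using hα.le
  have h := Real.add_one_le_exp (-Real.log (x / α))
  rw [Real.exp_neg, Real.exp_log (by positivity), inv_div] at h
  have := mul_le_mul_of_nonneg_left h hx.le
  rw [mul_div_cancel₀ _ hx.ne'] at this
  nlinarith

theorem poissonRate_nonneg {α : ℝ} (hα : 0 < α) (x : ℝ) : 0 ≤ poissonRate α x := by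
  rcases lt_or_ge x 0 with hx | hx
  · rw [poissonRate_of_neg hx]; exact le_top
  · rw [poissonRate_of_nonneg hx]
    exact_mod_cast mul_log_div_sub_add_nonneg hα hx

theorem continuous_mul_log_div_sub_add {α : ℝ} (hα : 0 < α) :
    Continuous fun x : ℝ => x * Real.log (x / α) - x + α := by
  have : (fun x : ℝ => x * Real.log (x / α) - x + α) =
      fun x => α * ((x / α) * Real.log (x / α)) - x + α := by
    funext x; field_simp
  rw [this]
  have := Real.continuous_mul_log.comp (continuous_id.div_const α)
  simp only [Function.comp_def, id] at this
  fun_prop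

theorem lowerSemicontinuous_poissonRate {α : ℝ} (hα : 0 < α) :
    LowerSemicontinuous (poissonRate α) := by
  intro x y hy
  rcases lt_or_ge x 0 with hx | hx
  · rw [poissonRate_of_neg hx] at hy
    filter_upwards [Iio_mem_nhds hx] with z hz
    rwa [poissonRate_of_neg hz]
  · rw [poissonRate_of_nonneg hx] at hy
    have hc : Continuous fun x : ℝ => ((x * Real.log (x / α) - x + α : ℝ) : EReal) :=
      continuous_coe_real_ereal.comp (continuous_mul_log_div_sub_add hα)
    filter_upwards [hc.continuousAt.eventually (lt_mem_nhds hy)] with z hz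
    rcases lt_or_ge z 0 with hz0 | hz0
    · rw [poissonRate_of_neg hz0]; exact hy.trans (EReal.coe_lt_top _)
    · rwa [poissonRate_of_nonneg hz0]

/-- The value of the Legendre transform at a positive point, attained at `log (x / α)`. -/
theorem legendre_log_div {α x : ℝ} (hα : 0 < α) (hx : 0 < x) :
    α * (Real.exp (Real.log (x / α)) - 1) - Real.log (x / α) * x =
      -(x * Real.log (x / α) - x + α) := by
  rw [Real.exp_log (by positivity)]
  field_simp
  ring

/-- A tail on the far side of `x` from the mean `α` decays at the rate given by `poissonRate`. -/
theorem HasPoissonLogMGF.eventually_tail_le_rate {μ : ℕ → Measure ℝ} {b : ℕ → ℝ} {α : ℝ}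
    (h : HasPoissonLogMGF μ b α) (hb : Tendsto b atTop atTop) (hα : 0 < α) {S : Set ℝ} {x : ℝ}
    (hS : MeasurableSet S)
    (hx : (α ≤ x ∧ ∀ y ∈ S, x ≤ y) ∨ (x ≤ α ∧ ∀ y ∈ S, y ≤ x)) {c : ℝ}
    (hc : (-c : ℝ) < poissonRate α x) :
    ∀ᶠ n in atTop, μ n S ≤ ENNReal.ofReal (Real.exp (b n * c)) := by
  rcases lt_or_ge 0 x with hx0 | hx0
  · refine h.eventually_tail_le hb (t := Real.log (x / α)) (x := x) hS ?_ ?_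
    · intro y hy
      rcases hx with ⟨h1, h2⟩ | ⟨h1, h2⟩
      · exact mul_nonneg (Real.log_nonneg ((one_le_div hα).2 h1)) (sub_nonneg.2 (h2 y hy))
      · exact mul_nonneg_of_nonpos_of_nonpos
          (Real.log_nonpos (by positivity) ((div_le_one hα).2 h1)) (sub_nonpos.2 (h2 y hy))
    · rw [legendre_log_div hα hx0]
      rw [poissonRate_of_nonneg hx0.le] at hc
      have := EReal.coe_lt_coe_iff.1 hc
      linarith
  · -- here the optimal tilt is at `-∞`, so a sufficiently negative one is used
    have hle : ∀ y ∈ S, y ≤ x := by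
      rcases hx with ⟨h1, h2⟩ | ⟨h1, h2⟩
      · linarith
      · exact h2
    have hex : ∃ t : ℝ, t ≤ 0 ∧ α * (Real.exp t - 1) - t * x < c := by
      rcases hx0.eq_or_lt with rfl | hx0
      · rw [poissonRate_of_nonneg le_rfl] at hc
        have hc' := EReal.coe_lt_coe_iff.1 hc
        simp only [zero_mul, sub_zero, zero_add] at hc'
        have hlim : Tendsto (fun t : ℝ => α * (Real.exp t - 1) - t * 0) atBot
            (𝓝 (α * (0 - 1) - 0)) := by
          simp only [mul_zero]
          exact ((Real.tendsto_exp_atBot.sub_const 1).const_mul α).sub_const 0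
        obtain ⟨t, h1, h2⟩ := ((eventually_le_atBot (0 : ℝ)).and
          (hlim.eventually_lt_const (u := c) (by linarith))).exists
        exact ⟨t, h1, h2⟩
      · have hlim : Tendsto (fun t : ℝ => α - t * x) atBot atBot := by
          have := (tendsto_id (α := ℝ) (x := atBot)).const_mul_atBot (r := -x) (by linarith)
          refine (tendsto_atBot_add_const_left _ α this).congr fun t => ?_
          simp; ring
        obtain ⟨t, h1, h2⟩ := ((eventually_le_atBot (0 : ℝ)).and
          (hlim.eventually_lt_atBot c)).exists
        refine ⟨t, h1, lt_of_le_of_lt ?_ h2⟩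
        have := Real.exp_le_one_iff.2 h1
        nlinarith [Real.exp_pos t]
    obtain ⟨t, ht, htc⟩ := hex
    exact h.eventually_tail_le hb hS
      (fun y hy => mul_nonneg_of_nonpos_of_nonpos ht (sub_nonpos.2 (hle y hy))) htc

/-- Tilting by `t = log (x / α)` makes `x` the typical value; the tails of the tilted law are
controlled by moving `t` slightly to either side. -/
theorem HasPoissonLogMGF.eventually_le_ball {μ : ℕ → Measure ℝ} {b : ℕ → ℝ} {α : ℝ}
    (h : HasPoissonLogMGF μ b α) (hb : Tendsto b atTop atTop) (hα : 0 < α) {x δ c : ℝ}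
    (hx : 0 < x) (hδ : 0 < δ) (hc : c < -(x * Real.log (x / α) - x + α)) :
    ∀ᶠ n in atTop, ENNReal.ofReal (Real.exp (b n * c)) ≤ μ n (Set.Ioo (x - δ) (x + δ)) := by
  set t := Real.log (x / α) with ht
  have hxt : α * Real.exp t = x := by rw [ht, Real.exp_log (by positivity)]; field_simp
  -- shrink the ball so that the tilt varies little on it
  obtain ⟨δ', hδ', hδδ, hδc⟩ : ∃ δ' > 0, δ' ≤ δ ∧ c + |t| * δ' < -(x * t - x + α) := by
    have hgap : 0 < -(x * t - x + α) - c := by linarith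
    refine ⟨min δ ((-(x * t - x + α) - c) / (2 * (|t| + 1))), by positivity, min_le_left _ _, ?_⟩
    have h1 : |t| * min δ ((-(x * t - x + α) - c) / (2 * (|t| + 1))) ≤
        (|t| + 1) * ((-(x * t - x + α) - c) / (2 * (|t| + 1))) :=
      mul_le_mul (by linarith) (min_le_right _ _) (by positivity) (by positivity)
    have h2 : (|t| + 1) * ((-(x * t - x + α) - c) / (2 * (|t| + 1))) =
        (-(x * t - x + α) - c) / 2 := by field_simp
    linarith
  -- `x` is the mean under the tilt, so a small further tilt by `± s` gains in both tails
  have hderiv : HasDerivAt (fun s => α * (Real.exp (t + s) - 1)) x 0 := by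
    have := (((Real.hasDerivAt_exp (t + 0)).comp (0 : ℝ)
      ((hasDerivAt_id (0 : ℝ)).const_add t)).sub_const 1).const_mul α
    simpa [hxt, Function.comp_def] using this
  have hslope := hasDerivAt_iff_tendsto_slope_zero.1 hderiv
  have hnear := (hslope.eventually (Metric.ball_mem_nhds x (half_pos hδ')))
  obtain ⟨s, hs, hslo, hshi⟩ : ∃ s > 0,
      α * (Real.exp (t + s) - 1) - s * (x + δ') < α * (Real.exp t - 1) ∧
      α * (Real.exp (t + -s) - 1) - -s * (x - δ') < α * (Real.exp t - 1) := by
    rw [eventually_nhdsWithin_iff, Metric.eventually_nhds_iff] at hnear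
    obtain ⟨ε, hε, hnear⟩ := hnear
    have h1 := hnear (y := ε / 2) (by simp [abs_of_pos hε]; linarith) (by simp; positivity)
    have h2 := hnear (y := -(ε / 2)) (by simp [abs_of_pos hε]; linarith) (by simp; positivity)
    refine ⟨ε / 2, by positivity, ?_, ?_⟩
    · simp only [Real.dist_eq, smul_eq_mul, zero_add, add_zero] at h1
      have h3 := (abs_lt.1 h1).2
      have h4 : (ε / 2)⁻¹ * (α * (Real.exp (t + ε / 2) - 1) - α * (Real.exp t - 1)) < x + δ' := by
        linarith
      rw [inv_mul_lt_iff₀ (by positivity)] at h4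
      linarith
    · simp only [Real.dist_eq, smul_eq_mul, zero_add, add_zero] at h2
      have h3 := (abs_lt.1 h2).1
      have h4 : x - δ' < (ε / 2)⁻¹ *
          (α * (Real.exp t - 1) - α * (Real.exp (t + -(ε / 2)) - 1)) := by
        rw [inv_neg] at h3
        linarith
      rw [lt_inv_mul_iff₀ (by positivity)] at h4
      linarith
  set Λ := α * (Real.exp t - 1) with hΛ
  set gap := min (Λ - (α * (Real.exp (t + s) - 1) - s * (x + δ')))
    (min (Λ - (α * (Real.exp (t + -s) - 1) - -s * (x - δ')))
      (-(x * t - x + α) - (c + |t| * δ'))) with hgap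
  have hgap0 : 0 < gap := lt_min (by linarith) (lt_min (by linarith) (by linarith))
  have hg1 : gap ≤ Λ - (α * (Real.exp (t + s) - 1) - s * (x + δ')) := min_le_left _ _
  have hg2 : gap ≤ Λ - (α * (Real.exp (t + -s) - 1) - -s * (x - δ')) :=
    (min_le_right _ _).trans (min_le_left _ _)
  have hg3 : gap ≤ -(x * t - x + α) - (c + |t| * δ') :=
    (min_le_right _ _).trans (min_le_right _ _)
  filter_upwards [h t (gap / 4) (by positivity), h (t + s) (gap / 4) (by positivity),
    h (t + -s) (gap / 4) (by positivity), hb.eventually_ge_atTop (4 * Real.log 4 / gap),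
    hb.eventually_gt_atTop 0] with n h0 h1 h2 hbn hbn0
  have hbig : Real.log 4 ≤ b n * (gap / 4) := by
    rw [div_le_iff₀ hgap0] at hbn
    linarith
  set f : ℝ → ℝ≥0∞ := fun y => ENNReal.ofReal (Real.exp (t * (b n * y))) with hf
  -- each tail of the tilted measure has at most a quarter of a lower bound for the total mass
  have hquarter : ∀ z : ℝ, z ≤ b n * (Λ - gap / 4) - Real.log 4 →
      ENNReal.ofReal (Real.exp z) ≤ ENNReal.ofReal (Real.exp (b n * (Λ - gap / 4)) / 4) := by
    intro z hz
    refine ENNReal.ofReal_le_ofReal ?_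
    rw [le_div_iff₀ (by norm_num), ← Real.exp_log (show (0 : ℝ) < 4 by norm_num), ← Real.exp_add]
    exact Real.exp_le_exp.2 (by rw [Real.exp_log (by norm_num)]; linarith)
  have hup : ∫⁻ y in Set.Ici (x + δ'), f y ∂(μ n) ≤
      ENNReal.ofReal (Real.exp (b n * (Λ - gap / 4)) / 4) := by
    refine (setLIntegral_exp_le (s := s) (x := x + δ') hbn0.le measurableSet_Ici
      fun y hy => mul_nonneg hs.le (sub_nonneg.2 hy)).trans
      ((mul_le_mul_right h1.2 _).trans ?_)
    rw [← ENNReal.ofReal_mul (by positivity), ← Real.exp_add]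
    refine hquarter _ ?_
    nlinarith [mul_le_mul_of_nonneg_left hg1 hbn0.le]
  have hlo : ∫⁻ y in Set.Iic (x - δ'), f y ∂(μ n) ≤
      ENNReal.ofReal (Real.exp (b n * (Λ - gap / 4)) / 4) := by
    refine (setLIntegral_exp_le (s := -s) (x := x - δ') hbn0.le measurableSet_Iic
      fun y hy => mul_nonneg_of_nonpos_of_nonpos (by linarith) (sub_nonpos.2 hy)).trans
      ((mul_le_mul_right h2.2 _).trans ?_)
    rw [← ENNReal.ofReal_mul (by positivity), ← Real.exp_add]
    refine hquarter _ ?_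
    nlinarith [mul_le_mul_of_nonneg_left hg2 hbn0.le]
  have hmid : ∫⁻ y in Set.Ioo (x - δ') (x + δ'), f y ∂(μ n) ≤
      ENNReal.ofReal (Real.exp (b n * (t * x + |t| * δ'))) * μ n (Set.Ioo (x - δ) (x + δ)) := by
    calc _ ≤ ∫⁻ y in Set.Ioo (x - δ') (x + δ'),
          ENNReal.ofReal (Real.exp (b n * (t * x + |t| * δ'))) ∂(μ n) := by
          refine setLIntegral_mono' measurableSet_Ioo fun y hy => ?_
          refine ENNReal.ofReal_le_ofReal (Real.exp_le_exp.2 ?_)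
          have hyx : |y - x| ≤ δ' := abs_le.2 ⟨by linarith [hy.1], by linarith [hy.2]⟩
          have : t * (y - x) ≤ |t| * δ' :=
            (le_abs_self _).trans (by rw [abs_mul]; gcongr)
          nlinarith [mul_le_mul_of_nonneg_left this hbn0.le]
      _ ≤ _ := by
          rw [setLIntegral_const]
          gcongr
  have hsplit : ∫⁻ y, f y ∂(μ n) ≤ ∫⁻ y in Set.Iic (x - δ'), f y ∂(μ n) +
      (∫⁻ y in Set.Ioo (x - δ') (x + δ'), f y ∂(μ n) + ∫⁻ y in Set.Ici (x + δ'), f y ∂(μ n)) := by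
    rw [← setLIntegral_univ]
    have hcover : (Set.univ : Set ℝ) ⊆
        Set.Iic (x - δ') ∪ (Set.Ioo (x - δ') (x + δ') ∪ Set.Ici (x + δ')) := by
      intro y _
      rcases le_or_gt y (x - δ') with hy | hy
      · exact Or.inl hy
      · rcases lt_or_ge y (x + δ') with hy' | hy'
        · exact Or.inr (Or.inl ⟨hy, hy'⟩)
        · exact Or.inr (Or.inr hy')
    refine (lintegral_mono_set hcover).trans ((lintegral_union_le _ _ _).trans ?_)
    gcongr
    exact lintegral_union_le _ _ _
  have hsum : ENNReal.ofReal (Real.exp (b n * (Λ - gap / 4)) / 2) ≤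
      ENNReal.ofReal (Real.exp (b n * (t * x + |t| * δ'))) * μ n (Set.Ioo (x - δ) (x + δ)) := by
    set X := Real.exp (b n * (Λ - gap / 4)) with hX
    have hX0 : 0 ≤ X := by positivity
    have hall := h0.1.trans (hsplit.trans (add_le_add hlo (add_le_add hmid hup)))
    have hXe : ENNReal.ofReal X =
        ENNReal.ofReal (X / 2) + (ENNReal.ofReal (X / 4) + ENNReal.ofReal (X / 4)) := by
      rw [← ENNReal.ofReal_add (by positivity) (by positivity),
        ← ENNReal.ofReal_add (by positivity) (by positivity)]
      congr 1; ring
    rw [hXe] at hall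
    refine (ENNReal.add_le_add_iff_right
      (a := ENNReal.ofReal (X / 4) + ENNReal.ofReal (X / 4)) (by finiteness)).1 (hall.trans_eq ?_)
    ring
  have hfac : ENNReal.ofReal (Real.exp (b n * (t * x + |t| * δ'))) *
      ENNReal.ofReal (Real.exp (b n * c)) ≤
        ENNReal.ofReal (Real.exp (b n * (Λ - gap / 4)) / 2) := by
    rw [← ENNReal.ofReal_mul (by positivity), ← Real.exp_add]
    refine ENNReal.ofReal_le_ofReal ?_
    have hlog2 : Real.log 2 ≤ Real.log 4 := Real.log_le_log (by norm_num) (by norm_num)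
    rw [le_div_iff₀ (by norm_num)]
    calc _ = Real.exp (b n * (t * x + |t| * δ') + b n * c + Real.log 2) := by
          rw [Real.exp_add _ (Real.log 2), Real.exp_log (by norm_num)]
      _ ≤ _ := by
          refine Real.exp_le_exp.2 ?_
          have hΛx : Λ = x - α := by rw [hΛ, mul_sub, hxt, mul_one]
          nlinarith [mul_le_mul_of_nonneg_left hg3 hbn0.le]
  exact (ENNReal.mul_le_mul_iff_right (by simp [Real.exp_pos]) (by finiteness)).1 (hfac.trans hsum)

/-- The Gärtner–Ellis theorem for the logarithmic moment generating function of the Poisson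
distribution. -/
theorem HasPoissonLogMGF.satisfiesLDP {μ : ℕ → Measure ℝ} {b : ℕ → ℝ} {α : ℝ}
    (h : HasPoissonLogMGF μ b α) (hb : Tendsto b atTop atTop) (hα : 0 < α)
    (hμ : ∀ᶠ n in atTop, μ n Set.univ ≤ 1) :
    SatisfiesLDP μ b (poissonRate α) where
  speed := hb
  nonneg := poissonRate_nonneg hα
  lsc := lowerSemicontinuous_poissonRate hα
  lower G hG := by
    rw [EReal.neg_le]
    refine le_iInf₂ fun x hx => ?_
    rw [EReal.neg_le]
    rcases lt_or_ge x 0 with hx0 | hx0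
    · rw [poissonRate_of_neg hx0]; simp
    rw [poissonRate_of_nonneg hx0, ← EReal.coe_neg]
    refine le_of_forall_lt fun c hc => ?_
    obtain ⟨c', hc', hc'x⟩ := EReal.lt_iff_exists_real_btwn.1 hc
    refine hc'.trans_le (le_liminf_log_div hb ?_)
    rw [EReal.coe_lt_coe_iff] at hc'x
    -- the origin is approached by positive points, where the tilt is finite
    obtain ⟨z, hz, hzG, hzc⟩ : ∃ z > 0, z ∈ G ∧ c' < -(z * Real.log (z / α) - z + α) := by
      rcases hx0.eq_or_lt with rfl | hx0
      · have hcont := (continuous_mul_log_div_sub_add hα).neg.continuousAt (x := (0 : ℝ))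
        have h1 := hcont.eventually (lt_mem_nhds hc'x)
        have h2 : ∀ᶠ z in 𝓝[>] (0 : ℝ), z ∈ G ∧ c' < -(z * Real.log (z / α) - z + α) :=
          ((hG.eventually_mem hx).and h1).filter_mono nhdsWithin_le_nhds
        obtain ⟨z, hz, hz'⟩ := (h2.and self_mem_nhdsWithin).exists
        exact ⟨z, hz', hz⟩
      · exact ⟨x, hx0, hx, hc'x⟩
    obtain ⟨δ, hδ, hball⟩ := Metric.isOpen_iff.1 hG z hzG
    rw [Real.ball_eq_Ioo] at hball
    filter_upwards [h.eventually_le_ball hb hα hz hδ hzc] with n hn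
    exact hn.trans (measure_mono hball)
  upper F hF := by
    by_cases hαF : α ∈ F
    · have h0 : (⨅ x ∈ F, poissonRate α x) ≤ 0 := by
        refine (iInf₂_le α hαF).trans ?_
        rw [poissonRate_of_nonneg hα.le, div_self hα.ne']
        simp
      have h1 := limsup_log_div_le (u := fun n => μ n F) hb (c := 0) (by
        filter_upwards [hμ] with n hn
        simpa using (measure_mono (Set.subset_univ F)).trans hn)
      exact h1.trans (by simpa using EReal.neg_le_neg_iff.2 h0)
    -- the closed set is split at the mean, and each part lies in a half-line starting at its point
    -- that is closest to the mean
    · refine le_of_forall_gt fun c hc => ?_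
      obtain ⟨c₁, hc₁, hc₁c⟩ := EReal.lt_iff_exists_real_btwn.1 hc
      obtain ⟨c₂, hc₂, hc₂c⟩ := EReal.lt_iff_exists_real_btwn.1 hc₁
      rw [EReal.coe_lt_coe_iff] at hc₂c
      have hrate : ∀ x ∈ F, (-c₂ : ℝ) < poissonRate α x := fun x hx => by
        rw [EReal.coe_neg, EReal.neg_lt_comm]
        exact (EReal.neg_le_neg_iff.2 (iInf₂_le x hx)).trans_lt hc₂
      have hlow : ∀ᶠ n in atTop, μ n (F ∩ Set.Iic α) ≤ ENNReal.ofReal (Real.exp (b n * c₂)) := by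
        rcases (F ∩ Set.Iic α).eq_empty_or_nonempty with he | hne
        · simp [he]
        · have hbdd : BddAbove (F ∩ Set.Iic α) := ⟨α, fun y hy => hy.2⟩
          have hmem := (hF.inter isClosed_Iic).csSup_mem hne hbdd
          exact h.eventually_tail_le_rate hb hα (hF.inter isClosed_Iic).measurableSet
            (Or.inr ⟨hmem.2, fun y hy => le_csSup hbdd hy⟩) (hrate _ hmem.1)
      have hhigh : ∀ᶠ n in atTop, μ n (F ∩ Set.Ici α) ≤ ENNReal.ofReal (Real.exp (b n * c₂)) := by
        rcases (F ∩ Set.Ici α).eq_empty_or_nonempty with he | hne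
        · simp [he]
        · have hbdd : BddBelow (F ∩ Set.Ici α) := ⟨α, fun y hy => hy.2⟩
          have hmem := (hF.inter isClosed_Ici).csInf_mem hne hbdd
          exact h.eventually_tail_le_rate hb hα (hF.inter isClosed_Ici).measurableSet
            (Or.inl ⟨hmem.2, fun y hy => csInf_le hbdd hy⟩) (hrate _ hmem.1)
      refine lt_of_le_of_lt (limsup_log_div_le hb ?_) hc₁c
      filter_upwards [hlow, hhigh, hb.eventually_ge_atTop (Real.log 2 / (c₁ - c₂))] with n h1 h2 h3
      have hsub : F ⊆ F ∩ Set.Iic α ∪ F ∩ Set.Ici α := fun y hy =>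
        (le_total y α).imp (fun h => ⟨hy, h⟩) (fun h => ⟨hy, h⟩)
      refine (measure_mono hsub).trans ((measure_union_le _ _).trans ((add_le_add h1 h2).trans ?_))
      rw [← ENNReal.ofReal_add (by positivity) (by positivity), ← two_mul]
      refine ENNReal.ofReal_le_ofReal ?_
      rw [div_le_iff₀ (by linarith)] at h3
      calc _ = Real.exp (Real.log 2 + b n * c₂) := by
            rw [Real.exp_add, Real.exp_log (by norm_num)]
        _ ≤ _ := Real.exp_le_exp.2 (by linarith)

end LargeDeviations

/-! ### The toroidal metric -/

section TorusMetric

variable {d : ℕ}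

/-- The lift to `ℝ^d` of the difference `x - y`, displaced by the lattice vector `z`. -/
noncomputable def liftDiff (x y : Cube d) (z : Fin d → ℤ) : EuclideanSpace ℝ (Fin d) :=
  WithLp.toLp 2 (fun i => (x i : ℝ) - (y i : ℝ) + (z i : ℝ))

@[simp]
theorem liftDiff_apply (x y : Cube d) (z : Fin d → ℤ) (i : Fin d) :
    liftDiff x y z i = (x i : ℝ) - (y i : ℝ) + (z i : ℝ) := rfl

theorem torusDist_le (x y : Cube d) (z : Fin d → ℤ) : torusDist x y ≤ ‖liftDiff x y z‖ :=
  ciInf_le ⟨0, by rintro _ ⟨z, rfl⟩; positivity⟩ z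

theorem euclidean_norm_le_of_abs_le {v w : EuclideanSpace ℝ (Fin d)} (h : ∀ i, |v i| ≤ |w i|) :
    ‖v‖ ≤ ‖w‖ := by
  rw [EuclideanSpace.norm_eq, EuclideanSpace.norm_eq]
  refine Real.sqrt_le_sqrt (Finset.sum_le_sum fun i _ => ?_)
  exact pow_le_pow_left₀ (norm_nonneg _) (h i) 2

/-- The lattice vector realizing the minimum in `torusDist`. -/
noncomputable def nearestLattice (x y : Cube d) : Fin d → ℤ := fun i => -round ((x i : ℝ) - y i)

theorem torusDist_eq_norm (x y : Cube d) :
    torusDist x y = ‖liftDiff x y (nearestLattice x y)‖ := by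
  refine le_antisymm (torusDist_le x y _)
    (le_ciInf fun z => euclidean_norm_le_of_abs_le fun i => ?_)
  have := round_le ((x i : ℝ) - y i) (-z i)
  simpa [nearestLattice, sub_eq_add_neg] using this

theorem torusDist_eq_of_abs_le (x y : Cube d) {z : Fin d → ℤ}
    (hz : ∀ i, |liftDiff x y z i| ≤ 1 / 2) : torusDist x y = ‖liftDiff x y z‖ := by
  refine le_antisymm (torusDist_le x y _)
    (le_ciInf fun z' => euclidean_norm_le_of_abs_le fun i => ?_)
  by_cases h : z' i = z i
  · simp [h]
  · have h1 : (1 : ℝ) ≤ |((z' i - z i : ℤ) : ℝ)| := by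
      exact_mod_cast Int.one_le_abs (sub_ne_zero.2 h)
    have h2 : ((z' i - z i : ℤ) : ℝ) = liftDiff x y z' i - liftDiff x y z i := by simp
    have h3 := abs_sub (liftDiff x y z' i) (liftDiff x y z i)
    have h4 := hz i
    rw [h2] at h1
    change |liftDiff x y z i| ≤ |liftDiff x y z' i|
    linarith

theorem torusDist_nonneg (x y : Cube d) : 0 ≤ torusDist x y := by
  rw [torusDist_eq_norm]; positivity

@[simp]
theorem torusDist_self (x : Cube d) : torusDist x x = 0 := by
  refine le_antisymm ((torusDist_le x x 0).trans_eq ?_) (torusDist_nonneg x x)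
  rw [norm_eq_zero]
  ext i; simp

theorem torusDist_comm (x y : Cube d) : torusDist x y = torusDist y x := by
  have h : ∀ x y : Cube d, torusDist x y ≤ torusDist y x := fun x y => by
    rw [torusDist_eq_norm y x, ← norm_neg]
    refine (torusDist_le x y (-nearestLattice y x)).trans_eq (congrArg norm ?_)
    ext i; simp; ring
  exact le_antisymm (h x y) (h y x)

theorem torusDist_triangle (x y w : Cube d) : torusDist x w ≤ torusDist x y + torusDist y w := by
  rw [torusDist_eq_norm x y, torusDist_eq_norm y w]
  refine (torusDist_le x w (nearestLattice x y + nearestLattice y w)).trans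
    (le_trans (le_of_eq (congrArg norm ?_)) (norm_add_le _ _))
  ext i; simp; ring

theorem torusDist_le_sqrt (x y : Cube d) : torusDist x y ≤ √d := by
  refine (torusDist_le x y 0).trans ?_
  rw [EuclideanSpace.norm_eq]
  refine Real.sqrt_le_sqrt ?_
  calc _ ≤ ∑ _i : Fin d, (1 : ℝ) := by
        refine Finset.sum_le_sum fun i _ => ?_
        have h1 := (x i).2.1
        have h2 := (x i).2.2
        have h3 := (y i).2.1
        have h4 := (y i).2.2
        simp only [liftDiff_apply, Pi.zero_apply, Int.cast_zero, add_zero, Real.norm_eq_abs, sq_abs]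
        nlinarith
    _ = d := by simp

theorem measurable_torusDist : Measurable (fun p : Cube d × Cube d => torusDist p.1 p.2) := by
  refine Measurable.iInf fun z => ?_
  refine Measurable.norm ((WithLp.measurable_toLp 2 _).comp (measurable_pi_lambda _ fun i => ?_))
  have h1 : Measurable fun p : Cube d × Cube d => (p.1 i : ℝ) :=
    measurable_subtype_coe.comp ((measurable_pi_apply i).comp measurable_fst)
  have h2 : Measurable fun p : Cube d × Cube d => (p.2 i : ℝ) :=
    measurable_subtype_coe.comp ((measurable_pi_apply i).comp measurable_snd)
  exact (h1.sub h2).add_const _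

theorem measurableSet_torusDist_le (r : ℝ) :
    MeasurableSet {p : Cube d × Cube d | torusDist p.1 p.2 ≤ r} :=
  measurableSet_le measurable_torusDist measurable_const

theorem measurableSet_torusBall (x : Cube d) (r : ℝ) : MeasurableSet (torusBall x r) :=
  measurable_prodMk_left (measurableSet_torusDist_le r)

theorem mem_torusBall {x y : Cube d} {r : ℝ} : y ∈ torusBall x r ↔ torusDist x y ≤ r := Iff.rfl

theorem mem_torusBall_comm {x y : Cube d} {r : ℝ} : y ∈ torusBall x r ↔ x ∈ torusBall y r := by
  rw [mem_torusBall, mem_torusBall, torusDist_comm]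

theorem mem_torusBall_self {x : Cube d} {r : ℝ} (hr : 0 ≤ r) : x ∈ torusBall x r := by
  rwa [mem_torusBall, torusDist_self]

theorem torusBall_subset_torusBall {x y : Cube d} {r s : ℝ} (h : torusDist x y + s ≤ r) :
    torusBall y s ⊆ torusBall x r := fun w hw =>
  (torusDist_triangle x y w).trans ((add_le_add le_rfl hw).trans h)

end TorusMetric

/-! ### Volumes of toroidal balls and their differences -/

section Volume

/-- The fractional part maps any unit interval to the standard one, preserving length. -/
theorem measurePreserving_fract (t : ℝ) :
    MeasurePreserving (Int.fract : ℝ → ℝ) (volume.restrict (Set.Ioc t (t + 1)))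
      (volume.restrict (Set.Ioc 0 1)) := by
  set F : UnitAddCircle → ℝ := fun q => AddCircle.equivIco 1 0 q with hF
  have hFm : Measurable F :=
    measurable_subtype_coe.comp (AddCircle.measurableEquivIco 1 0).measurable
  have hfr : ∀ x : ℝ, F (x : UnitAddCircle) = Int.fract x := fun x => by
    have := AddCircle.coe_equivIco_mk_apply (p := (1 : ℝ)) x
    rw [div_one, mul_one] at this
    exact this
  -- the fractional part factors through the circle
  have hcomp : (Int.fract : ℝ → ℝ) = F ∘ ((↑) : ℝ → UnitAddCircle) := by
    funext x; exact (hfr x).symm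
  have hmap : ∀ t : ℝ, (volume.restrict (Set.Ioc t (t + 1))).map Int.fract = volume.map F := by
    intro t
    have h := UnitAddCircle.measurePreserving_mk t
    rw [hcomp, ← Measure.map_map hFm h.measurable, h.map_eq]
  refine ⟨measurable_fract, ?_⟩
  rw [hmap t, ← hmap 0, zero_add]
  have hid : (Int.fract : ℝ → ℝ) =ᵐ[volume.restrict (Set.Ioc (0 : ℝ) 1)] id := by
    rw [← Measure.restrict_congr_set Ico_ae_eq_Ioc]
    filter_upwards [ae_restrict_mem measurableSet_Ico] with x hx
    exact Int.fract_eq_self.2 hx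
  rw [Measure.map_congr hid, Measure.map_id]

/-- Measured from a fixed point, the representative of the difference closest to zero is uniform on
the centred unit interval. -/
theorem measurePreserving_sub_round (x : ℝ) :
    MeasurePreserving (fun y : unitInterval => (x - y) - round (x - (y : ℝ))) volume
      (volume.restrict (Set.Ioc (-(1 / 2)) (1 / 2))) := by
  set c := x + 1 / 2 with hc
  have h1 : MeasurePreserving (fun y : unitInterval => (y : ℝ)) volume
      (volume.restrict (Set.Icc 0 1)) := measurePreserving_subtype_coe measurableSet_Icc
  have h2 : MeasurePreserving (fun y : ℝ => c - y) (volume.restrict (Set.Icc 0 1))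
      (volume.restrict (Set.Icc (c - 1) c)) := by
    have h := (Measure.measurePreserving_sub_left volume c).restrict_preimage
      (measurableSet_Icc (a := c - 1) (b := c))
    have hpre : (fun y : ℝ => c - y) ⁻¹' Set.Icc (c - 1) c = Set.Icc 0 1 := by
      ext y; simp
    rwa [hpre] at h
  have h3 := measurePreserving_fract (c - 1)
  rw [sub_add_cancel, Measure.restrict_congr_set Ioc_ae_eq_Icc] at h3
  have h4 : MeasurePreserving (fun y : ℝ => y - 1 / 2) (volume.restrict (Set.Ioc 0 1))
      (volume.restrict (Set.Ioc (-(1 / 2)) (1 / 2))) := by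
    have h := (measurePreserving_sub_right volume (1 / 2 : ℝ)).restrict_preimage
      (measurableSet_Ioc (a := -(1 / 2 : ℝ)) (b := 1 / 2))
    have hpre : (fun y : ℝ => y - 1 / 2) ⁻¹' Set.Ioc (-(1 / 2)) (1 / 2) = Set.Ioc 0 1 := by
      ext y
      simp only [Set.mem_preimage, Set.mem_Ioc]
      constructor <;> rintro ⟨h1, h2⟩ <;> constructor <;> linarith
    rwa [hpre] at h
  have h := h4.comp (h3.comp (h2.comp h1))
  have hfun : ((fun y : ℝ => y - 1 / 2) ∘ (Int.fract : ℝ → ℝ) ∘ (fun y : ℝ => c - y) ∘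
      fun y : unitInterval => (y : ℝ)) = fun y : unitInterval => (x - y) - round (x - (y : ℝ)) := by
    funext y
    simp only [Function.comp_apply, Int.fract, hc, round_eq]
    rw [show x + 1 / 2 - (y : ℝ) = x - y + 1 / 2 by ring]
    ring
  rwa [hfun] at h

variable {d : ℕ}

theorem unitBallVolume_pos (d : ℕ) : 0 < unitBallVolume d :=
  ENNReal.toReal_pos (Metric.measure_closedBall_pos volume _ one_pos).ne'
    measure_closedBall_lt_top.ne

/-- A toroidal ball of radius below `1/2` has the volume of a Euclidean ball. -/
theorem volume_torusBall (x : Cube d) {r : ℝ} (hr : 0 ≤ r) (hr2 : r < 1 / 2) :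
    volume (torusBall x r) = ENNReal.ofReal (unitBallVolume d * r ^ d) := by
  set g : Cube d → Fin d → ℝ := fun y i => ((x i : ℝ) - y i) - round ((x i : ℝ) - y i) with hg
  have hgm : MeasurePreserving g volume
      (Measure.pi fun _ : Fin d => volume.restrict (Set.Ioc (-(1 / 2 : ℝ)) (1 / 2))) :=
    measurePreserving_pi _ _ fun i => measurePreserving_sub_round (x i)
  set S : Set (Fin d → ℝ) := WithLp.toLp 2 ⁻¹' Metric.closedBall (0 : EuclideanSpace ℝ (Fin d)) r
    with hS
  have hSm : MeasurableSet S := (WithLp.measurable_toLp 2 _) measurableSet_closedBall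
  have hpre : torusBall x r = g ⁻¹' S := by
    ext y
    rw [mem_torusBall, torusDist_eq_norm, Set.mem_preimage, hS, Set.mem_preimage,
      mem_closedBall_zero_iff]
    have : liftDiff x y (nearestLattice x y) = WithLp.toLp 2 (g y) := by
      ext i; simp [hg, nearestLattice, sub_eq_add_neg]
    rw [this]
  have hsub : S ⊆ Set.univ.pi fun _ => Set.Ioc (-(1 / 2 : ℝ)) (1 / 2) := by
    intro w hw i _
    have h1 := PiLp.norm_apply_le (WithLp.toLp 2 w : EuclideanSpace ℝ (Fin d)) i
    have h2 : ‖(WithLp.toLp 2 w : EuclideanSpace ℝ (Fin d))‖ ≤ r := mem_closedBall_zero_iff.1 hw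
    have h3 : |w i| < 1 / 2 := (h1.trans h2).trans_lt hr2
    exact ⟨(abs_lt.1 h3).1, (abs_lt.1 h3).2.le⟩
  rw [hpre, hgm.measure_preimage hSm.nullMeasurableSet, ← Measure.restrict_pi_pi,
    Measure.restrict_apply hSm, Set.inter_eq_left.2 hsub, ← volume_pi, hS,
    (PiLp.volume_preserving_toLp (Fin d)).measure_preimage
      measurableSet_closedBall.nullMeasurableSet,
    Measure.addHaar_closedBall' _ _ hr, finrank_euclideanSpace_fin, mul_comm,
    ENNReal.ofReal_mul (unitBallVolume_pos d).le, unitBallVolume,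
    ENNReal.ofReal_toReal measure_closedBall_lt_top.ne]

/-- The point of the cube obtained from `y` by translation by `w` modulo the lattice. -/
noncomputable def translate (y : Cube d) (w : EuclideanSpace ℝ (Fin d)) : Cube d := fun i =>
  ⟨Int.fract ((y i : ℝ) + w i), Int.fract_nonneg _, (Int.fract_lt_one _).le⟩

theorem exists_liftDiff_translate (x y : Cube d) (w : EuclideanSpace ℝ (Fin d)) (z : Fin d → ℤ) :
    ∃ z', liftDiff (translate y w) x z' = liftDiff y x z + w := by
  refine ⟨fun i => ⌊(y i : ℝ) + w i⌋ + z i, ?_⟩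
  ext i
  simp only [liftDiff_apply, translate, Int.fract, PiLp.add_apply]
  push_cast
  ring

/-- Of two balls with the same small radius, each contains a smaller ball outside the other. -/
theorem le_volume_torusBall_diff {x y : Cube d} {r ε : ℝ} (hr : 0 < r) (hr2 : r < 1 / 8)
    (hε : 0 < ε) (hε1 : ε ≤ 1) (hlo : ε * r ≤ torusDist x y) (hhi : torusDist x y ≤ 2 * r) :
    ENNReal.ofReal ((ε / 4) ^ d * (unitBallVolume d * r ^ d)) ≤
      volume (torusBall y r \ torusBall x r) := by
  have hεr : 0 < ε * r := by positivity
  have hεr1 : ε * r ≤ r := mul_le_of_le_one_left hr.le hε1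
  set u := liftDiff y x (nearestLattice y x) with hu
  have hun : ‖u‖ = torusDist x y := by rw [torusDist_comm, torusDist_eq_norm]
  have hu0 : 0 < ‖u‖ := by rw [hun]; linarith
  -- the small ball has its centre on the line from `x` through `y`, at distance `s` beyond `y`
  set s := r - ε * r / 4 with hs
  have hs0 : 0 < s := by rw [hs]; linarith
  set w : EuclideanSpace ℝ (Fin d) := (s / ‖u‖) • u with hw
  have hwn : ‖w‖ = s := by
    rw [hw, norm_smul, Real.norm_of_nonneg (by positivity), div_mul_cancel₀ _ hu0.ne']
  have huw : ‖u + w‖ = ‖u‖ + s := by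
    have : u + w = (1 + s / ‖u‖) • u := by rw [hw, add_smul, one_smul]
    rw [this, norm_smul, Real.norm_of_nonneg (by positivity), add_mul, one_mul,
      div_mul_cancel₀ _ hu0.ne']
  have h1 : torusDist (translate y w) y ≤ s := by
    obtain ⟨z', hz'⟩ := exists_liftDiff_translate y y w 0
    refine (torusDist_le _ _ z').trans ?_
    rw [hz', ← hwn]
    refine le_of_eq (congrArg norm ?_)
    ext i; simp
  have h2 : torusDist (translate y w) x = ‖u‖ + s := by
    obtain ⟨z', hz'⟩ := exists_liftDiff_translate x y w (nearestLattice y x)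
    -- the representative `u + w` is the shortest because `2 r + r < 1 / 2`
    rw [torusDist_eq_of_abs_le (z := z'), hz', ← hu, huw]
    intro i
    rw [hz']
    have := PiLp.norm_apply_le (u + w) i
    rw [huw, Real.norm_eq_abs] at this
    linarith
  have hsub : torusBall (translate y w) (ε / 4 * r) ⊆ torusBall y r \ torusBall x r := by
    intro q hq
    rw [mem_torusBall] at hq
    refine ⟨?_, fun hqx => ?_⟩
    · have := torusDist_triangle y (translate y w) q
      rw [torusDist_comm y (translate y w)] at this
      rw [mem_torusBall]
      linarith
    · have := torusDist_triangle (translate y w) q x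
      rw [mem_torusBall, torusDist_comm] at hqx
      linarith
  refine le_trans (le_of_eq ?_) (measure_mono hsub)
  rw [volume_torusBall _ (by positivity) (by nlinarith), mul_pow]
  congr 1; ring

/-- A ball of radius `ρ r` is covered by a number, depending on `ρ` only, of sets of toroidal
diameter at most `r`. -/
theorem exists_cover_torusBall (d : ℕ) (ρ : ℝ) :
    ∃ C : ℕ, ∀ (x : Cube d) (r : ℝ), 0 < r → ∃ D : Fin C → Set (Cube d),
      torusBall x (ρ * r) ⊆ ⋃ i, D i ∧ ∀ i, ∀ y ∈ D i, ∀ y' ∈ D i, torusDist y y' ≤ r := by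
  obtain ⟨t, -, htfin, ht⟩ := finite_cover_balls_of_compact
    (isCompact_closedBall (0 : EuclideanSpace ℝ (Fin d)) ρ) (e := 1 / 2) (by norm_num)
  have := htfin.fintype
  refine ⟨Fintype.card t, fun x r hr => ⟨fun i =>
    {y | ∃ z, ‖liftDiff x y z - r • ((Fintype.equivFin t).symm i).1‖ ≤ r / 2}, ?_, ?_⟩⟩
  · intro y hy
    rw [mem_torusBall, torusDist_eq_norm] at hy
    set u := liftDiff x y (nearestLattice x y) with hu
    have hmem : r⁻¹ • u ∈ Metric.closedBall (0 : EuclideanSpace ℝ (Fin d)) ρ := by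
      rw [mem_closedBall_zero_iff, norm_smul, Real.norm_of_nonneg (by positivity),
        inv_mul_le_iff₀ hr]
      linarith
    obtain ⟨c, hc, hcu⟩ := Set.mem_iUnion₂.1 (ht hmem)
    rw [Metric.mem_ball, dist_eq_norm] at hcu
    refine Set.mem_iUnion.2 ⟨Fintype.equivFin t ⟨c, hc⟩, nearestLattice x y, ?_⟩
    rw [Equiv.symm_apply_apply, ← hu]
    have : u - r • c = r • (r⁻¹ • u - c) := by rw [smul_sub, smul_inv_smul₀ hr.ne']
    rw [this, norm_smul, Real.norm_of_nonneg hr.le]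
    nlinarith
  · rintro i y ⟨z, hz⟩ y' ⟨z', hz'⟩
    refine (torusDist_le y y' (z' - z)).trans ?_
    have : liftDiff y y' (z' - z) =
        (liftDiff x y' z' - r • ((Fintype.equivFin t).symm i).1) -
          (liftDiff x y z - r • ((Fintype.equivFin t).symm i).1) := by
      ext i; simp; ring
    rw [this]
    linarith [norm_sub_le (liftDiff x y' z' - r • ((Fintype.equivFin t).symm i).1)
      (liftDiff x y z - r • ((Fintype.equivFin t).symm i).1)]

end Volume

/-! ### Measurability on the space of finite measures -/

section FiniteMeasureSpace

variable {E : Type*} [MeasurableSpace E]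

/-- The unit point mass at `x`, as a finite measure. -/
noncomputable def pointMass (x : E) : FiniteMeasure E := ⟨Measure.dirac x, inferInstance⟩

@[simp]
theorem toMeasure_pointMass (x : E) : (pointMass x : Measure E) = Measure.dirac x := rfl

theorem measurable_toMeasure :
    Measurable (fun m : FiniteMeasure E => (m : Measure E)) := measurable_subtype_coe

theorem measurable_finiteMeasure_apply {A : Set E} (hA : MeasurableSet A) :
    Measurable (fun m : FiniteMeasure E => (m : Measure E) A) :=
  (Measure.measurable_coe hA).comp measurable_toMeasure

theorem measurable_finiteMeasure_of_apply {β : Type*} [MeasurableSpace β]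
    {f : β → FiniteMeasure E}
    (h : ∀ A, MeasurableSet A → Measurable (fun b => (f b : Measure E) A)) : Measurable f :=
  Measurable.subtype_mk (Measure.measurable_of_measurable_coe (fun b => (f b : Measure E)) h)

@[fun_prop]
theorem measurable_pointMass : Measurable (pointMass : E → FiniteMeasure E) :=
  Measurable.subtype_mk Measure.measurable_dirac

instance : MeasurableAdd₂ (FiniteMeasure E) := by
  refine ⟨measurable_finiteMeasure_of_apply fun A hA => ?_⟩
  simp only [FiniteMeasure.toMeasure_add, Measure.coe_add, Pi.add_apply]
  exact ((measurable_finiteMeasure_apply hA).comp measurable_fst).add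
    ((measurable_finiteMeasure_apply hA).comp measurable_snd)

theorem measurable_finiteMeasure_restrict {A : Set E} (hA : MeasurableSet A) :
    Measurable (fun m : FiniteMeasure E => m.restrict A) := by
  refine measurable_finiteMeasure_of_apply fun B hB => ?_
  simp only [FiniteMeasure.restrict_measure_eq, Measure.restrict_apply hB]
  exact measurable_finiteMeasure_apply (hB.inter hA)

/-- The tautological kernel from finite measures on `E` to `E`. -/
noncomputable def finiteMeasureKernel (E : Type*) [MeasurableSpace E] :
    Kernel (FiniteMeasure E) E := ⟨fun m => m, measurable_toMeasure⟩

@[simp]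
theorem finiteMeasureKernel_apply (m : FiniteMeasure E) : finiteMeasureKernel E m = m := rfl

-- The total mass is finite but unbounded, so the kernel is cut along the integer part of the mass.
instance : IsSFiniteKernel (finiteMeasureKernel E) := by
  classical
  set S : ℕ → Set (FiniteMeasure E) := fun n =>
    {m | (n : ℝ≥0∞) ≤ (m : Measure E) Set.univ ∧ (m : Measure E) Set.univ < n + 1} with hS
  have hSm : ∀ n, MeasurableSet (S n) := fun n =>
    (measurableSet_le measurable_const (measurable_finiteMeasure_apply .univ)).inter
      (measurableSet_lt (measurable_finiteMeasure_apply .univ) measurable_const)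
  set κ : ℕ → Kernel (FiniteMeasure E) E := fun n =>
    Kernel.piecewise (hSm n) (finiteMeasureKernel E) 0 with hκ
  have hfin : ∀ n, IsFiniteKernel (κ n) := fun n => by
    refine ⟨⟨n + 1, by simp, fun m => ?_⟩⟩
    by_cases hm : m ∈ S n
    · simpa [hκ, Kernel.piecewise_apply, hm] using hm.2.le
    · simp [hκ, Kernel.piecewise_apply, hm]
  have hsum : finiteMeasureKernel E = Kernel.sum κ := by
    ext m A hA
    rw [Kernel.sum_apply, Measure.sum_apply _ hA]
    set j := ⌊m.mass⌋₊ with hj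
    have hmass : (m : Measure E) Set.univ = (m.mass : ℝ≥0∞) := by simp
    have hmem : ∀ n, m ∈ S n ↔ n = j := fun n => by
      simp only [hS, Set.mem_ofPred_eq, hmass]
      rw [hj, eq_comm, Nat.floor_eq_iff zero_le]
      norm_cast
    rw [tsum_eq_single j]
    · simp [hκ, Kernel.piecewise_apply, (hmem j).2 rfl]
    · intro n hn
      simp [hκ, Kernel.piecewise_apply, mt (hmem n).1 hn]
  rw [hsum]
  infer_instance

theorem measurable_finiteMeasure_lintegral {β : Type*} [MeasurableSpace β]
    {m : β → FiniteMeasure E} (hm : Measurable m) {F : β → E → ℝ≥0∞}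
    (hF : Measurable (Function.uncurry F)) :
    Measurable (fun b => ∫⁻ x, F b x ∂(m b : Measure E)) :=
  Measurable.lintegral_kernel_prod_right (κ := (finiteMeasureKernel E).comap m hm) hF

theorem measurable_finiteMeasure_lintegral_id {F : FiniteMeasure E × E → ℝ≥0∞}
    (hF : Measurable F) :
    Measurable (fun m : FiniteMeasure E => ∫⁻ x, F (m, x) ∂(m : Measure E)) :=
  measurable_finiteMeasure_lintegral measurable_id (F := fun m x => F (m, x)) hF

theorem measurable_finiteMeasure_section {β : Type*} [MeasurableSpace β]
    {m : β → FiniteMeasure E} (hm : Measurable m) {S : Set (β × E)} (hS : MeasurableSet S) :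
    Measurable (fun b => (m b : Measure E) (Prod.mk b ⁻¹' S)) :=
  Kernel.measurable_kernel_prodMk_left (κ := (finiteMeasureKernel E).comap m hm) hS

end FiniteMeasureSpace

/-! ### The law of a Poisson process: superposition, Mecke formula, independence -/

section PoissonLaw

variable {E : Type*} [MeasurableSpace E]

/-- The image of `Λ^j` under `(x_1, …, x_j) ↦ δ_{x_1} + ⋯ + δ_{x_j}`. -/
noncomputable def tupleLaw (Λ : Measure E) : ℕ → Measure (FiniteMeasure E)
  | 0 => Measure.dirac 0
  | j + 1 => (Λ.prod (tupleLaw Λ j)).map (fun p => p.2 + pointMass p.1)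

variable (Λ : Measure E)

theorem isFiniteMeasure_tupleLaw [IsFiniteMeasure Λ] (j : ℕ) : IsFiniteMeasure (tupleLaw Λ j) := by
  induction j with
  | zero => rw [tupleLaw]; infer_instance
  | succ j ih => rw [tupleLaw]; infer_instance

instance [IsFiniteMeasure Λ] (j : ℕ) : IsFiniteMeasure (tupleLaw Λ j) :=
  isFiniteMeasure_tupleLaw Λ j

theorem lintegral_tupleLaw_zero {F : FiniteMeasure E → ℝ≥0∞} (hF : Measurable F) :
    ∫⁻ m, F m ∂(tupleLaw Λ 0) = F 0 := by
  rw [tupleLaw, lintegral_dirac' _ hF]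

theorem lintegral_tupleLaw_succ [IsFiniteMeasure Λ] {F : FiniteMeasure E → ℝ≥0∞}
    (hF : Measurable F) (j : ℕ) :
    ∫⁻ m, F m ∂(tupleLaw Λ (j + 1)) = ∫⁻ x, ∫⁻ m, F (m + pointMass x) ∂(tupleLaw Λ j) ∂Λ := by
  rw [tupleLaw, lintegral_map hF (by fun_prop), lintegral_prod _ (by fun_prop)]

/-- The law of the Poisson process with finite intensity measure `Λ`, on the space of finite
measures: a Poisson number of independent points with distribution proportional to `Λ`. -/
noncomputable def poissonLaw : Measure (FiniteMeasure E) :=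
  Measure.sum fun j : ℕ =>
    (ENNReal.ofReal (Real.exp (-(Λ Set.univ).toReal)) * ((j.factorial : ℝ≥0∞))⁻¹) • tupleLaw Λ j

theorem lintegral_poissonLaw (F : FiniteMeasure E → ℝ≥0∞) :
    ∫⁻ m, F m ∂(poissonLaw Λ) = ENNReal.ofReal (Real.exp (-(Λ Set.univ).toReal)) *
      ∑' j : ℕ, (j.factorial : ℝ≥0∞)⁻¹ * ∫⁻ m, F m ∂(tupleLaw Λ j) := by
  rw [poissonLaw, lintegral_sum_measure, ← ENNReal.tsum_mul_left]
  simp only [lintegral_smul_measure, smul_eq_mul, mul_assoc]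

variable [IsFiniteMeasure Λ]

/-- The binomial theorem for tuples of points drawn from a sum of two measures. -/
theorem lintegral_tupleLaw_add (Λ' : Measure E) [IsFiniteMeasure Λ'] (j : ℕ) :
    ∀ {F : FiniteMeasure E → ℝ≥0∞}, Measurable F →
    (j.factorial : ℝ≥0∞)⁻¹ * ∫⁻ m, F m ∂(tupleLaw (Λ + Λ') j) =
      ∑ p ∈ Finset.HasAntidiagonal.antidiagonal j,
        ((p.1.factorial : ℝ≥0∞)⁻¹ * (p.2.factorial : ℝ≥0∞)⁻¹) *
        ∫⁻ m, ∫⁻ m', F (m + m') ∂(tupleLaw Λ' p.2) ∂(tupleLaw Λ p.1) := by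
  induction j with
  | zero =>
    intro F hF
    have h : Measurable fun m => ∫⁻ m', F (m + m') ∂(tupleLaw Λ' 0) :=
      Measurable.lintegral_prod_right (f := fun m m' => F (m + m')) (by fun_prop)
    simp only [Finset.Nat.antidiagonal_zero, Finset.sum_singleton, lintegral_tupleLaw_zero _ hF,
      lintegral_tupleLaw_zero _ h]
    rw [lintegral_tupleLaw_zero _ (by fun_prop)]
    simp
  | succ j ih =>
    intro F hF
    have hinv : ∀ n : ℕ, ((n + 1).factorial : ℝ≥0∞)⁻¹ * (n + 1) = (n.factorial : ℝ≥0∞)⁻¹ := by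
      intro n
      rw [Nat.factorial_succ, Nat.cast_mul, ENNReal.mul_inv (by simp) (by simp), mul_assoc,
        mul_comm _ ((n : ℝ≥0∞) + 1), ← mul_assoc]
      push_cast
      rw [ENNReal.inv_mul_cancel (by simp) (by finiteness), one_mul]
    have hF' : ∀ x, Measurable fun m => F (m + pointMass x) := fun x => by fun_prop
    set A : ℕ → ℕ → ℝ≥0∞ := fun p q => ((p.factorial : ℝ≥0∞)⁻¹ * (q.factorial : ℝ≥0∞)⁻¹) *
      ∫⁻ m, ∫⁻ m', F (m + m') ∂(tupleLaw Λ' q) ∂(tupleLaw Λ p) with hA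
    have hmeas3 : ∀ (ν : Measure (FiniteMeasure E)) [SFinite ν],
        Measurable fun q : FiniteMeasure E × E => ∫⁻ m', F (q.1 + m' + pointMass q.2) ∂ν :=
      fun ν _ => Measurable.lintegral_prod_right
        (f := fun (q : FiniteMeasure E × E) m' => F (q.1 + m' + pointMass q.2)) (by fun_prop)
    -- adding a point drawn from `Λ` raises the first index, one from `Λ'` the second
    have h1 : ∀ p q, ∫⁻ x, ((p.factorial : ℝ≥0∞)⁻¹ * (q.factorial : ℝ≥0∞)⁻¹) *
        ∫⁻ m, ∫⁻ m', F (m + m' + pointMass x) ∂(tupleLaw Λ' q) ∂(tupleLaw Λ p) ∂Λ =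
        (p + 1) * A (p + 1) q := by
      intro p q
      rw [lintegral_const_mul _ ?_]
      swap
      · exact Measurable.lintegral_prod_left'
          (f := fun q' : FiniteMeasure E × E => ∫⁻ m', F (q'.1 + m' + pointMass q'.2) ∂_)
          (hmeas3 _)
      simp only [hA]
      rw [lintegral_tupleLaw_succ _ (Measurable.lintegral_prod_right
        (f := fun m m' => F (m + m')) (by fun_prop)), ← hinv p]
      rw [← mul_assoc, mul_comm ((p : ℝ≥0∞) + 1), mul_right_comm (_)⁻¹]
      simp only [add_right_comm]
    have h2 : ∀ p q, ∫⁻ x, ((p.factorial : ℝ≥0∞)⁻¹ * (q.factorial : ℝ≥0∞)⁻¹) *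
        ∫⁻ m, ∫⁻ m', F (m + m' + pointMass x) ∂(tupleLaw Λ' q) ∂(tupleLaw Λ p) ∂Λ' =
        (q + 1) * A p (q + 1) := by
      intro p q
      rw [lintegral_const_mul _ ?_]
      swap
      · exact Measurable.lintegral_prod_left'
          (f := fun q' : FiniteMeasure E × E => ∫⁻ m', F (q'.1 + m' + pointMass q'.2) ∂_)
          (hmeas3 _)
      simp only [hA]
      rw [lintegral_lintegral_swap
          (f := fun x m => ∫⁻ m', F (m + m' + pointMass x) ∂(tupleLaw Λ' q))
          ((Measurable.comp (hmeas3 _) measurable_swap).aemeasurable)]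
      have e : ∫⁻ m, ∫⁻ x, ∫⁻ m', F (m + m' + pointMass x) ∂(tupleLaw Λ' q) ∂Λ' ∂(tupleLaw Λ p) =
          ∫⁻ m, ∫⁻ m', F (m + m') ∂(tupleLaw Λ' (q + 1)) ∂(tupleLaw Λ p) := by
        refine lintegral_congr fun m => ?_
        rw [lintegral_tupleLaw_succ _ (by fun_prop)]
        simp only [add_assoc]
      rw [e, ← hinv q]
      ring
    have key : ((j : ℝ≥0∞) + 1) * (((j + 1).factorial : ℝ≥0∞)⁻¹ *
        ∫⁻ m, F m ∂(tupleLaw (Λ + Λ') (j + 1))) =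
        ((j : ℝ≥0∞) + 1) * ∑ p ∈ Finset.HasAntidiagonal.antidiagonal (j + 1), A p.1 p.2 := by
      rw [← mul_assoc, mul_comm ((j : ℝ≥0∞) + 1), hinv, lintegral_tupleLaw_succ _ hF,
        ← lintegral_const_mul _ (Measurable.lintegral_prod_right
          (f := fun x m => F (m + pointMass x)) (by fun_prop))]
      simp_rw [ih (hF' _)]
      rw [lintegral_finsetSum]
      swap
      · intro p _
        refine Measurable.const_mul ?_ _
        exact Measurable.lintegral_prod_left'
          (f := fun q' : FiniteMeasure E × E => ∫⁻ m', F (q'.1 + m' + pointMass q'.2) ∂_)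
          (hmeas3 _)
      simp_rw [lintegral_add_measure, h1, h2]
      rw [Finset.sum_add_distrib, Finset.mul_sum]
      have e : ∀ p ∈ Finset.HasAntidiagonal.antidiagonal (j + 1), ((j : ℝ≥0∞) + 1) * A p.1 p.2 =
          (p.1 : ℝ≥0∞) * A p.1 p.2 + (p.2 : ℝ≥0∞) * A p.1 p.2 := by
        intro p hp
        rw [← add_mul]
        congr 1
        rw [Finset.HasAntidiagonal.mem_antidiagonal] at hp
        exact_mod_cast hp.symm
      rw [Finset.sum_congr rfl e, Finset.sum_add_distrib]
      congr 1
      · rw [Finset.Nat.sum_antidiagonal_succ]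
        simp
      · rw [Finset.Nat.sum_antidiagonal_succ']
        simp
    exact (ENNReal.mul_right_inj (by simp) (by finiteness)).1 key

/-- The superposition of two independent Poisson processes is a Poisson process. -/
theorem lintegral_poissonLaw_add (Λ' : Measure E) [IsFiniteMeasure Λ']
    {F : FiniteMeasure E → ℝ≥0∞} (hF : Measurable F) :
    ∫⁻ m, F m ∂(poissonLaw (Λ + Λ')) =
      ∫⁻ m, ∫⁻ m', F (m + m') ∂(poissonLaw Λ') ∂(poissonLaw Λ) := by
  have hm : ∀ (ν : Measure (FiniteMeasure E)) [SFinite ν],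
      Measurable fun m : FiniteMeasure E => ∫⁻ m', F (m + m') ∂ν :=
    fun ν _ => Measurable.lintegral_prod_right (f := fun m m' => F (m + m')) (by fun_prop)
  simp_rw [lintegral_poissonLaw Λ']
  rw [lintegral_const_mul _ (Measurable.tsum fun j => (hm _).const_mul _),
    lintegral_tsum fun j => ((hm _).const_mul _).aemeasurable]
  simp_rw [lintegral_const_mul _ (hm _), lintegral_poissonLaw]
  have hexp : ENNReal.ofReal (Real.exp (-((Λ + Λ') Set.univ).toReal)) =
      ENNReal.ofReal (Real.exp (-(Λ' Set.univ).toReal)) *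
        ENNReal.ofReal (Real.exp (-(Λ Set.univ).toReal)) := by
    rw [← ENNReal.ofReal_mul (by positivity), ← Real.exp_add, Measure.add_apply,
      ENNReal.toReal_add (by finiteness) (by finiteness)]
    congr 2; ring
  rw [hexp, mul_assoc]
  congr 1
  simp_rw [lintegral_tupleLaw_add Λ Λ' _ hF]
  set f : ℕ × ℕ → ℝ≥0∞ := fun p => ((p.1.factorial : ℝ≥0∞)⁻¹ * (p.2.factorial : ℝ≥0∞)⁻¹) *
    ∫⁻ m, ∫⁻ m', F (m + m') ∂(tupleLaw Λ' p.2) ∂(tupleLaw Λ p.1) with hf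
  calc _ = ENNReal.ofReal (Real.exp (-(Λ Set.univ).toReal)) *
        ∑' j : ℕ, ∑' p : Finset.HasAntidiagonal.antidiagonal j, f p := by
        congr 1
        refine tsum_congr fun j => ?_
        rw [tsum_fintype, Finset.univ_eq_attach, Finset.sum_attach _ f]
    _ = ENNReal.ofReal (Real.exp (-(Λ Set.univ).toReal)) * ∑' p : ℕ × ℕ, f p := by
        rw [← ENNReal.tsum_sigma (f := fun (j : ℕ) (p : Finset.HasAntidiagonal.antidiagonal j) =>
          f p),
          ← Finset.HasAntidiagonal.sigmaAntidiagonalEquivProd.tsum_eq f]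
        rfl
    _ = _ := by
        rw [ENNReal.tsum_prod', ENNReal.tsum_comm, ← ENNReal.tsum_mul_left]
        refine congrArg (fun f : ℕ → ℝ≥0∞ => ∑' l, f l) (funext fun l => ?_)
        rw [mul_left_comm]
        congr 1
        rw [← ENNReal.tsum_mul_left]
        refine congrArg (fun f : ℕ → ℝ≥0∞ => ∑' l, f l) (funext fun p => ?_)
        rw [hf, ← mul_assoc, mul_comm (_)⁻¹ (_)⁻¹]

theorem lintegral_tupleLaw_mass {F : ℝ≥0∞ → ℝ≥0∞} (hF : Measurable F) (j : ℕ) :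
    ∫⁻ m, F ((m : Measure E) Set.univ) ∂(tupleLaw Λ j) = Λ Set.univ ^ j * F j := by
  have hFm {F : ℝ≥0∞ → ℝ≥0∞} (hF : Measurable F) :
      Measurable fun m : FiniteMeasure E => F ((m : Measure E) Set.univ) :=
    hF.comp (measurable_finiteMeasure_apply .univ)
  induction j generalizing F with
  | zero =>
    rw [lintegral_tupleLaw_zero _ (hFm hF)]
    simp
  | succ j ih =>
    rw [lintegral_tupleLaw_succ _ (hFm hF)]
    simp only [FiniteMeasure.toMeasure_add, toMeasure_pointMass, Measure.add_apply, measure_univ]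
    rw [ih (F := fun y => F (y + 1)) (hF.comp (measurable_id.add_const 1)), lintegral_const]
    push_cast
    ring

theorem lintegral_poissonMeasure (r : ℝ≥0) (f : ℕ → ℝ≥0∞) :
    ∫⁻ j, f j ∂(poissonMeasure r) = ENNReal.ofReal (Real.exp (-r)) *
      ∑' j : ℕ, (j.factorial : ℝ≥0∞)⁻¹ * ((r : ℝ≥0∞) ^ j * f j) := by
  rw [poissonMeasure, lintegral_sum_measure, ← ENNReal.tsum_mul_left]
  refine tsum_congr fun j => ?_
  rw [lintegral_smul_measure, lintegral_dirac, smul_eq_mul, mul_div_assoc,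
    ENNReal.ofReal_mul (by positivity), ENNReal.ofReal_div_of_pos (by positivity),
    ENNReal.div_eq_inv_mul, ENNReal.ofReal_natCast, ENNReal.ofReal_pow (by positivity),
    ENNReal.ofReal_coe_nnreal]
  ring

theorem lintegral_poissonLaw_mass {F : ℝ≥0∞ → ℝ≥0∞} (hF : Measurable F) :
    ∫⁻ m, F ((m : Measure E) Set.univ) ∂(poissonLaw Λ) =
      ∫⁻ j : ℕ, F j ∂(poissonMeasure (Λ Set.univ).toNNReal) := by
  rw [lintegral_poissonLaw, lintegral_poissonMeasure]
  simp_rw [lintegral_tupleLaw_mass Λ hF]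
  rw [ENNReal.coe_toNNReal (by finiteness)]
  rfl

instance : IsProbabilityMeasure (poissonLaw Λ) := ⟨by
  have := lintegral_poissonLaw_mass Λ (F := fun _ => 1) measurable_const
  simpa using this⟩

/-- The Mecke formula for a fixed number of points: the `j + 1` points play the same role. -/
theorem lintegral_tupleLaw_mecke (j : ℕ) :
    ∀ {F : E → FiniteMeasure E → ℝ≥0∞}, Measurable (Function.uncurry F) →
    ∫⁻ m, ∫⁻ x, F x m ∂(m : Measure E) ∂(tupleLaw Λ (j + 1)) =
      (j + 1) * ∫⁻ x, ∫⁻ m, F x (m + pointMass x) ∂(tupleLaw Λ j) ∂Λ := by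
  have hstep : ∀ (j : ℕ) {F : E → FiniteMeasure E → ℝ≥0∞}, Measurable (Function.uncurry F) →
      ∫⁻ m, ∫⁻ x, F x m ∂(m : Measure E) ∂(tupleLaw Λ (j + 1)) =
      ∫⁻ y, ∫⁻ m, ∫⁻ x, F x (m + pointMass y) ∂(m : Measure E) ∂(tupleLaw Λ j) ∂Λ +
        ∫⁻ y, ∫⁻ m, F y (m + pointMass y) ∂(tupleLaw Λ j) ∂Λ := by
    intro j F hF
    have hF' : Measurable fun p : FiniteMeasure E × E => F p.2 p.1 := hF.comp measurable_swap
    have hd : Measurable fun p : E × FiniteMeasure E => F p.1 (p.2 + pointMass p.1) :=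
      hF.comp (f := fun p : E × FiniteMeasure E => (p.1, p.2 + pointMass p.1)) (by fun_prop)
    rw [lintegral_tupleLaw_succ _ (measurable_finiteMeasure_lintegral_id hF'),
      ← lintegral_add_right _ hd.lintegral_prod_right']
    refine lintegral_congr fun y => ?_
    have hdy : Measurable fun m => F y (m + pointMass y) := hd.comp measurable_prodMk_left
    dsimp only
    rw [← lintegral_add_right _ hdy]
    refine lintegral_congr fun m => ?_
    have hmx : Measurable fun x => F x (m + pointMass y) := hF.comp measurable_prodMk_right
    rw [FiniteMeasure.toMeasure_add, lintegral_add_measure, toMeasure_pointMass,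
      lintegral_dirac' _ hmx]
  induction j with
  | zero =>
    intro F hF
    rw [hstep 0 hF]
    have : ∀ y, ∫⁻ m, ∫⁻ x, F x (m + pointMass y) ∂(m : Measure E) ∂(tupleLaw Λ 0) = 0 := by
      intro y
      have hm : Measurable fun p : FiniteMeasure E × E => F p.2 (p.1 + pointMass y) :=
        hF.comp (f := fun p : FiniteMeasure E × E => (p.2, p.1 + pointMass y)) (by fun_prop)
      rw [lintegral_tupleLaw_zero _ (measurable_finiteMeasure_lintegral_id hm)]
      simp
    simp [this]
  | succ j ih =>
    intro F hF
    rw [hstep _ hF]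
    have h1 : ∀ y, ∫⁻ m, ∫⁻ x, F x (m + pointMass y) ∂(m : Measure E) ∂(tupleLaw Λ (j + 1)) =
        (j + 1) * ∫⁻ x, ∫⁻ m, F x (m + pointMass x + pointMass y) ∂(tupleLaw Λ j) ∂Λ := fun y =>
      ih (F := fun x m => F x (m + pointMass y))
        (hF.comp (f := fun p : E × FiniteMeasure E => (p.1, p.2 + pointMass y)) (by fun_prop))
    have hm3 : Measurable fun q : (E × E) × FiniteMeasure E =>
        F q.1.2 (q.2 + pointMass q.1.2 + pointMass q.1.1) :=
      hF.comp (f := fun q : (E × E) × FiniteMeasure E =>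
        (q.1.2, q.2 + pointMass q.1.2 + pointMass q.1.1)) (by fun_prop)
    have hm2 : Measurable fun q : E × E =>
        ∫⁻ m, F q.2 (m + pointMass q.2 + pointMass q.1) ∂(tupleLaw Λ j) :=
      hm3.lintegral_prod_right'
    simp_rw [h1]
    rw [lintegral_const_mul _ hm2.lintegral_prod_right', lintegral_lintegral_swap hm2.aemeasurable]
    have h2 : ∀ x, ∫⁻ m, F x (m + pointMass x) ∂(tupleLaw Λ (j + 1)) =
        ∫⁻ y, ∫⁻ m, F x (m + pointMass x + pointMass y) ∂(tupleLaw Λ j) ∂Λ := by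
      intro x
      have hm : Measurable fun m : FiniteMeasure E => F x (m + pointMass x) :=
        hF.comp (f := fun m : FiniteMeasure E => (x, m + pointMass x)) (by fun_prop)
      rw [lintegral_tupleLaw_succ _ hm]
      simp only [add_right_comm]
    simp_rw [h2]
    push_cast
    ring

/-- The Mecke formula for the Poisson process. -/
theorem lintegral_poissonLaw_mecke {F : E → FiniteMeasure E → ℝ≥0∞}
    (hF : Measurable (Function.uncurry F)) :
    ∫⁻ m, ∫⁻ x, F x m ∂(m : Measure E) ∂(poissonLaw Λ) =
      ∫⁻ x, ∫⁻ m, F x (m + pointMass x) ∂(poissonLaw Λ) ∂Λ := by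
  have hd : Measurable fun p : E × FiniteMeasure E => F p.1 (p.2 + pointMass p.1) :=
    hF.comp (f := fun p : E × FiniteMeasure E => (p.1, p.2 + pointMass p.1)) (by fun_prop)
  have hF' : Measurable fun p : FiniteMeasure E × E => F p.2 p.1 := hF.comp measurable_swap
  have hz : ∫⁻ m, ∫⁻ x, F x m ∂(m : Measure E) ∂(tupleLaw Λ 0) = 0 := by
    rw [lintegral_tupleLaw_zero _ (measurable_finiteMeasure_lintegral_id hF')]
    simp
  simp_rw [lintegral_poissonLaw]
  rw [lintegral_const_mul _ (Measurable.tsum fun j => hd.lintegral_prod_right'.const_mul _),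
    lintegral_tsum fun j => (hd.lintegral_prod_right'.const_mul _).aemeasurable,
    tsum_eq_zero_add' ENNReal.summable, hz, mul_zero, zero_add]
  congr 1
  refine tsum_congr fun j => ?_
  rw [lintegral_tupleLaw_mecke _ _ hF, lintegral_const_mul _ hd.lintegral_prod_right', ← mul_assoc]
  congr 1
  rw [Nat.factorial_succ, Nat.cast_mul, ENNReal.mul_inv (by simp) (by simp), mul_comm,
    ← mul_assoc]
  push_cast
  rw [ENNReal.mul_inv_cancel (by simp) (by finiteness), one_mul]

theorem poissonLaw_ae_apply_eq_zero {A : Set E} (hA : MeasurableSet A) (hΛ : Λ A = 0) :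
    ∀ᵐ m : FiniteMeasure E ∂(poissonLaw Λ), (m : Measure E) A = 0 := by
  have h := lintegral_poissonLaw_mecke Λ (F := fun x _ => A.indicator 1 x)
    ((measurable_one.indicator hA).comp measurable_fst)
  simp only [lintegral_indicator_one hA, lintegral_const, measure_univ, mul_one, hΛ] at h
  exact (lintegral_eq_zero_iff (measurable_finiteMeasure_apply hA)).1 h

/-- The parts of a Poisson process in a set and in its complement are independent Poisson
processes. -/
theorem lintegral_poissonLaw_restrict_compl {A : Set E} (hA : MeasurableSet A)
    {F : FiniteMeasure E → FiniteMeasure E → ℝ≥0∞} (hF : Measurable (Function.uncurry F)) :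
    ∫⁻ m, F (m.restrict A) (m.restrict Aᶜ) ∂(poissonLaw Λ) =
      ∫⁻ m, ∫⁻ m', F m m' ∂(poissonLaw (Λ.restrict Aᶜ)) ∂(poissonLaw (Λ.restrict A)) := by
  have hG : Measurable fun m : FiniteMeasure E => F (m.restrict A) (m.restrict Aᶜ) :=
    hF.comp ((measurable_finiteMeasure_restrict hA).prodMk
      (measurable_finiteMeasure_restrict hA.compl))
  conv_lhs => rw [← Measure.restrict_add_restrict_compl (μ := Λ) hA]
  rw [lintegral_poissonLaw_add _ _ hG]
  refine lintegral_congr_ae ?_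
  filter_upwards [poissonLaw_ae_apply_eq_zero (Λ.restrict A) hA.compl
    (by rw [Measure.restrict_apply hA.compl]; simp)] with m hm
  refine lintegral_congr_ae ?_
  filter_upwards [poissonLaw_ae_apply_eq_zero (Λ.restrict Aᶜ) hA
    (by rw [Measure.restrict_apply hA]; simp)] with m' hm'
  have e1 : (m + m').restrict A = m := by
    apply FiniteMeasure.toMeasure_injective
    rw [FiniteMeasure.restrict_measure_eq, FiniteMeasure.toMeasure_add, Measure.restrict_add,
      Measure.restrict_eq_zero.2 hm', add_zero, Measure.restrict_eq_self_of_ae_mem]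
    exact hm
  have e2 : (m + m').restrict Aᶜ = m' := by
    apply FiniteMeasure.toMeasure_injective
    rw [FiniteMeasure.restrict_measure_eq, FiniteMeasure.toMeasure_add, Measure.restrict_add,
      Measure.restrict_eq_zero.2 hm, zero_add, Measure.restrict_eq_self_of_ae_mem]
    rw [ae_iff]
    simpa using hm'
  rw [e1, e2]

theorem lintegral_poissonLaw_restrict {A : Set E} (hA : MeasurableSet A)
    {F : FiniteMeasure E → ℝ≥0∞} (hF : Measurable F) :
    ∫⁻ m, F (m.restrict A) ∂(poissonLaw Λ) = ∫⁻ m, F m ∂(poissonLaw (Λ.restrict A)) := by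
  rw [lintegral_poissonLaw_restrict_compl Λ hA (F := fun m _ => F m) (hF.comp measurable_fst)]
  simp

theorem lintegral_poissonLaw_mul_restrict_compl {A : Set E} (hA : MeasurableSet A)
    {F G : FiniteMeasure E → ℝ≥0∞} (hF : Measurable F) (hG : Measurable G) :
    ∫⁻ m, F (m.restrict A) * G (m.restrict Aᶜ) ∂(poissonLaw Λ) =
      (∫⁻ m, F (m.restrict A) ∂(poissonLaw Λ)) * ∫⁻ m, G (m.restrict Aᶜ) ∂(poissonLaw Λ) := by
  rw [lintegral_poissonLaw_restrict_compl Λ hA (F := fun m m' => F m * G m')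
    ((hF.comp measurable_fst).mul (hG.comp measurable_snd)),
    lintegral_poissonLaw_restrict Λ hA hF, lintegral_poissonLaw_restrict Λ hA.compl hG]
  simp_rw [lintegral_const_mul _ hG]
  rw [lintegral_mul_const _ hF]

/-- The number of points of a Poisson process in a set has a Poisson distribution. -/
theorem lintegral_poissonLaw_apply {A : Set E} (hA : MeasurableSet A) {F : ℝ≥0∞ → ℝ≥0∞}
    (hF : Measurable F) :
    ∫⁻ m, F ((m : Measure E) A) ∂(poissonLaw Λ) =
      ∫⁻ j : ℕ, F j ∂(poissonMeasure (Λ A).toNNReal) := by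
  have h := lintegral_poissonLaw_restrict Λ hA
    (F := fun m => F ((m : Measure E) Set.univ)) (hF.comp (measurable_finiteMeasure_apply .univ))
  rw [lintegral_poissonLaw_mass _ hF] at h
  simpa using h

/-- The numbers of points in disjoint sets are independent. -/
theorem lintegral_poissonLaw_prod {ι : Type*} (s : Finset ι) {A : ι → Set E}
    (hA : ∀ i, MeasurableSet (A i)) (hd : Pairwise (fun i j => Disjoint (A i) (A j)))
    {F : ι → ℝ≥0∞ → ℝ≥0∞} (hF : ∀ i, Measurable (F i)) :
    ∫⁻ m, ∏ i ∈ s, F i ((m : Measure E) (A i)) ∂(poissonLaw Λ) =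
      ∏ i ∈ s, ∫⁻ m, F i ((m : Measure E) (A i)) ∂(poissonLaw Λ) := by
  classical
  induction s using Finset.induction_on with
  | empty => simp
  | insert i s hi ih =>
    rw [Finset.prod_insert hi, ← ih]
    have h := lintegral_poissonLaw_mul_restrict_compl Λ (hA i)
      (F := fun m => F i ((m : Measure E) (A i)))
      (G := fun m => ∏ j ∈ s, F j ((m : Measure E) (A j)))
      ((hF i).comp (measurable_finiteMeasure_apply (hA i)))
      (Finset.measurable_fun_prod _ fun j _ => (hF j).comp (measurable_finiteMeasure_apply (hA j)))
    have e1 : ∀ m : FiniteMeasure E, (m.restrict (A i) : Measure E) (A i) = (m : Measure E) (A i) :=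
      fun m => by simp
    have e2 : ∀ m : FiniteMeasure E, ∏ j ∈ s, F j ((m.restrict (A i)ᶜ : Measure E) (A j)) =
        ∏ j ∈ s, F j ((m : Measure E) (A j)) := fun m => by
      refine Finset.prod_congr rfl fun j hj => ?_
      have hij : j ≠ i := fun h => hi (h ▸ hj)
      rw [FiniteMeasure.restrict_measure_eq, Measure.restrict_apply (hA j),
        Set.inter_eq_left.2 (hd hij).subset_compl_right]
    simp only [e1, e2] at h
    rw [← h]
    refine lintegral_congr fun m => ?_
    rw [Finset.prod_insert hi]

end PoissonLaw

/-! ### Uniqueness of the law of a Poisson process -/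

section Uniqueness

variable {E : Type*} [MeasurableSpace E]

/-- Laws of random finite measures are determined by the joint laws of their values on finitely
many measurable sets. -/
theorem finiteMeasure_law_ext {Q Q' : Measure (FiniteMeasure E)} [IsFiniteMeasure Q]
    [IsFiniteMeasure Q']
    (h : ∀ I : Finset {A : Set E // MeasurableSet A},
      Q.map (fun (m : FiniteMeasure E) (A : I) => (m : Measure E) A.1.1) =
        Q'.map (fun (m : FiniteMeasure E) (A : I) => (m : Measure E) A.1.1)) : Q = Q' := by
  set φ : FiniteMeasure E → {A : Set E // MeasurableSet A} → ℝ≥0∞ :=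
    fun m A => (m : Measure E) A.1 with hφ
  have hφm : Measurable φ := measurable_pi_lambda _ fun A => measurable_finiteMeasure_apply A.2
  have hmap : Q.map φ = Q'.map φ := by
    refine IsProjectiveLimit.unique (P := fun I => (Q.map φ).map I.restrict) (fun I => rfl) ?_
    intro I
    dsimp only
    rw [Measure.map_map (Finset.measurable_restrict I) hφm,
      Measure.map_map (Finset.measurable_restrict I) hφm]
    exact (h I).symm
  have hcomap : ∀ S : Set (FiniteMeasure E), MeasurableSet S → ∃ S', MeasurableSet S' ∧
      φ ⁻¹' S' = S := by
    intro S hS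
    have hle : (inferInstance : MeasurableSpace (FiniteMeasure E)) ≤
        MeasurableSpace.comap φ inferInstance := by
      have : @Measurable _ _ (MeasurableSpace.comap φ inferInstance) _
          (fun m : FiniteMeasure E => (m : Measure E)) := by
        refine @Measure.measurable_of_measurable_coe _ _ _ (MeasurableSpace.comap φ inferInstance)
          _ fun A hA => ?_
        exact (measurable_pi_apply (⟨A, hA⟩ : {A : Set E // MeasurableSet A})).comp
          (comap_measurable φ)
      exact this.comap_le
    exact hle S hS
  ext S hS
  obtain ⟨S', hS', rfl⟩ := hcomap S hS
  rw [← Measure.map_apply hφm hS', hmap, Measure.map_apply hφm hS']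

/-- The cell of the partition generated by the sets `A ∈ I` on which the set of indices of the
sets containing a point is given by `σ`. -/
def atomOf (I : Finset {A : Set E // MeasurableSet A}) (σ : I → Bool) : Set E :=
  ⋂ A : I, if σ A then A.1.1 else A.1.1ᶜ

theorem measurableSet_atomOf (I : Finset {A : Set E // MeasurableSet A}) (σ : I → Bool) :
    MeasurableSet (atomOf I σ) := by
  refine MeasurableSet.iInter fun A => ?_
  split_ifs
  exacts [A.1.2, A.1.2.compl]

theorem mem_atomOf {I : Finset {A : Set E // MeasurableSet A}} {σ : I → Bool} {x : E} :
    x ∈ atomOf I σ ↔ ∀ A, (σ A = true ↔ x ∈ A.1.1) := by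
  simp only [atomOf, Set.mem_iInter]
  refine forall_congr' fun A => ?_
  cases σ A <;> simp

theorem disjoint_atomOf (I : Finset {A : Set E // MeasurableSet A}) {σ τ : I → Bool}
    (h : σ ≠ τ) : Disjoint (atomOf I σ) (atomOf I τ) := by
  refine Set.disjoint_left.2 fun x hx hx' => h (funext fun A => ?_)
  have := (mem_atomOf.1 hx A).trans (mem_atomOf.1 hx' A).symm
  exact Bool.eq_iff_iff.2 this

/-- Each set of the family is the disjoint union of the cells contained in it. -/
theorem measure_eq_sum_atomOf (I : Finset {A : Set E // MeasurableSet A}) (m : Measure E)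
    (A : I) : m A.1.1 = ∑ σ : I → Bool, if σ A then m (atomOf I σ) else 0 := by
  classical
  rw [← Finset.sum_filter, ← measure_biUnion_finset
    (fun σ _ τ _ h => disjoint_atomOf I h) (fun σ _ => measurableSet_atomOf I σ)]
  congr 1
  ext x
  simp only [Finset.mem_filter, Finset.mem_univ, true_and, Set.mem_iUnion, exists_prop]
  constructor
  · intro hx
    have hmem : x ∈ atomOf I (fun B => decide (x ∈ B.1.1)) := mem_atomOf.2 fun B => by simp
    exact ⟨_, by simpa using hx, hmem⟩
  · rintro ⟨σ, hσ, hx⟩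
    exact (mem_atomOf.1 hx A).1 hσ

/-- The number of points in a set has a Poisson distribution. -/
theorem poissonLaw_map_apply (Λ : Measure E) [IsFiniteMeasure Λ] {A : Set E}
    (hA : MeasurableSet A) :
    (poissonLaw Λ).map (fun m : FiniteMeasure E => (m : Measure E) A) =
      (poissonMeasure (Λ A).toNNReal).map (fun j : ℕ => (j : ℝ≥0∞)) := by
  ext S hS
  have h := lintegral_poissonLaw_apply Λ hA (F := S.indicator 1) (measurable_one.indicator hS)
  have hm := measurable_finiteMeasure_apply hA
  rw [Measure.map_apply hm hS, Measure.map_apply (by fun_prop) hS,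
    ← lintegral_indicator_one (hm hS),
    ← lintegral_indicator_one ((by fun_prop : Measurable fun j : ℕ => (j : ℝ≥0∞)) hS)]
  exact h

/-- A point process which has Poisson counts, independent over disjoint sets, and finite intensity
has the law `poissonLaw`. -/
theorem IsPoissonProcess.map_eq_poissonLaw {Ω : Type*} [MeasurableSpace Ω] {P : Measure Ω}
    [IsProbabilityMeasure P] {Λ : Measure E} [IsFiniteMeasure Λ] {η : Ω → Measure E}
    (hη : IsPoissonProcess P Λ η) {ζ : Ω → FiniteMeasure E} (hζ : Measurable ζ)
    (hζη : ∀ᵐ ω ∂P, (ζ ω : Measure E) = η ω) : P.map ζ = poissonLaw Λ := by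
  have : IsProbabilityMeasure (P.map ζ) := Measure.isProbabilityMeasure_map hζ.aemeasurable
  have hηm : ∀ A, MeasurableSet A → Measurable fun ω => η ω A := fun A hA =>
    (Measure.measurable_coe hA).comp hη.measurable
  refine finiteMeasure_law_ext fun I => ?_
  -- the values on the sets of `I` are sums of the values on the atoms
  set L : ((I → Bool) → ℝ≥0∞) → I → ℝ≥0∞ := fun v A => ∑ σ : I → Bool, if σ A then v σ else 0
    with hL
  have hLm : Measurable L := by
    refine measurable_pi_lambda _ fun A => Finset.measurable_fun_sum _ fun σ _ => ?_
    split_ifs <;> fun_prop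
  set V : Measure E → (I → Bool) → ℝ≥0∞ := fun m σ => m (atomOf I σ) with hV
  have hVm : Measurable fun m : FiniteMeasure E => V m :=
    measurable_pi_lambda _ fun σ => measurable_finiteMeasure_apply (measurableSet_atomOf I σ)
  have hVη : Measurable fun ω => V (η ω) :=
    measurable_pi_lambda _ fun σ => hηm _ (measurableSet_atomOf I σ)
  have hLV : (fun (m : FiniteMeasure E) (A : I) => (m : Measure E) A.1.1) =
      L ∘ (fun m : FiniteMeasure E => V m) := by
    funext m A
    exact measure_eq_sum_atomOf I m A
  rw [hLV, ← Measure.map_map hLm hVm, ← Measure.map_map hLm hVm]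
  congr 1
  rw [Measure.map_map hVm hζ]
  have e0 : P.map ((fun m : FiniteMeasure E => V m) ∘ ζ) = P.map (fun ω => V (η ω)) := by
    refine Measure.map_congr ?_
    filter_upwards [hζη] with ω hω
    simp [Function.comp, hω]
  rw [e0]
  have hind : iIndepFun (fun σ ω => η ω (atomOf I σ)) P := by
    have h := hη.indep _ (fun i => atomOf I ((Fintype.equivFin (I → Bool)).symm i))
      (fun i => measurableSet_atomOf I _)
      (fun i j hij => disjoint_atomOf I (by simpa using hij))
    have h' := h.precomp (Fintype.equivFin (I → Bool)).injective
    simpa using h'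
  have e1 := (iIndepFun_iff_map_fun_eq_pi_map
    (fun σ => (hηm _ (measurableSet_atomOf I σ)).aemeasurable)).1 hind
  rw [show (fun ω => V (η ω)) = fun ω σ => η ω (atomOf I σ) from rfl, e1]
  refine Measure.pi_eq fun s hs => ?_
  have h := lintegral_poissonLaw_prod Λ Finset.univ (A := atomOf I)
    (F := fun σ => (s σ).indicator 1)
    (fun σ => measurableSet_atomOf I σ) (fun σ τ h => disjoint_atomOf I h)
    (fun σ => measurable_one.indicator (hs σ))
  rw [Measure.map_apply hVm (MeasurableSet.univ_pi hs),
    ← lintegral_indicator_one (hVm (MeasurableSet.univ_pi hs))]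
  have e2 : ∀ m : FiniteMeasure E, ((fun m : FiniteMeasure E => V m) ⁻¹' Set.univ.pi s).indicator
      (1 : FiniteMeasure E → ℝ≥0∞) m = ∏ σ, (s σ).indicator 1 ((m : Measure E) (atomOf I σ)) := by
    intro m
    by_cases hm : ∀ σ, (m : Measure E) (atomOf I σ) ∈ s σ
    · rw [Set.indicator_of_mem (by simpa [hV] using hm)]
      exact (Finset.prod_eq_one fun σ _ => by simp [hm σ]).symm
    · rw [Set.indicator_of_notMem (by simpa [hV] using hm)]
      push Not at hm
      obtain ⟨σ, hσ⟩ := hm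
      exact (Finset.prod_eq_zero (Finset.mem_univ σ) (by simp [hσ])).symm
  simp_rw [e2]
  rw [h]
  refine Finset.prod_congr rfl fun σ _ => ?_
  rw [hη.poisson _ (measurableSet_atomOf I σ) (by finiteness),
    ← poissonLaw_map_apply Λ (measurableSet_atomOf I σ),
    Measure.map_apply (measurable_finiteMeasure_apply (measurableSet_atomOf I σ)) (hs σ),
    ← lintegral_indicator_one
      (measurable_finiteMeasure_apply (measurableSet_atomOf I σ) (hs σ))]
  rfl

end Uniqueness

/-! ### Low-degree points and local changes of a configuration -/

section LowDegree

variable {d : ℕ}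

/-- The set of locations whose closed `r`-ball has mass at most `k`. -/
def lowSet (k : ℕ) (r : ℝ) (m : Measure (Cube d)) : Set (Cube d) :=
  {x | m (torusBall x r) ≤ (k : ℝ≥0∞)}

theorem lowDegreeCount_eq (k : ℕ) (r : ℝ) (m : Measure (Cube d)) :
    lowDegreeCount k r m = m.real (lowSet k r m) := rfl

theorem mem_lowSet {k : ℕ} {r : ℝ} {m : Measure (Cube d)} {x : Cube d} :
    x ∈ lowSet k r m ↔ m (torusBall x r) ≤ k := Iff.rfl

theorem lowSet_anti (k : ℕ) (r : ℝ) {m m' : Measure (Cube d)} (h : m ≤ m') :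
    lowSet k r m' ⊆ lowSet k r m := fun _ hx => (h _).trans hx

theorem measurable_apply_torusBall (r : ℝ) :
    Measurable fun p : FiniteMeasure (Cube d) × Cube d => (p.1 : Measure (Cube d))
      (torusBall p.2 r) :=
  measurable_finiteMeasure_section (m := fun p : FiniteMeasure (Cube d) × Cube d => p.1)
    measurable_fst (S := {q | torusDist q.1.2 q.2 ≤ r})
    (((measurable_snd.comp measurable_fst).prodMk measurable_snd) (measurableSet_torusDist_le r))

theorem measurable_apply_torusBall_inter (r : ℝ) {A : Set (Cube d)} (hA : MeasurableSet A) :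
    Measurable fun p : FiniteMeasure (Cube d) × Cube d =>
      (p.1 : Measure (Cube d)) (torusBall p.2 r ∩ A) :=
  measurable_finiteMeasure_section (m := fun p : FiniteMeasure (Cube d) × Cube d => p.1)
    measurable_fst (S := {q | torusDist q.1.2 q.2 ≤ r ∧ q.2 ∈ A})
    ((((measurable_snd.comp measurable_fst).prodMk measurable_snd)
      (measurableSet_torusDist_le r)).inter (measurable_snd hA))

theorem measurableSet_mem_lowSet (k : ℕ) (r : ℝ) :
    MeasurableSet {p : FiniteMeasure (Cube d) × Cube d | p.2 ∈ lowSet k r p.1} :=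
  measurableSet_le (measurable_apply_torusBall r) measurable_const

theorem measurableSet_lowSet (k : ℕ) (r : ℝ) (m : Measure (Cube d)) [IsFiniteMeasure m] :
    MeasurableSet (lowSet k r m) :=
  (measurable_prodMk_left (x := (⟨m, inferInstance⟩ : FiniteMeasure (Cube d))))
    (measurableSet_mem_lowSet k r)

theorem measurable_apply_lowSet (k : ℕ) (r : ℝ) :
    Measurable fun m : FiniteMeasure (Cube d) => (m : Measure (Cube d)) (lowSet k r m) :=
  measurable_finiteMeasure_section measurable_id (measurableSet_mem_lowSet k r)

@[fun_prop]
theorem measurable_lowDegreeCount (k : ℕ) (r : ℝ) :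
    Measurable fun m : FiniteMeasure (Cube d) => lowDegreeCount k r (m : Measure (Cube d)) :=
  (measurable_apply_lowSet k r).ennreal_toReal

theorem lowDegreeCount_nonneg (k : ℕ) (r : ℝ) (m : Measure (Cube d)) :
    0 ≤ lowDegreeCount k r m := ENNReal.toReal_nonneg

/-- The number, depending on `ρ` only, of sets of toroidal diameter at most `r` that cover a ball of
radius `ρ r`. -/
noncomputable def coverNumber (d : ℕ) (ρ : ℝ) : ℕ := (exists_cover_torusBall d ρ).choose

/-- A ball of radius `ρ r` contains boundedly many low-degree points: two of them at distance at
most `r` share their neighbours. -/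
theorem measure_torusBall_inter_lowSet_le (k : ℕ) {r : ℝ} (hr : 0 < r) (ρ : ℝ)
    (m : Measure (Cube d)) (x : Cube d) :
    m (torusBall x (ρ * r) ∩ lowSet k r m) ≤ (coverNumber d ρ * k : ℕ) := by
  obtain ⟨D, hcov, hD⟩ : ∃ D : Fin (coverNumber d ρ) → Set (Cube d),
      torusBall x (ρ * r) ⊆ ⋃ i, D i ∧ ∀ i, ∀ y ∈ D i, ∀ y' ∈ D i, torusDist y y' ≤ r :=
    (exists_cover_torusBall d ρ).choose_spec x r hr
  have hsub : torusBall x (ρ * r) ∩ lowSet k r m ⊆ ⋃ i, (D i ∩ lowSet k r m) := by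
    rintro y ⟨hy, hy'⟩
    obtain ⟨i, hi⟩ := Set.mem_iUnion.1 (hcov hy)
    exact Set.mem_iUnion.2 ⟨i, hi, hy'⟩
  have hle : ∀ i, m (D i ∩ lowSet k r m) ≤ k := by
    intro i
    -- all points of `D i` are in the ball of a single low-degree point
    rcases (D i ∩ lowSet k r m).eq_empty_or_nonempty with he | ⟨y, hyD, hy⟩
    · simp [he]
    · exact (measure_mono fun y' hy' => hD i y hyD y' hy'.1).trans hy
  calc m (torusBall x (ρ * r) ∩ lowSet k r m) ≤ ∑ i, m (D i ∩ lowSet k r m) :=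
        (measure_mono hsub).trans (measure_iUnion_fintype_le m _)
    _ ≤ ∑ _i : Fin (coverNumber d ρ), (k : ℝ≥0∞) := Finset.sum_le_sum fun i _ => hle i
    _ = _ := by simp

/-- The number of low-degree points is bounded, for a fixed radius. -/
theorem exists_lowDegreeCount_le (d k : ℕ) {r : ℝ} (hr : 0 < r) :
    ∃ K : ℝ, ∀ m : Measure (Cube d), lowDegreeCount k r m ≤ K := by
  refine ⟨(coverNumber d (√d / r) * k : ℕ), fun m => ?_⟩
  have h := measure_torusBall_inter_lowSet_le k hr (√d / r) m (fun _ => 0)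
  rw [div_mul_cancel₀ _ hr.ne'] at h
  have huniv : torusBall (fun _ => 0 : Cube d) √d = Set.univ :=
    Set.eq_univ_of_forall fun y => torusDist_le_sqrt _ y
  rw [huniv, Set.univ_inter] at h
  simpa [lowDegreeCount_eq, Measure.real] using ENNReal.toReal_mono (by finiteness) h

/-- The effect of additional mass `m₂` on the number of low-degree points. -/
theorem lowDegreeCount_add (k : ℕ) (r : ℝ) (m₁ m₂ : Measure (Cube d)) [IsFiniteMeasure m₁]
    [IsFiniteMeasure m₂] :
    lowDegreeCount k r (m₁ + m₂) = lowDegreeCount k r m₁ + m₂.real (lowSet k r (m₁ + m₂)) -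
      m₁.real (lowSet k r m₁ \ lowSet k r (m₁ + m₂)) := by
  have hsub : lowSet k r (m₁ + m₂) ⊆ lowSet k r m₁ :=
    lowSet_anti k r (Measure.le_add_right le_rfl)
  rw [lowDegreeCount_eq, lowDegreeCount_eq, measureReal_add_apply,
    measureReal_sdiff hsub (measurableSet_lowSet k r _)]
  ring

/-- Additional mass in a ball only affects the degrees in the ball with radius enlarged by `r`. -/
theorem lowSet_diff_subset (k : ℕ) {r R : ℝ} {m₁ m₂ : Measure (Cube d)} {x : Cube d}
    (h : m₂ (torusBall x R)ᶜ = 0) :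
    lowSet k r m₁ \ lowSet k r (m₁ + m₂) ⊆ torusBall x (R + r) := by
  rintro y ⟨hy, hy'⟩
  by_contra hxy
  refine hy' ?_
  have hdisj : torusBall y r ⊆ (torusBall x R)ᶜ := by
    intro w hw hwx
    rw [mem_torusBall, not_le] at hxy
    have := torusDist_triangle x w y
    rw [torusDist_comm w y] at this
    rw [mem_torusBall] at hw hwx
    linarith
  rw [mem_lowSet, Measure.add_apply, measure_mono_null hdisj h, add_zero]
  exact hy

/-- Additional mass in a ball changes the number of low-degree points by a bounded amount. -/
theorem abs_lowDegreeCount_add_sub_le (k : ℕ) {r ρ : ℝ} (hr : 0 < r) {m₁ m₂ : Measure (Cube d)}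
    [IsFiniteMeasure m₁] [IsFiniteMeasure m₂] {x : Cube d}
    (h : m₂ (torusBall x (ρ * r))ᶜ = 0) :
    |lowDegreeCount k r (m₁ + m₂) - lowDegreeCount k r m₁| ≤
      (coverNumber d ρ * k : ℕ) + (coverNumber d (ρ + 1) * k : ℕ) := by
  have h1 : m₂.real (lowSet k r (m₁ + m₂)) ≤ (coverNumber d ρ * k : ℕ) := by
    have e : m₂ (lowSet k r (m₁ + m₂)) ≤ (coverNumber d ρ * k : ℕ) := by
      calc _ ≤ m₂ (torusBall x (ρ * r) ∩ lowSet k r (m₁ + m₂)) +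
            m₂ (torusBall x (ρ * r))ᶜ := by
            refine (measure_mono ?_).trans (measure_union_le _ _)
            intro y hy
            by_cases hyx : y ∈ torusBall x (ρ * r)
            · exact Or.inl ⟨hyx, hy⟩
            · exact Or.inr hyx
        _ ≤ (m₁ + m₂) (torusBall x (ρ * r) ∩ lowSet k r (m₁ + m₂)) := by
            rw [h, add_zero]
            exact Measure.le_add_left le_rfl _
        _ ≤ _ := measure_torusBall_inter_lowSet_le k hr ρ _ x
    exact (ENNReal.toReal_mono (by finiteness) e).trans_eq (by simp)
  have h2 : m₁.real (lowSet k r m₁ \ lowSet k r (m₁ + m₂)) ≤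
      (coverNumber d (ρ + 1) * k : ℕ) := by
    have e : m₁ (lowSet k r m₁ \ lowSet k r (m₁ + m₂)) ≤ (coverNumber d (ρ + 1) * k : ℕ) := by
      refine (measure_mono ?_).trans (measure_torusBall_inter_lowSet_le k hr (ρ + 1) m₁ x)
      intro y hy
      have := lowSet_diff_subset k h hy
      exact ⟨by rwa [add_mul, one_mul], hy.1⟩
    exact (ENNReal.toReal_mono (by finiteness) e).trans_eq (by simp)
  rw [lowDegreeCount_add]
  have h3 : 0 ≤ m₂.real (lowSet k r (m₁ + m₂)) := measureReal_nonneg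
  have h4 : 0 ≤ m₁.real (lowSet k r m₁ \ lowSet k r (m₁ + m₂)) := measureReal_nonneg
  rw [abs_le]
  constructor <;> linarith

/-- A bound, uniform in the radius, for the effect of changing a point configuration within three
radii of a location. -/
noncomputable def localBound (d k : ℕ) : ℝ :=
  ∑ ρ ∈ Finset.range 5, ((coverNumber d ρ * k : ℕ) : ℝ)

theorem localBound_nonneg (d k : ℕ) : 0 ≤ localBound d k :=
  Finset.sum_nonneg fun _ _ => by positivity

theorem abs_lowDegreeCount_add_sub_le_localBound (k : ℕ) {r : ℝ} (hr : 0 < r) {ρ : ℕ} (hρ : ρ ≤ 3)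
    {m₁ m₂ : Measure (Cube d)} [IsFiniteMeasure m₁] [IsFiniteMeasure m₂] {x : Cube d}
    (h : m₂ (torusBall x (ρ * r))ᶜ = 0) :
    |lowDegreeCount k r (m₁ + m₂) - lowDegreeCount k r m₁| ≤ localBound d k := by
  refine (abs_lowDegreeCount_add_sub_le k hr h).trans ?_
  have hsub : ({ρ, ρ + 1} : Finset ℕ) ⊆ Finset.range 5 := by
    intro i hi
    simp only [Finset.mem_insert, Finset.mem_singleton] at hi
    rw [Finset.mem_range]; omega
  have := Finset.sum_le_sum_of_subset_of_nonneg (f := fun ρ : ℕ => ((coverNumber d ρ * k : ℕ) : ℝ))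
    hsub (fun _ _ _ => by positivity)
  rw [Finset.sum_pair (by omega)] at this
  rw [localBound]
  push_cast at this ⊢
  exact this

theorem lowDegreeCount_restrict_add (k : ℕ) (r : ℝ) (m : Measure (Cube d)) {A : Set (Cube d)}
    (hA : MeasurableSet A) :
    lowDegreeCount k r m = lowDegreeCount k r (m.restrict Aᶜ + m.restrict A) := by
  rw [Measure.restrict_compl_add_restrict hA]

theorem abs_lowDegreeCount_sub_restrict_le (k : ℕ) {r : ℝ} (hr : 0 < r) {ρ : ℕ} (hρ : ρ ≤ 3)
    (m : Measure (Cube d)) [IsFiniteMeasure m] (x : Cube d) :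
    |lowDegreeCount k r m - lowDegreeCount k r (m.restrict (torusBall x (ρ * r))ᶜ)| ≤
      localBound d k := by
  have hA := measurableSet_torusBall x (ρ * r)
  rw [lowDegreeCount_restrict_add k r m hA]
  refine abs_lowDegreeCount_add_sub_le_localBound k hr hρ (x := x) ?_
  rw [Measure.restrict_apply hA.compl, Set.compl_inter_self, measure_empty]

theorem abs_lowDegreeCount_add_dirac_sub_le (k : ℕ) {r : ℝ} (hr : 0 < r)
    (m : Measure (Cube d)) [IsFiniteMeasure m] (x : Cube d) :
    |lowDegreeCount k r (m + Measure.dirac x) - lowDegreeCount k r m| ≤ localBound d k := by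
  refine abs_lowDegreeCount_add_sub_le_localBound k hr (ρ := 1) (by norm_num) (x := x) ?_
  rw [Measure.dirac_apply' _ (measurableSet_torusBall _ _).compl]
  simp [mem_torusBall, hr.le]

/-- The number of points `y` near `x` that could be of low degree, either in the whole
configuration, for `y` in the ball of `x`, or in the configuration outside the ball of `x`. -/
noncomputable def nearLowCount (k : ℕ) (r : ℝ) (x : Cube d) (m : Measure (Cube d)) : ℝ≥0∞ :=
  m (torusBall x r ∩ lowSet k r m) +
    m ((torusBall x (2 * r) \ torusBall x r) ∩ lowSet k r (m.restrict (torusBall x r)ᶜ))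

theorem measurable_nearLowCount (k : ℕ) (r : ℝ) (x : Cube d) :
    Measurable fun m : FiniteMeasure (Cube d) => nearLowCount k r x m := by
  have hB := measurableSet_torusBall x r
  refine Measurable.add ?_ ?_
  · exact measurable_finiteMeasure_section measurable_id
      (S := {p : FiniteMeasure (Cube d) × Cube d | p.2 ∈ torusBall x r ∧ p.2 ∈ lowSet k r p.1})
      ((measurable_snd hB).inter (measurableSet_mem_lowSet k r))
  · have hf : Measurable fun p : FiniteMeasure (Cube d) × Cube d =>
        (p.1.restrict (torusBall x r)ᶜ, p.2) :=
      ((measurable_finiteMeasure_restrict hB.compl).comp measurable_fst).prodMk measurable_snd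
    exact measurable_finiteMeasure_section measurable_id
      (S := {p : FiniteMeasure (Cube d) × Cube d | p.2 ∈ torusBall x (2 * r) \ torusBall x r ∧
        p.2 ∈ lowSet k r (p.1.restrict (torusBall x r)ᶜ : FiniteMeasure (Cube d))})
      ((measurable_snd ((measurableSet_torusBall x (2 * r)).diff hB)).inter
        (hf (measurableSet_mem_lowSet k r)))

/-- `nearLowCount` only depends on the configuration within three radii. -/
theorem nearLowCount_restrict (k : ℕ) {r : ℝ} (hr : 0 < r) (x : Cube d) (m : Measure (Cube d))
    [IsFiniteMeasure m] :
    nearLowCount k r x (m.restrict (torusBall x (3 * r))) = nearLowCount k r x m := by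
  have hball : ∀ {y : Cube d}, y ∈ torusBall x (2 * r) → torusBall y r ⊆ torusBall x (3 * r) :=
    fun {y} hy => torusBall_subset_torusBall (by rw [mem_torusBall] at hy; linarith)
  have h12 : torusBall x r ⊆ torusBall x (2 * r) :=
    torusBall_subset_torusBall (by rw [torusDist_self]; linarith)
  have h23 : torusBall x (2 * r) ⊆ torusBall x (3 * r) :=
    torusBall_subset_torusBall (by rw [torusDist_self]; linarith)
  set W := torusBall x (3 * r) with hW
  have hWm : MeasurableSet W := measurableSet_torusBall _ _
  have happ : ∀ (m : Measure (Cube d)) {y : Cube d}, y ∈ torusBall x (2 * r) →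
      m.restrict W (torusBall y r) = m (torusBall y r) := fun m y hy => by
    rw [Measure.restrict_apply' hWm, Set.inter_eq_left.2 (hball hy)]
  have e1 : torusBall x r ∩ lowSet k r (m.restrict W) = torusBall x r ∩ lowSet k r m := by
    ext y
    refine and_congr_right fun hy => ?_
    rw [mem_lowSet, mem_lowSet, happ _ (h12 hy)]
  have e2 : (torusBall x (2 * r) \ torusBall x r) ∩
      lowSet k r ((m.restrict W).restrict (torusBall x r)ᶜ) =
      (torusBall x (2 * r) \ torusBall x r) ∩ lowSet k r (m.restrict (torusBall x r)ᶜ) := by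
    ext y
    refine and_congr_right fun hy => ?_
    rw [mem_lowSet, mem_lowSet, Measure.restrict_comm (measurableSet_torusBall x r).compl,
      happ _ hy.1]
  rw [nearLowCount, nearLowCount, e1, e2, Measure.restrict_apply' hWm, Measure.restrict_apply' hWm,
    Set.inter_eq_left.2 ((Set.inter_subset_left.trans h12).trans h23),
    Set.inter_eq_left.2 ((Set.inter_subset_left.trans Set.sdiff_subset).trans h23)]

theorem nearLowCount_ne_top (k : ℕ) (r : ℝ) (x : Cube d) (m : Measure (Cube d))
    [IsFiniteMeasure m] : nearLowCount k r x m ≠ ∞ := by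
  rw [nearLowCount]; finiteness

/-- The points near `x` account for the difference between the numbers of low-degree points in
the whole configuration and in the configuration outside the ball of `x`. -/
theorem abs_lowDegreeCount_sub_restrict_le_nearLowCount (k : ℕ) {r : ℝ} (x : Cube d)
    (m : Measure (Cube d)) [IsFiniteMeasure m] :
    |lowDegreeCount k r m - lowDegreeCount k r (m.restrict (torusBall x r)ᶜ)| ≤
      (nearLowCount k r x m).toReal := by
  have hB := measurableSet_torusBall x r
  set m₁ := m.restrict (torusBall x r)ᶜ with hm₁
  set m₂ := m.restrict (torusBall x r) with hm₂
  have hm : m₁ + m₂ = m := Measure.restrict_compl_add_restrict hB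
  have hsupp : m₂ (torusBall x r)ᶜ = 0 := by
    rw [hm₂, Measure.restrict_apply hB.compl, Set.compl_inter_self, measure_empty]
  have h := lowDegreeCount_add k r m₁ m₂
  have hd := lowSet_diff_subset k (r := r) (m₁ := m₁) hsupp
  rw [hm] at h hd
  have h1 : m₂.real (lowSet k r m) = (m (torusBall x r ∩ lowSet k r m)).toReal := by
    rw [Measure.real, hm₂, Measure.restrict_apply' hB, Set.inter_comm]
  have h2 : m₁.real (lowSet k r m₁ \ lowSet k r m) ≤
      (m ((torusBall x (2 * r) \ torusBall x r) ∩ lowSet k r m₁)).toReal := by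
    refine ENNReal.toReal_mono (by finiteness) ?_
    rw [hm₁, Measure.restrict_apply' hB.compl]
    refine measure_mono fun y hy => ⟨⟨?_, hy.2⟩, hy.1.1⟩
    have := hd hy.1
    rwa [two_mul]
  rw [nearLowCount, ENNReal.toReal_add (by finiteness) (by finiteness), ← h1]
  have h3 : 0 ≤ m₂.real (lowSet k r m) := measureReal_nonneg
  have h4 : 0 ≤ m₁.real (lowSet k r m₁ \ lowSet k r m) := measureReal_nonneg
  rw [abs_le]
  constructor <;> linarith

/-- The same comparison after adding a low-degree point at `x`, which counts for one. -/
theorem abs_lowDegreeCount_add_dirac_sub_restrict_le_nearLowCount (k : ℕ) {r : ℝ} (hr : 0 < r)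
    (x : Cube d) (m : Measure (Cube d)) [IsFiniteMeasure m]
    (hx : m (torusBall x r) + 1 ≤ (k : ℝ≥0∞)) :
    |lowDegreeCount k r (m + Measure.dirac x) -
      (1 + lowDegreeCount k r (m.restrict (torusBall x r)ᶜ))| ≤ (nearLowCount k r x m).toReal := by
  have hB := measurableSet_torusBall x r
  set m₁ := m.restrict (torusBall x r)ᶜ with hm₁
  set m₂ := m.restrict (torusBall x r) + Measure.dirac x with hm₂
  have hm : m₁ + m₂ = m + Measure.dirac x := by
    rw [hm₂, ← add_assoc, Measure.restrict_compl_add_restrict hB]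
  have hxB : x ∈ torusBall x r := mem_torusBall_self hr.le
  have hsupp : m₂ (torusBall x r)ᶜ = 0 := by
    rw [hm₂, Measure.add_apply, Measure.restrict_apply hB.compl, Set.compl_inter_self,
      measure_empty, Measure.dirac_apply' _ hB.compl]
    simp [hxB]
  have h := lowDegreeCount_add k r m₁ m₂
  have hd := lowSet_diff_subset k (r := r) (m₁ := m₁) hsupp
  rw [hm] at h hd
  have hanti : lowSet k r (m + Measure.dirac x) ⊆ lowSet k r m :=
    lowSet_anti k r (Measure.le_add_right le_rfl)
  have hxlow : x ∈ lowSet k r (m + Measure.dirac x) := by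
    rw [mem_lowSet, Measure.add_apply, Measure.dirac_apply_of_mem hxB]
    exact hx
  have h1 : m₂.real (lowSet k r (m + Measure.dirac x)) =
      (m.restrict (torusBall x r)).real (lowSet k r (m + Measure.dirac x)) + 1 := by
    rw [hm₂, measureReal_add_apply]
    congr 1
    rw [Measure.real, Measure.dirac_apply_of_mem hxlow, ENNReal.toReal_one]
  have h1' : (m.restrict (torusBall x r)).real (lowSet k r (m + Measure.dirac x)) ≤
      (m (torusBall x r ∩ lowSet k r m)).toReal := by
    refine ENNReal.toReal_mono (by finiteness) ?_
    rw [Measure.restrict_apply' hB, Set.inter_comm]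
    exact measure_mono (Set.inter_subset_inter_right _ hanti)
  have h2 : m₁.real (lowSet k r m₁ \ lowSet k r (m + Measure.dirac x)) ≤
      (m ((torusBall x (2 * r) \ torusBall x r) ∩ lowSet k r m₁)).toReal := by
    refine ENNReal.toReal_mono (by finiteness) ?_
    rw [hm₁, Measure.restrict_apply' hB.compl]
    refine measure_mono fun y hy => ⟨⟨?_, hy.2⟩, hy.1.1⟩
    have := hd hy.1
    rwa [two_mul]
  rw [nearLowCount, ENNReal.toReal_add (by finiteness) (by finiteness)]
  have h3 : 0 ≤ (m.restrict (torusBall x r)).real (lowSet k r (m + Measure.dirac x)) :=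
    measureReal_nonneg
  have h4 : 0 ≤ m₁.real (lowSet k r m₁ \ lowSet k r (m + Measure.dirac x)) := measureReal_nonneg
  have h5 : 0 ≤ (m (torusBall x r ∩ lowSet k r m)).toReal := ENNReal.toReal_nonneg
  rw [abs_le]
  constructor <;> linarith

end LowDegree

/-! ### Poisson probabilities of small numbers of points -/

section PoissonTail

/-- The probability that a Poisson variable of mean `u` is smaller than `k`. -/
noncomputable def poissonLower (k : ℕ) (u : ℝ) : ℝ :=
  Real.exp (-u) * ∑ j ∈ Finset.range k, u ^ j / j.factorial

theorem poissonLower_nonneg (k : ℕ) {u : ℝ} (hu : 0 ≤ u) : 0 ≤ poissonLower k u := by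
  unfold poissonLower; positivity

theorem poissonLower_le_exp (k : ℕ) {u : ℝ} (hu : 0 ≤ u) :
    poissonLower k u ≤ 2 ^ k * Real.exp (-(u / 2)) := by
  have h : ∑ j ∈ Finset.range k, u ^ j / j.factorial ≤ 2 ^ k * Real.exp (u / 2) := by
    calc _ ≤ ∑ j ∈ Finset.range k, 2 ^ k * ((u / 2) ^ j / j.factorial) := by
          refine Finset.sum_le_sum fun j hj => ?_
          have hjk : (2 : ℝ) ^ j ≤ 2 ^ k :=
            pow_le_pow_right₀ (by norm_num) (Finset.mem_range.1 hj).le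
          calc u ^ j / j.factorial = 2 ^ j * ((u / 2) ^ j / j.factorial) := by
                rw [div_pow]; field_simp
            _ ≤ _ := by gcongr
      _ ≤ _ := by
          rw [← Finset.mul_sum]
          gcongr
          exact Real.sum_le_exp_of_nonneg (by positivity) k
  calc poissonLower k u ≤ Real.exp (-u) * (2 ^ k * Real.exp (u / 2)) := by
        unfold poissonLower; gcongr
    _ = 2 ^ k * (Real.exp (-u) * Real.exp (u / 2)) := by ring
    _ = _ := by rw [← Real.exp_add]; congr 2; ring

/-- Lowering the admissible number of points by one gains a factor of order `1 / u`, which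
compensates the mean number `ε ^ d u` of points within distance `ε r` of a location. -/
theorem mul_poissonLower_le (k : ℕ) {u : ℝ} (hu : 0 ≤ u) :
    u * poissonLower k u ≤ (k + 1) * poissonLower (k + 1) u := by
  unfold poissonLower
  rw [mul_left_comm, mul_left_comm ((k : ℝ) + 1)]
  refine mul_le_mul_of_nonneg_left ?_ (Real.exp_pos _).le
  rw [Finset.sum_range_succ', Finset.mul_sum, mul_add, Finset.mul_sum]
  refine le_add_of_le_of_nonneg (Finset.sum_le_sum fun j hj => ?_) (by positivity)
  have hjk : (j : ℝ) + 1 ≤ k + 1 := by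
    have := (Finset.mem_range.1 hj).le
    have : (j : ℝ) ≤ k := by exact_mod_cast this
    linarith
  calc u * (u ^ j / j.factorial) = (j + 1) * (u ^ (j + 1) / (j + 1).factorial) := by
        rw [Nat.factorial_succ]; push_cast; field_simp; ring
    _ ≤ _ := by gcongr

variable {E : Type*} [MeasurableSpace E] (Λ : Measure E) [IsFiniteMeasure Λ]

/-- The configurations with fewer than `k` points in `A`. -/
def fewerThan (k : ℕ) (A : Set E) : Set (FiniteMeasure E) :=
  {m | (m : Measure E) A + 1 ≤ k}

theorem measurableSet_fewerThan {A : Set E} (hA : MeasurableSet A) (k : ℕ) :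
    MeasurableSet (fewerThan k A : Set (FiniteMeasure E)) :=
  measurableSet_le ((measurable_finiteMeasure_apply hA).add_const 1) measurable_const

theorem poissonLaw_fewerThan {A : Set E} (hA : MeasurableSet A) (k : ℕ) :
    poissonLaw Λ (fewerThan k A) =
      ENNReal.ofReal (poissonLower k (Λ A).toReal) := by
  have hS : MeasurableSet {y : ℝ≥0∞ | y + 1 ≤ k} :=
    measurableSet_le (measurable_id.add_const 1) measurable_const
  have h := congrArg (fun μ => μ {y : ℝ≥0∞ | y + 1 ≤ k}) (poissonLaw_map_apply Λ hA)
  rw [Measure.map_apply (measurable_finiteMeasure_apply hA) hS,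
    Measure.map_apply (by fun_prop) hS] at h
  have hpre : (fun j : ℕ => (j : ℝ≥0∞)) ⁻¹' {y : ℝ≥0∞ | y + 1 ≤ k} =
      (Finset.range k : Set ℕ) := by
    ext j
    simp only [Set.mem_preimage, Set.mem_ofPred_eq, Finset.coe_range, Set.mem_Iio]
    rw [← Nat.succ_le_iff]
    exact_mod_cast Iff.rfl
  rw [hpre, ← sum_measure_singleton] at h
  refine h.trans ?_
  simp_rw [poissonMeasure_singleton]
  rw [← ENNReal.ofReal_sum_of_nonneg fun j _ => by positivity, poissonLower, Finset.mul_sum]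
  congr 1
  refine Finset.sum_congr rfl fun j _ => ?_
  rw [mul_div_assoc]
  rfl

theorem poissonLaw_fewerThan_inter {A A' : Set E} (hA : MeasurableSet A)
    (hA' : MeasurableSet A') (hd : Disjoint A A') (k k' : ℕ) :
    poissonLaw Λ (fewerThan k A ∩
      fewerThan k' A') =
    poissonLaw Λ (fewerThan k A) *
      poissonLaw Λ (fewerThan k' A') := by
  have hS := measurableSet_fewerThan hA k
  have hS' := measurableSet_fewerThan hA' k'
  have h := lintegral_poissonLaw_mul_restrict_compl Λ hA
    (F := (fewerThan k A).indicator (1 : FiniteMeasure E → ℝ≥0∞))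
    (G := (fewerThan k' A').indicator
      (1 : FiniteMeasure E → ℝ≥0∞))
    (measurable_one.indicator hS) (measurable_one.indicator hS')
  have e1 : ∀ m : FiniteMeasure E,
      (fewerThan k A).indicator (1 : FiniteMeasure E → ℝ≥0∞)
        (m.restrict A) =
      (fewerThan k A).indicator 1 m := fun m => by
    simp [Set.indicator_apply, fewerThan]
  have e2 : ∀ m : FiniteMeasure E,
      (fewerThan k' A').indicator (1 : FiniteMeasure E → ℝ≥0∞)
        (m.restrict Aᶜ) =
      (fewerThan k' A').indicator 1 m := fun m => by
    simp [Set.indicator_apply, fewerThan, Measure.restrict_apply hA',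
      Set.inter_eq_left.2 hd.symm.subset_compl_right]
  simp only [e1, e2] at h
  rw [lintegral_indicator_one hS, lintegral_indicator_one hS'] at h
  rw [← h, ← lintegral_indicator_one (hS.inter hS')]
  refine lintegral_congr fun m => ?_
  rw [Set.inter_indicator_one]
  rfl

end PoissonTail

/-! ### Approximate independence of exponential weights and local events -/

section Decoupling

variable {E : Type*} [MeasurableSpace E] (Λ : Measure E) [IsFiniteMeasure Λ]

/-- If `Φ` changes by at most `K` when the points in `W` are removed, then the exponential weight
`exp Φ` is nearly independent of what happens in `W`. -/
theorem lintegral_mul_exp_le_of_local {W : Set E} (hW : MeasurableSet W)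
    {J : FiniteMeasure E → ℝ≥0∞} (hJ : Measurable J) (hJW : ∀ m, J (m.restrict W) = J m)
    {Φ : FiniteMeasure E → ℝ} (hΦ : Measurable Φ) {K : ℝ}
    (hK : ∀ m, |Φ m - Φ (m.restrict Wᶜ)| ≤ K) :
    ∫⁻ m, J m * ENNReal.ofReal (Real.exp (Φ m)) ∂(poissonLaw Λ) ≤
      ENNReal.ofReal (Real.exp (2 * K)) * ((∫⁻ m, J m ∂(poissonLaw Λ)) *
        ∫⁻ m, ENNReal.ofReal (Real.exp (Φ m)) ∂(poissonLaw Λ)) := by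
  have hexp : ∀ a b : ℝ, a ≤ K + b → ENNReal.ofReal (Real.exp a) ≤
      ENNReal.ofReal (Real.exp K) * ENNReal.ofReal (Real.exp b) := fun a b h => by
    rw [← ENNReal.ofReal_mul (by positivity), ← Real.exp_add]
    exact ENNReal.ofReal_le_ofReal (Real.exp_le_exp.2 h)
  have hG : Measurable fun m : FiniteMeasure E => ENNReal.ofReal (Real.exp (Φ m)) := by fun_prop
  have hGr : Measurable fun m : FiniteMeasure E =>
      ENNReal.ofReal (Real.exp (Φ (m.restrict Wᶜ))) :=
    hG.comp (measurable_finiteMeasure_restrict hW.compl)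
  have hJG : Measurable fun m : FiniteMeasure E =>
      J m * ENNReal.ofReal (Real.exp (Φ (m.restrict Wᶜ))) := hJ.mul hGr
  have h := lintegral_poissonLaw_mul_restrict_compl Λ hW hJ hG
  simp only [hJW] at h
  calc _ ≤ ∫⁻ m, ENNReal.ofReal (Real.exp K) *
        (J m * ENNReal.ofReal (Real.exp (Φ (m.restrict Wᶜ)))) ∂(poissonLaw Λ) := by
        refine lintegral_mono fun m => ?_
        rw [mul_left_comm]
        gcongr
        exact hexp _ _ (by linarith [(abs_le.1 (hK m)).2])
    _ = ENNReal.ofReal (Real.exp K) * ((∫⁻ m, J m ∂(poissonLaw Λ)) *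
        ∫⁻ m, ENNReal.ofReal (Real.exp (Φ (m.restrict Wᶜ))) ∂(poissonLaw Λ)) := by
        rw [lintegral_const_mul _ hJG, h]
    _ ≤ ENNReal.ofReal (Real.exp K) * ((∫⁻ m, J m ∂(poissonLaw Λ)) *
        ∫⁻ m, ENNReal.ofReal (Real.exp K) *
          ENNReal.ofReal (Real.exp (Φ m)) ∂(poissonLaw Λ)) := by
        gcongr with m
        exact hexp _ _ (by linarith [(abs_le.1 (hK m)).1])
    _ = _ := by
        rw [lintegral_const_mul _ hG, two_mul, Real.exp_add,
          ENNReal.ofReal_mul (by positivity)]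
        ring

end Decoupling

/-! ### Possible low-degree points near a location -/

section NearLow

variable {d : ℕ}

theorem mem_lowSet_add_dirac (k : ℕ) {r : ℝ} (hr : 0 ≤ r) {m : Measure (Cube d)} {x : Cube d} :
    x ∈ lowSet k r (m + Measure.dirac x) ↔ m (torusBall x r) + 1 ≤ k := by
  rw [mem_lowSet, Measure.add_apply, Measure.dirac_apply_of_mem (mem_torusBall_self hr)]

/-- The pairs `(y, m)` such that `y` is counted by `nearLowCount k r x m`. -/
def nearLowSet (k : ℕ) (r : ℝ) (x : Cube d) : Set (Cube d × FiniteMeasure (Cube d)) :=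
  {p | (p.1 ∈ torusBall x r ∧ p.1 ∈ lowSet k r p.2) ∨
    (p.1 ∈ torusBall x (2 * r) \ torusBall x r ∧
      p.1 ∈ lowSet k r ((p.2 : Measure (Cube d)).restrict (torusBall x r)ᶜ))}

theorem measurableSet_nearLowSet (k : ℕ) (r : ℝ) (x : Cube d) :
    MeasurableSet (nearLowSet k r x) := by
  have hB := measurableSet_torusBall x r
  have hf : Measurable fun p : Cube d × FiniteMeasure (Cube d) =>
      (p.2.restrict (torusBall x r)ᶜ, p.1) :=
    ((measurable_finiteMeasure_restrict hB.compl).comp measurable_snd).prodMk measurable_fst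
  exact ((measurable_fst hB).inter (measurable_swap (measurableSet_mem_lowSet k r))).union
    ((measurable_fst ((measurableSet_torusBall x (2 * r)).diff hB)).inter
      (hf (measurableSet_mem_lowSet k r)))

theorem nearLowCount_eq_lintegral (k : ℕ) (r : ℝ) (x : Cube d) (m : FiniteMeasure (Cube d)) :
    nearLowCount k r x m = ∫⁻ y, (nearLowSet k r x).indicator
      (1 : Cube d × FiniteMeasure (Cube d) → ℝ≥0∞) (y, m) ∂(m : Measure (Cube d)) := by
  have hS : MeasurableSet {y | (y, m) ∈ nearLowSet k r x} :=
    measurable_prodMk_right (measurableSet_nearLowSet k r x)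
  have e : ∀ y, (nearLowSet k r x).indicator (1 : Cube d × FiniteMeasure (Cube d) → ℝ≥0∞) (y, m) =
      {y | (y, m) ∈ nearLowSet k r x}.indicator 1 y := fun y => rfl
  simp_rw [e]
  rw [lintegral_indicator_one hS, nearLowCount, ← measure_union]
  · rfl
  · exact Set.disjoint_left.2 fun y hy hy' => hy'.1.2 hy.1
  · exact ((measurableSet_torusBall x (2 * r)).diff (measurableSet_torusBall x r)).inter
      (measurableSet_lowSet k r _)

/-- An upper bound for the probability that fewer than `k` points fall into the part of a ball
outside another ball, at distance at least `ε` radii, when `u` points are expected in a ball. -/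
noncomputable def crescentBound (d k : ℕ) (ε u : ℝ) : ℝ :=
  2 ^ k * Real.exp (-((ε / 4) ^ d * u / 2))

theorem crescentBound_nonneg (d k : ℕ) (ε u : ℝ) : 0 ≤ crescentBound d k ε u := by
  unfold crescentBound; positivity

theorem toReal_smul_volume_torusBall (l : ℝ≥0) (x : Cube d) {r : ℝ} (hr : 0 ≤ r)
    (hr2 : r < 1 / 2) :
    ((l • (volume : Measure (Cube d))) (torusBall x r)).toReal =
      l * (unitBallVolume d * r ^ d) := by
  have := unitBallVolume_pos d
  rw [Measure.smul_apply, volume_torusBall x hr hr2, ENNReal.toReal_smul,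
    ENNReal.toReal_ofReal (by positivity)]
  rfl

/-- Few points in the part of the ball of `y` outside the ball of `x` are unlikely, unless `x` and
`y` are very close. -/
theorem poissonLaw_crescent_le (k : ℕ) (l : ℝ≥0) {x y : Cube d} {r ε : ℝ} (hr : 0 < r)
    (hr2 : r < 1 / 8) (hε : 0 < ε) (hε1 : ε ≤ 1) (hlo : ε * r ≤ torusDist x y)
    (hhi : torusDist x y ≤ 2 * r) :
    poissonLaw (l • (volume : Measure (Cube d)))
      (fewerThan k (torusBall y r \ torusBall x r)) ≤
      ENNReal.ofReal (crescentBound d k ε (l * (unitBallVolume d * r ^ d))) := by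
  have := unitBallVolume_pos d
  have hm : MeasurableSet (torusBall y r \ torusBall x r) :=
    (measurableSet_torusBall y r).diff (measurableSet_torusBall x r)
  rw [poissonLaw_fewerThan _ hm]
  refine ENNReal.ofReal_le_ofReal ((poissonLower_le_exp k ENNReal.toReal_nonneg).trans ?_)
  unfold crescentBound
  gcongr
  have h := ENNReal.toReal_mono (by finiteness) (le_volume_torusBall_diff hr hr2 hε hε1 hlo hhi)
  rw [ENNReal.toReal_ofReal (by positivity)] at h
  rw [Measure.smul_apply, ENNReal.toReal_smul]
  calc _ = (l : ℝ) * ((ε / 4) ^ d * (unitBallVolume d * r ^ d)) := by ring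
    _ ≤ (l : ℝ) * (volume (torusBall y r \ torusBall x r)).toReal := by gcongr
    _ = _ := rfl

theorem poissonLower_le_crescentBound (k : ℕ) {ε u : ℝ} (hu : 0 ≤ u) (hε : 0 < ε) (hε1 : ε ≤ 1) :
    poissonLower k u ≤ crescentBound d k ε u := by
  refine (poissonLower_le_exp k hu).trans ?_
  unfold crescentBound
  gcongr
  exact mul_le_of_le_one_left hu (pow_le_one₀ (by positivity) (by linarith))

end NearLow

/-! ### Logarithmic moment generating functions -/

section LogMGF

variable {Ω : Type*} [MeasurableSpace Ω] {ν : Measure Ω} [IsFiniteMeasure ν]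

/-- A logarithmic moment generating function whose derivative is within `κ` of `w` differs from the
primitive `W` of `w` accordingly. The measure need not be normalized, so that the lemma also
applies to tilted laws. -/
theorem abs_log_integral_exp_sub_le (hν : ν ≠ 0) {X : Ω → ℝ} (hX : Measurable X) {C : ℝ}
    (hC : ∀ ω, |X ω| ≤ C) {W w : ℝ → ℝ} (hW : ∀ s, HasDerivAt W (w s) s) {κ s₀ : ℝ}
    (h : ∀ s, |s| ≤ s₀ → |∫ ω, X ω * Real.exp (s * X ω) ∂ν - w s * ∫ ω, Real.exp (s * X ω) ∂ν| ≤
      κ * ∫ ω, Real.exp (s * X ω) ∂ν) {s : ℝ} (hs : |s| ≤ s₀) :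
    |Real.log (∫ ω, Real.exp (s * X ω) ∂ν) - Real.log (ν.real Set.univ) - (W s - W 0)| ≤
      κ * |s| := by
  have hexp : ∀ t, Integrable (fun ω => Real.exp (t * X ω)) ν := fun t => by
    refine Integrable.of_bound (by fun_prop) (Real.exp (|t| * C)) (ae_of_all _ fun ω => ?_)
    rw [Real.norm_eq_abs, Real.abs_exp, Real.exp_le_exp]
    calc _ ≤ |t * X ω| := le_abs_self _
      _ ≤ _ := by rw [abs_mul]; gcongr; exact hC ω
  have hset : integrableExpSet X ν = Set.univ := Set.eq_univ_of_forall hexp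
  have hpos : ∀ t, 0 < ∫ ω, Real.exp (t * X ω) ∂ν := fun t => mgf_pos' hν (hexp t)
  have hd : ∀ t, HasDerivAt (fun s => Real.log (∫ ω, Real.exp (s * X ω) ∂ν) - W s)
      ((∫ ω, X ω * Real.exp (t * X ω) ∂ν) / (∫ ω, Real.exp (t * X ω) ∂ν) - w t) t := fun t => by
    have := hasDerivAt_mgf (X := X) (μ := ν) (t := t) (by simp [hset])
    exact (this.log (hpos t).ne').sub (hW t)
  -- the mean value inequality for the difference of the two primitives
  have hmv := (convex_Icc (-s₀) s₀).norm_image_sub_le_of_norm_hasDerivWithin_le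
    (C := κ) (fun t _ => (hd t).hasDerivWithinAt) (fun t ht => by
      rw [Real.norm_eq_abs, div_sub' (hpos t).ne', abs_div, abs_of_pos (hpos t),
        div_le_iff₀ (hpos t), mul_comm _ (w t)]
      exact h t (abs_le.2 ht)) (x := 0) (y := s)
    (abs_le.1 (by rw [abs_zero]; exact (abs_nonneg s).trans hs)) (abs_le.1 hs)
  rw [Real.norm_eq_abs, Real.norm_eq_abs, sub_zero] at hmv
  refine le_of_eq_of_le ?_ hmv
  congr 1
  simp only [zero_mul, Real.exp_zero, integral_const, smul_eq_mul, mul_one]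
  ring

end LogMGF

/-! ### Expected number of possible low-degree points near a location -/

section NearLow

variable {d : ℕ}

theorem mem_fewerThan_of_le {E : Type*} [MeasurableSpace E] {k : ℕ} {A A' : Set E}
    {m m' : FiniteMeasure E} (h : (m : Measure E) A ≤ (m' : Measure E) A')
    (hm : m' ∈ fewerThan k A') : m ∈ fewerThan k A :=
  (add_le_add_left h 1).trans hm

/-- The Mecke formula for the number of points near `x` that could be of low degree. -/
theorem lintegral_indicator_nearLowCount (k : ℕ) (l : ℝ≥0) (r : ℝ) (x : Cube d)
    {L : Set (FiniteMeasure (Cube d))} (hL : MeasurableSet L) :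
    ∫⁻ m : FiniteMeasure (Cube d), L.indicator (1 : FiniteMeasure (Cube d) → ℝ≥0∞) m *
        nearLowCount k r x m ∂(poissonLaw (l • volume)) =
      l * ∫⁻ y : Cube d, poissonLaw (l • volume)
        {m | m + pointMass y ∈ L ∧ (y, m + pointMass y) ∈ nearLowSet k r x} := by
  have hS : MeasurableSet ((Prod.snd ⁻¹' L) ∩ nearLowSet k r x) :=
    (measurable_snd hL).inter (measurableSet_nearLowSet k r x)
  have hind : Measurable (((Prod.snd ⁻¹' L) ∩ nearLowSet k r x).indicator
      (1 : Cube d × FiniteMeasure (Cube d) → ℝ≥0∞)) := measurable_one.indicator hS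
  have h := lintegral_poissonLaw_mecke (l • (volume : Measure (Cube d)))
    (F := fun y m => ((Prod.snd ⁻¹' L) ∩ nearLowSet k r x).indicator
      (1 : Cube d × FiniteMeasure (Cube d) → ℝ≥0∞) (y, m)) hind
  have hn : Measurable ((nearLowSet k r x).indicator
      (1 : Cube d × FiniteMeasure (Cube d) → ℝ≥0∞)) :=
    measurable_one.indicator (measurableSet_nearLowSet k r x)
  refine Eq.trans (lintegral_congr fun m => ?_) (h.trans ?_)
  · have hn' : Measurable fun y : Cube d => (nearLowSet k r x).indicator
        (1 : Cube d × FiniteMeasure (Cube d) → ℝ≥0∞) (y, m) := hn.comp measurable_prodMk_right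
    rw [nearLowCount_eq_lintegral, ← lintegral_const_mul _ hn']
    refine lintegral_congr fun y => ?_
    rw [Set.inter_indicator_one]
    rfl
  · rw [← Measure.coe_nnreal_smul, lintegral_smul_measure]
    congr 1
    refine lintegral_congr fun y => ?_
    rw [← lintegral_indicator_one]
    · rfl
    · have hm : Measurable fun m : FiniteMeasure (Cube d) => (y, m + pointMass y) := by fun_prop
      exact hm hS

theorem coe_mul_volume_torusBall (l : ℝ≥0) (x : Cube d) {r a u : ℝ} (hr : 0 ≤ r) (ha : 0 ≤ a)
    (har : a * r < 1 / 2) (hu : u = l * (unitBallVolume d * r ^ d)) :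
    (l : ℝ≥0∞) * volume (torusBall x (a * r)) = ENNReal.ofReal (a ^ d * u) := by
  have hθ := unitBallVolume_pos d
  rw [volume_torusBall x (by positivity) har, ← ENNReal.ofReal_coe_nnreal,
    ← ENNReal.ofReal_mul l.coe_nonneg, hu, mul_pow]
  congr 1
  ring

/-- Outside the ball of `x`, a point counted near `x` has fewer than `k` neighbours in
the crescent. -/
theorem mem_fewerThan_diff_of_mem_nearLowSet {k : ℕ} {r : ℝ} (hr : 0 ≤ r) {x y : Cube d}
    {m : FiniteMeasure (Cube d)} (h : (y, m + pointMass y) ∈ nearLowSet k r x)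
    (hy : y ∉ torusBall x r) : m ∈ fewerThan k (torusBall y r \ torusBall x r) := by
  have hyr : y ∈ torusBall y r \ torusBall x r := ⟨mem_torusBall_self hr, hy⟩
  rcases h with ⟨h, _⟩ | ⟨_, h⟩
  · exact absurd h hy
  · change (m : Measure (Cube d)) _ + 1 ≤ _
    rw [mem_lowSet, Measure.restrict_apply (measurableSet_torusBall y r)] at h
    simpa [toMeasure_pointMass, ← Set.sdiff_eq, Measure.dirac_apply_of_mem hyr] using h

theorem mem_fewerThan_of_mem_nearLowSet {k : ℕ} {r : ℝ} (hr : 0 ≤ r) {x y : Cube d}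
    {m : FiniteMeasure (Cube d)} (h : (y, m + pointMass y) ∈ nearLowSet k r x)
    (hy : y ∈ torusBall x r) : m ∈ fewerThan k (torusBall y r) := by
  rcases h with ⟨_, h⟩ | ⟨h, _⟩
  · exact (mem_lowSet_add_dirac k hr).1 h
  · exact absurd hy h.2

theorem mem_torusBall_of_mem_nearLowSet {k : ℕ} {r : ℝ} (hr : 0 ≤ r) {x y : Cube d}
    {m : FiniteMeasure (Cube d)} (h : (y, m) ∈ nearLowSet k r x) : y ∈ torusBall x (2 * r) := by
  rcases h with ⟨h, _⟩ | ⟨h, _⟩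
  · rw [mem_torusBall] at h ⊢
    linarith
  · exact h.1

/-- The expected number of points near `x` that could be of low degree is small. -/
theorem lintegral_nearLowCount_le (k : ℕ) (l : ℝ≥0) {r : ℝ} (hr : 0 < r) (hr2 : r < 1 / 8)
    (x : Cube d) {u : ℝ} (hu : u = l * (unitBallVolume d * r ^ d)) :
    ∫⁻ m : FiniteMeasure (Cube d), nearLowCount k r x m ∂(poissonLaw (l • volume)) ≤
      ENNReal.ofReal (2 ^ d * u * crescentBound d k 1 u) := by
  have hθ := unitBallVolume_pos d
  have hu0 : 0 ≤ u := by rw [hu]; positivity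
  have hc := crescentBound_nonneg d k 1 u
  have h := lintegral_indicator_nearLowCount k l r x (L := Set.univ) MeasurableSet.univ
  simp only [Set.indicator_univ, Pi.one_apply, one_mul, Set.mem_univ, true_and] at h
  rw [h]
  have key : ∀ y : Cube d, poissonLaw (l • volume)
      {m | (y, m + pointMass y) ∈ nearLowSet k r x} ≤ (torusBall x (2 * r)).indicator
        (fun _ => ENNReal.ofReal (crescentBound d k 1 u)) y := by
    intro y
    by_cases hyV : y ∈ torusBall x (2 * r)
    · rw [Set.indicator_of_mem hyV]
      by_cases hyB : y ∈ torusBall x r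
      · refine (measure_mono fun m hm => mem_fewerThan_of_mem_nearLowSet hr.le hm hyB).trans ?_
        rw [poissonLaw_fewerThan _ (measurableSet_torusBall y r),
          toReal_smul_volume_torusBall l y hr.le (by linarith), ← hu]
        exact ENNReal.ofReal_le_ofReal (poissonLower_le_crescentBound k hu0 one_pos le_rfl)
      · refine (measure_mono fun m hm =>
          mem_fewerThan_diff_of_mem_nearLowSet hr.le hm hyB).trans ?_
        rw [hu]
        refine poissonLaw_crescent_le k l hr hr2 one_pos le_rfl ?_ hyV
        rw [one_mul]; exact (not_le.1 hyB).le
    · rw [Set.indicator_of_notMem hyV]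
      refine le_of_eq (measure_mono_null (t := ∅) (fun m hm => ?_) measure_empty)
      exact hyV (mem_torusBall_of_mem_nearLowSet hr.le hm)
  refine (mul_le_mul_right (lintegral_mono key) _).trans_eq ?_
  rw [lintegral_indicator_const (measurableSet_torusBall x _), mul_left_comm,
    coe_mul_volume_torusBall l x hr.le two_pos.le (by linarith) hu, mul_comm,
    ← ENNReal.ofReal_mul (by positivity)]

/-- The same under the condition that `x` itself would be of low degree: points much closer to
`x` than `r` are rare because of their small volume, the others because of the many points
expected in the difference of the two balls. -/
theorem lintegral_fewerThan_nearLowCount_le {k : ℕ} (hk : 1 ≤ k) (l : ℝ≥0) {r : ℝ} (hr : 0 < r)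
    (hr2 : r < 1 / 8) (x : Cube d) {u : ℝ} (hu : u = l * (unitBallVolume d * r ^ d)) {ε : ℝ}
    (hε : 0 < ε) (hε1 : ε ≤ 1) :
    ∫⁻ m : FiniteMeasure (Cube d), (fewerThan k (torusBall x r)).indicator
        (1 : FiniteMeasure (Cube d) → ℝ≥0∞) m * nearLowCount k r x m
        ∂(poissonLaw (l • volume)) ≤
      ENNReal.ofReal (poissonLower k u * (ε ^ d * k + 2 ^ d * u * crescentBound d k ε u)) := by
  obtain ⟨k, rfl⟩ : ∃ k', k = k' + 1 := ⟨k - 1, by omega⟩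
  have hθ := unitBallVolume_pos d
  have hu0 : 0 ≤ u := by rw [hu]; positivity
  have hc := crescentBound_nonneg d (k + 1) ε u
  have hp := poissonLower_nonneg (k + 1) hu0
  have hp' := poissonLower_nonneg k hu0
  have hB := measurableSet_torusBall x r
  rw [lintegral_indicator_nearLowCount (k + 1) l r x (measurableSet_fewerThan hB _)]
  have hε2 : ε * r < 1 / 2 := by nlinarith
  -- close points reduce the admissible number of neighbours of `x` by one, for the others the
  -- numbers of points in the ball of `x` and in the crescent are independent
  have key : ∀ y : Cube d, poissonLaw (l • volume)
      {m | m + pointMass y ∈ fewerThan (k + 1) (torusBall x r) ∧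
        (y, m + pointMass y) ∈ nearLowSet (k + 1) r x} ≤
      (torusBall x (ε * r)).indicator (fun _ => ENNReal.ofReal (poissonLower k u)) y +
      (torusBall x (2 * r)).indicator
        (fun _ => ENNReal.ofReal (poissonLower (k + 1) u * crescentBound d (k + 1) ε u)) y := by
    intro y
    by_cases hyε : y ∈ torusBall x (ε * r)
    · rw [Set.indicator_of_mem hyε]
      refine le_trans ?_ le_self_add
      have hyB : y ∈ torusBall x r := by
        rw [mem_torusBall] at hyε ⊢
        nlinarith
      calc _ ≤ poissonLaw (l • volume) (fewerThan k (torusBall x r)) := by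
            refine measure_mono fun m hm => ?_
            have h := hm.1
            simp only [fewerThan, Set.mem_ofPred_eq, FiniteMeasure.toMeasure_add,
              toMeasure_pointMass, Measure.add_apply, Measure.dirac_apply_of_mem hyB,
              Nat.cast_add, Nat.cast_one] at h ⊢
            exact (ENNReal.add_le_add_iff_right ENNReal.one_ne_top).1 h
        _ = _ := by
            rw [poissonLaw_fewerThan _ hB,
              toReal_smul_volume_torusBall l x hr.le (by linarith), ← hu]
    by_cases hyV : y ∈ torusBall x (2 * r)
    · rw [Set.indicator_of_mem hyV]
      refine le_trans ?_ le_add_self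
      have hD : MeasurableSet (torusBall y r \ torusBall x r) :=
        (measurableSet_torusBall y r).diff hB
      calc _ ≤ poissonLaw (l • volume) (fewerThan (k + 1) (torusBall x r) ∩
              fewerThan (k + 1) (torusBall y r \ torusBall x r)) := by
            refine measure_mono fun m hm => ⟨?_, ?_⟩
            · refine mem_fewerThan_of_le ?_ hm.1
              rw [FiniteMeasure.toMeasure_add, Measure.add_apply]
              exact le_self_add
            · by_cases hyB : y ∈ torusBall x r
              · exact mem_fewerThan_of_le (measure_mono Set.sdiff_subset)
                  (mem_fewerThan_of_mem_nearLowSet hr.le hm.2 hyB)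
              · exact mem_fewerThan_diff_of_mem_nearLowSet hr.le hm.2 hyB
        _ = poissonLaw (l • volume) (fewerThan (k + 1) (torusBall x r)) *
            poissonLaw (l • volume) (fewerThan (k + 1) (torusBall y r \ torusBall x r)) :=
            poissonLaw_fewerThan_inter _ hB hD Set.disjoint_sdiff_right _ _
        _ ≤ _ := by
            rw [ENNReal.ofReal_mul hp]
            gcongr
            · rw [poissonLaw_fewerThan _ hB,
                toReal_smul_volume_torusBall l x hr.le (by linarith), ← hu]
            · rw [hu]
              exact poissonLaw_crescent_le (k + 1) l hr hr2 hε hε1 (not_le.1 hyε).le hyV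
    · refine le_of_eq_of_le (measure_mono_null (t := ∅) (fun m hm => ?_) measure_empty) zero_le
      exact hyV (mem_torusBall_of_mem_nearLowSet hr.le hm.2)
  refine (mul_le_mul_right (lintegral_mono key) _).trans ?_
  rw [lintegral_add_left (measurable_const.indicator (measurableSet_torusBall x _)),
    lintegral_indicator_const (measurableSet_torusBall x _),
    lintegral_indicator_const (measurableSet_torusBall x _), mul_add, mul_left_comm,
    coe_mul_volume_torusBall l x hr.le hε.le hε2 hu, mul_left_comm,
    coe_mul_volume_torusBall l x hr.le two_pos.le (by linarith) hu,
    ← ENNReal.ofReal_mul hp', ← ENNReal.ofReal_mul (by positivity),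
    ← ENNReal.ofReal_add (by positivity) (by positivity)]
  refine ENNReal.ofReal_le_ofReal ?_
  have h1 := mul_le_mul_of_nonneg_left (mul_poissonLower_le k hu0) (pow_nonneg hε.le d)
  push_cast
  nlinarith

end NearLow

/-! ### Inserting a point -/

section Insertion

/-- A one-sided mean value estimate for the exponential function, with a separate bound `c` for the
exponent. -/
theorem exp_le_exp_add {a b c δ : ℝ} (hab : a - b ≤ δ) (hδ : 0 ≤ δ) (hac : a ≤ c) :
    Real.exp a ≤ Real.exp b + δ * Real.exp c := by
  have h1 : Real.exp b = Real.exp a * Real.exp (b - a) := by rw [← Real.exp_add]; ring_nf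
  have h2 := Real.add_one_le_exp (b - a)
  have h3 : Real.exp a * δ ≤ δ * Real.exp c := by
    rw [mul_comm]; gcongr
  have h4 := Real.exp_pos a
  nlinarith

/-- If the count `a` differs from `b` by at most `N`, and from `c` by at most the constant `K`, then
the error made by replacing `a` by `b` in the exponent is of order `N exp (t c)`. -/
theorem ofReal_exp_mul_le_add {a b c K : ℝ} (t : ℝ) {N : ℝ≥0∞} (hN : N ≠ ∞)
    (hab : |a - b| ≤ N.toReal) (hac : |a - c| ≤ K) :
    ENNReal.ofReal (Real.exp (t * a)) ≤ ENNReal.ofReal (Real.exp (t * b)) +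
      ENNReal.ofReal (|t| * Real.exp (|t| * K)) * (N * ENNReal.ofReal (Real.exp (t * c))) := by
  have hmul : ∀ {y z : ℝ}, |y| ≤ z → t * y ≤ |t| * z := fun {y z} h =>
    (le_abs_self _).trans ((abs_mul t y).trans_le (mul_le_mul_of_nonneg_left h (abs_nonneg t)))
  have h := exp_le_exp_add (a := t * a) (b := t * b) (c := |t| * K + t * c)
    (δ := |t| * N.toReal) (by rw [← mul_sub]; exact hmul hab) (by positivity)
      (by linarith [hmul hac])
  conv_rhs => rw [← ENNReal.ofReal_toReal hN]
  rw [← ENNReal.ofReal_mul (by positivity), ← ENNReal.ofReal_mul (by positivity),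
    ← ENNReal.ofReal_add (by positivity) (by positivity)]
  refine ENNReal.ofReal_le_ofReal (h.trans_eq ?_)
  rw [Real.exp_add]
  ring

variable {d : ℕ}

/-- The weight `exp (t T)` of a configuration, `T` being the number of points of low degree. -/
noncomputable def expCount (k : ℕ) (r t : ℝ) (m : FiniteMeasure (Cube d)) : ℝ≥0∞ :=
  ENNReal.ofReal (Real.exp (t * lowDegreeCount k r (m : Measure (Cube d))))

theorem measurable_expCount (k : ℕ) (r t : ℝ) :
    Measurable (expCount (d := d) k r t) := by
  have := measurable_lowDegreeCount (d := d) k r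
  unfold expCount
  fun_prop

/-- The constant in the estimate of the effect of one ball on `exp (t T)`. -/
noncomputable def couplingConst (d k : ℕ) (t : ℝ) : ℝ :=
  |t| * Real.exp (|t| * (localBound d k + 1)) * Real.exp (2 * (|t| * localBound d k))

theorem couplingConst_nonneg (d k : ℕ) (t : ℝ) : 0 ≤ couplingConst d k t := by
  unfold couplingConst; positivity

/-- Under the law tilted by `exp (t T)`, the number of points near `x` that could be of low degree
remains small, also on a local event or with a local weight `J`. -/
theorem lintegral_indicator_nearLowCount_mul_expCount_le (k : ℕ) (l : ℝ≥0) {r : ℝ} (hr : 0 < r)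
    (t : ℝ) (x : Cube d) {J : FiniteMeasure (Cube d) → ℝ≥0∞} (hJ : Measurable J)
    (hJW : ∀ m, J (m.restrict (torusBall x (3 * r))) = J m) {ρ : ℝ}
    (hJρ : ∫⁻ m : FiniteMeasure (Cube d), J m * nearLowCount k r x m
      ∂(poissonLaw (l • volume)) ≤ ENNReal.ofReal ρ) :
    ENNReal.ofReal (|t| * Real.exp (|t| * (localBound d k + 1))) *
      ∫⁻ m : FiniteMeasure (Cube d), J m * nearLowCount k r x m * expCount k r t m
        ∂(poissonLaw (l • volume)) ≤
      ENNReal.ofReal (couplingConst d k t * ρ) *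
        ∫⁻ m, expCount k r t m ∂(poissonLaw (l • (volume : Measure (Cube d)))) := by
  have hT := measurable_lowDegreeCount (d := d) k r
  have h := lintegral_mul_exp_le_of_local (l • (volume : Measure (Cube d)))
    (measurableSet_torusBall x (3 * r))
    (J := fun m => J m * nearLowCount k r x (m : Measure (Cube d)))
    (hJ.mul (measurable_nearLowCount k r x))
    (fun m => by
      rw [hJW]
      congr 1
      exact nearLowCount_restrict k hr x m)
    (Φ := fun m => t * lowDegreeCount k r (m : Measure (Cube d))) (hT.const_mul t)
    (K := |t| * localBound d k) (fun m => by
      rw [← mul_sub, abs_mul]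
      gcongr
      exact abs_lowDegreeCount_sub_restrict_le k hr le_rfl m x)
  refine (mul_le_mul_right (h.trans (mul_le_mul_right (mul_le_mul_left hJρ _) _)) _).trans_eq ?_
  rw [couplingConst, ENNReal.ofReal_mul (q := ρ) (by positivity),
    ENNReal.ofReal_mul (q := Real.exp (2 * (|t| * localBound d k))) (by positivity)]
  simp only [expCount]
  generalize ENNReal.ofReal (|t| * Real.exp (|t| * (localBound d k + 1))) = A
  ring

/-- Removing the points of one ball hardly changes the exponential moment. -/
theorem lintegral_expCount_restrict (k : ℕ) (l : ℝ≥0) {r : ℝ} (hr : 0 < r) (hr2 : r < 1 / 8)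
    (t : ℝ) (x : Cube d) {u : ℝ} (hu : u = l * (unitBallVolume d * r ^ d)) :
    (∫⁻ m, expCount k r t (m.restrict (torusBall x r)ᶜ) ∂(poissonLaw (l • volume)) ≤
      ∫⁻ m, expCount k r t m ∂(poissonLaw (l • (volume : Measure (Cube d)))) +
      ENNReal.ofReal (couplingConst d k t * (2 ^ d * u * crescentBound d k 1 u)) *
        ∫⁻ m, expCount k r t m ∂(poissonLaw (l • (volume : Measure (Cube d))))) ∧
    (∫⁻ m, expCount k r t m ∂(poissonLaw (l • (volume : Measure (Cube d)))) ≤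
      ∫⁻ m, expCount k r t (m.restrict (torusBall x r)ᶜ) ∂(poissonLaw (l • volume)) +
      ENNReal.ofReal (couplingConst d k t * (2 ^ d * u * crescentBound d k 1 u)) *
        ∫⁻ m, expCount k r t m ∂(poissonLaw (l • (volume : Measure (Cube d))))) := by
  have hLB := localBound_nonneg d k
  have hloc : ∀ m : FiniteMeasure (Cube d), |lowDegreeCount k r (m : Measure (Cube d)) -
      lowDegreeCount k r ((m : Measure (Cube d)).restrict (torusBall x r)ᶜ)| ≤ localBound d k :=
    fun m => by simpa using abs_lowDegreeCount_sub_restrict_le k hr (ρ := 1) (by norm_num) m x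
  have hnear := fun m : FiniteMeasure (Cube d) =>
    abs_lowDegreeCount_sub_restrict_le_nearLowCount k (r := r) x (m : Measure (Cube d))
  have hE := measurable_expCount (d := d) k r t
  have hEr : Measurable fun m : FiniteMeasure (Cube d) =>
      expCount k r t (m.restrict (torusBall x r)ᶜ) :=
    hE.comp (measurable_finiteMeasure_restrict (measurableSet_torusBall x r).compl)
  have hNE : Measurable fun m : FiniteMeasure (Cube d) =>
      nearLowCount k r x (m : Measure (Cube d)) * expCount k r t m :=
    (measurable_nearLowCount k r x).mul hE
  have hbound := lintegral_indicator_nearLowCount_mul_expCount_le k l hr t x (J := fun _ => 1)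
    measurable_const (fun _ => rfl) (ρ := 2 ^ d * u * crescentBound d k 1 u)
    (by simpa only [one_mul] using lintegral_nearLowCount_le k l hr hr2 x hu)
  simp only [one_mul] at hbound
  have hloc' : ∀ m : FiniteMeasure (Cube d), |lowDegreeCount k r ((m : Measure (Cube d)).restrict
      (torusBall x r)ᶜ) - lowDegreeCount k r (m : Measure (Cube d))| ≤ localBound d k + 1 :=
    fun m => by rw [abs_sub_comm]; linarith [hloc m]
  have hself : ∀ m : FiniteMeasure (Cube d), |lowDegreeCount k r (m : Measure (Cube d)) -
      lowDegreeCount k r (m : Measure (Cube d))| ≤ localBound d k + 1 :=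
    fun m => by rw [sub_self, abs_zero]; linarith
  constructor
  · exact (lintegral_mono fun m => ofReal_exp_mul_le_add t (nearLowCount_ne_top k r x _)
      (by rw [abs_sub_comm]; exact hnear m) (hloc' m)).trans ((lintegral_add_left hE _).trans_le
        (add_le_add_right ((lintegral_const_mul _ hNE).trans_le hbound) _))
  · exact (lintegral_mono fun m => ofReal_exp_mul_le_add t (nearLowCount_ne_top k r x _)
      (hnear m) (hself m)).trans ((lintegral_add_left hEr _).trans_le
        (add_le_add_right ((lintegral_const_mul _ hNE).trans_le hbound) _))

/-- The event that `x` has few neighbours is independent of the points outside the ball of `x`. -/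
theorem lintegral_fewerThan_expCount_restrict (k : ℕ) (l : ℝ≥0) {r : ℝ} (hr : 0 < r)
    (hr2 : r < 1 / 8) (t : ℝ) (x : Cube d) {u : ℝ} (hu : u = l * (unitBallVolume d * r ^ d)) :
    ∫⁻ m : FiniteMeasure (Cube d), (fewerThan k (torusBall x r)).indicator
      (1 : FiniteMeasure (Cube d) → ℝ≥0∞) m * ENNReal.ofReal (Real.exp (t * (1 +
        lowDegreeCount k r ((m : Measure (Cube d)).restrict (torusBall x r)ᶜ))))
        ∂(poissonLaw (l • volume)) =
      ENNReal.ofReal (poissonLower k u * Real.exp t) *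
        ∫⁻ m, expCount k r t (m.restrict (torusBall x r)ᶜ)
          ∂(poissonLaw (l • (volume : Measure (Cube d)))) := by
  have hB := measurableSet_torusBall x r
  have hu0 : 0 ≤ u := by have := unitBallVolume_pos d; rw [hu]; positivity
  have hS := measurableSet_fewerThan hB k
  have h := lintegral_poissonLaw_mul_restrict_compl (l • (volume : Measure (Cube d))) hB
    (F := (fewerThan k (torusBall x r)).indicator (1 : FiniteMeasure (Cube d) → ℝ≥0∞))
    (G := fun m => ENNReal.ofReal (Real.exp t) * expCount k r t m)
    (measurable_one.indicator hS) ((measurable_expCount k r t).const_mul _)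
  have e1 : ∀ m : FiniteMeasure (Cube d), (fewerThan k (torusBall x r)).indicator
      (1 : FiniteMeasure (Cube d) → ℝ≥0∞) (m.restrict (torusBall x r)) =
      (fewerThan k (torusBall x r)).indicator (1 : FiniteMeasure (Cube d) → ℝ≥0∞) m :=
    fun m => by simp [Set.indicator_apply, fewerThan]
  have hEr : Measurable fun m : FiniteMeasure (Cube d) =>
      expCount k r t (m.restrict (torusBall x r)ᶜ) :=
    (measurable_expCount k r t).comp (measurable_finiteMeasure_restrict hB.compl)
  simp only [e1] at h
  rw [lintegral_indicator_one hS, poissonLaw_fewerThan _ hB,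
    toReal_smul_volume_torusBall l x hr.le (by linarith), ← hu, lintegral_const_mul _ hEr,
    ← mul_assoc, ← ENNReal.ofReal_mul (poissonLower_nonneg k hu0)] at h
  rw [← h]
  refine lintegral_congr fun m => ?_
  rw [expCount, ← ENNReal.ofReal_mul (Real.exp_pos _).le, ← Real.exp_add, mul_add, mul_one]
  rfl

/-- The relative error made by treating a low-degree point as independent of all the others. -/
noncomputable def couplingError (d k : ℕ) (t ε u : ℝ) : ℝ :=
  couplingConst d k t * ((ε ^ d * k + 2 ^ d * u * crescentBound d k ε u) +
    Real.exp t * (2 ^ d * u * crescentBound d k 1 u))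

/-- A point inserted at `x` is of low degree with the Poisson probability of `x` having few
neighbours, nearly independently of the number of the other points of low degree. -/
theorem lintegral_fewerThan_expCount_add {k : ℕ} (hk : 1 ≤ k) (l : ℝ≥0) {r : ℝ} (hr : 0 < r)
    (hr2 : r < 1 / 8) (t : ℝ) (x : Cube d) {u : ℝ} (hu : u = l * (unitBallVolume d * r ^ d))
    {ε : ℝ} (hε : 0 < ε) (hε1 : ε ≤ 1) :
    (∫⁻ m, (fewerThan k (torusBall x r)).indicator (1 : FiniteMeasure (Cube d) → ℝ≥0∞) m *
        expCount k r t (m + pointMass x) ∂(poissonLaw (l • volume)) ≤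
      ENNReal.ofReal (poissonLower k u * (Real.exp t + couplingError d k t ε u)) *
        ∫⁻ m, expCount k r t m ∂(poissonLaw (l • (volume : Measure (Cube d))))) ∧
    (ENNReal.ofReal (poissonLower k u * Real.exp t) *
        ∫⁻ m, expCount k r t m ∂(poissonLaw (l • (volume : Measure (Cube d)))) ≤
      ∫⁻ m, (fewerThan k (torusBall x r)).indicator (1 : FiniteMeasure (Cube d) → ℝ≥0∞) m *
        expCount k r t (m + pointMass x) ∂(poissonLaw (l • volume)) +
      ENNReal.ofReal (poissonLower k u * couplingError d k t ε u) *
        ∫⁻ m, expCount k r t m ∂(poissonLaw (l • (volume : Measure (Cube d))))) := by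
  have hB := measurableSet_torusBall x r
  have hS := measurableSet_fewerThan hB k
  have hu0 : 0 ≤ u := by have := unitBallVolume_pos d; rw [hu]; positivity
  have hp := poissonLower_nonneg k hu0
  have hA := couplingConst_nonneg d k t
  have hc1 := crescentBound_nonneg d k 1 u
  have hcε := crescentBound_nonneg d k ε u
  have hZ := lintegral_fewerThan_expCount_restrict k l hr hr2 t x hu
  have hI := lintegral_expCount_restrict k l hr hr2 t x hu
  have hE := measurable_expCount (d := d) k r t
  have hind : Measurable ((fewerThan k (torusBall x r)).indicator
      (1 : FiniteMeasure (Cube d) → ℝ≥0∞)) := measurable_one.indicator hS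
  -- the error terms, where the event of few neighbours plays the role of the local weight
  have hbound := lintegral_indicator_nearLowCount_mul_expCount_le k l hr t x hind
    (fun m => by
      have : torusBall x r ⊆ torusBall x (3 * r) :=
        torusBall_subset_torusBall (by rw [torusDist_self]; linarith)
      simp [Set.indicator_apply, fewerThan, Measure.restrict_apply hB, Set.inter_eq_left.2 this])
    (lintegral_fewerThan_nearLowCount_le hk l hr hr2 x hu hε hε1)
  have hNE : Measurable fun m : FiniteMeasure (Cube d) =>
      (fewerThan k (torusBall x r)).indicator (1 : FiniteMeasure (Cube d) → ℝ≥0∞) m *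
        nearLowCount k r x (m : Measure (Cube d)) * expCount k r t m :=
    (hind.mul (measurable_nearLowCount k r x)).mul hE
  have hX : Measurable fun m : FiniteMeasure (Cube d) =>
      (fewerThan k (torusBall x r)).indicator (1 : FiniteMeasure (Cube d) → ℝ≥0∞) m *
        expCount k r t (m + pointMass x) :=
    hind.mul (hE.comp (measurable_id.add_const _))
  have hTr : Measurable fun m : FiniteMeasure (Cube d) =>
      lowDegreeCount k r ((m : Measure (Cube d)).restrict (torusBall x r)ᶜ) :=
    (measurable_lowDegreeCount k r).comp (measurable_finiteMeasure_restrict hB.compl)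
  have hY : Measurable fun m : FiniteMeasure (Cube d) =>
      (fewerThan k (torusBall x r)).indicator (1 : FiniteMeasure (Cube d) → ℝ≥0∞) m *
        ENNReal.ofReal (Real.exp (t * (1 +
          lowDegreeCount k r ((m : Measure (Cube d)).restrict (torusBall x r)ᶜ)))) :=
    hind.mul (by fun_prop)
  have hadd : ∀ m : FiniteMeasure (Cube d),
      ((m + pointMass x : FiniteMeasure (Cube d)) : Measure (Cube d)) =
        (m : Measure (Cube d)) + Measure.dirac x := fun m => by
    rw [FiniteMeasure.toMeasure_add, toMeasure_pointMass]
  have hloc1 : ∀ m : FiniteMeasure (Cube d), |lowDegreeCount k r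
      ((m + pointMass x : FiniteMeasure (Cube d)) : Measure (Cube d)) -
      lowDegreeCount k r (m : Measure (Cube d))| ≤ localBound d k + 1 := fun m => by
    rw [hadd]
    exact (abs_lowDegreeCount_add_dirac_sub_le k hr _ x).trans (by linarith)
  have hloc2 : ∀ m : FiniteMeasure (Cube d), |1 + lowDegreeCount k r
      ((m : Measure (Cube d)).restrict (torusBall x r)ᶜ) -
      lowDegreeCount k r (m : Measure (Cube d))| ≤ localBound d k + 1 := fun m => by
    have := abs_lowDegreeCount_sub_restrict_le k hr (ρ := 1) (by norm_num) m x
    rw [Nat.cast_one, one_mul] at this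
    rw [abs_le] at this ⊢
    constructor <;> linarith
  have hnear : ∀ m ∈ fewerThan k (torusBall x r), |lowDegreeCount k r
      ((m + pointMass x : FiniteMeasure (Cube d)) : Measure (Cube d)) - (1 + lowDegreeCount k r
      ((m : Measure (Cube d)).restrict (torusBall x r)ᶜ))| ≤
      (nearLowCount k r x (m : Measure (Cube d))).toReal := fun m hm => by
    rw [hadd]
    exact abs_lowDegreeCount_add_dirac_sub_restrict_le_nearLowCount k hr x _ hm
  have hXY : ∫⁻ m, (fewerThan k (torusBall x r)).indicator
        (1 : FiniteMeasure (Cube d) → ℝ≥0∞) m * expCount k r t (m + pointMass x)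
        ∂(poissonLaw (l • volume)) ≤
      ENNReal.ofReal (poissonLower k u * Real.exp t) *
        ∫⁻ m, expCount k r t (m.restrict (torusBall x r)ᶜ)
          ∂(poissonLaw (l • (volume : Measure (Cube d)))) +
      ENNReal.ofReal (couplingConst d k t *
        (poissonLower k u * (ε ^ d * k + 2 ^ d * u * crescentBound d k ε u))) *
        ∫⁻ m, expCount k r t m ∂(poissonLaw (l • (volume : Measure (Cube d)))) := by
    rw [← hZ]
    refine le_trans ?_ (add_le_add_right hbound _)
    rw [← lintegral_const_mul _ hNE, ← lintegral_add_left hY]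
    refine lintegral_mono fun m => ?_
    by_cases hm : m ∈ fewerThan k (torusBall x r)
    · simp only [Set.indicator_of_mem hm, Pi.one_apply, one_mul]
      exact ofReal_exp_mul_le_add t (nearLowCount_ne_top k r x _) (hnear m hm) (hloc1 m)
    · simp [Set.indicator_of_notMem hm]
  have hYX : ENNReal.ofReal (poissonLower k u * Real.exp t) *
        ∫⁻ m, expCount k r t (m.restrict (torusBall x r)ᶜ)
          ∂(poissonLaw (l • (volume : Measure (Cube d)))) ≤
      ∫⁻ m, (fewerThan k (torusBall x r)).indicator
        (1 : FiniteMeasure (Cube d) → ℝ≥0∞) m * expCount k r t (m + pointMass x)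
        ∂(poissonLaw (l • volume)) +
      ENNReal.ofReal (couplingConst d k t *
        (poissonLower k u * (ε ^ d * k + 2 ^ d * u * crescentBound d k ε u))) *
        ∫⁻ m, expCount k r t m ∂(poissonLaw (l • (volume : Measure (Cube d)))) := by
    rw [← hZ]
    refine le_trans ?_ (add_le_add_right hbound _)
    rw [← lintegral_const_mul _ hNE, ← lintegral_add_left hX]
    refine lintegral_mono fun m => ?_
    by_cases hm : m ∈ fewerThan k (torusBall x r)
    · simp only [Set.indicator_of_mem hm, Pi.one_apply, one_mul]
      exact ofReal_exp_mul_le_add t (nearLowCount_ne_top k r x _)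
        (by rw [abs_sub_comm]; exact hnear m hm) (hloc2 m)
    · simp [Set.indicator_of_notMem hm]
  obtain ⟨hI1, hI2⟩ := hI
  clear hZ hbound
  generalize ∫⁻ m, expCount k r t m ∂(poissonLaw (l • (volume : Measure (Cube d)))) = M at *
  generalize ∫⁻ m, expCount k r t (m.restrict (torusBall x r)ᶜ)
    ∂(poissonLaw (l • (volume : Measure (Cube d)))) = Z at *
  generalize ∫⁻ m, (fewerThan k (torusBall x r)).indicator (1 : FiniteMeasure (Cube d) → ℝ≥0∞) m *
    expCount k r t (m + pointMass x) ∂(poissonLaw (l • volume)) = X at *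
  constructor
  · refine hXY.trans ((add_le_add_left (mul_le_mul_right hI1 _) _).trans_eq ?_)
    rw [mul_add, ← mul_assoc, ← add_mul, ← add_mul, ← ENNReal.ofReal_mul (by positivity),
      ← ENNReal.ofReal_add (by positivity) (by positivity),
      ← ENNReal.ofReal_add (by positivity) (by positivity)]
    congr 2
    rw [couplingError]
    ring
  · refine (mul_le_mul_right hI2 _).trans ?_
    rw [mul_add, ← mul_assoc]
    refine (add_le_add_left hYX _).trans_eq ?_
    rw [add_assoc, ← add_mul, ← ENNReal.ofReal_mul (by positivity),
      ← ENNReal.ofReal_add (by positivity) (by positivity)]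
    congr 3
    rw [couplingError]
    ring

end Insertion

/-! ### Exponential moments of the number of low-degree points -/

section LogMoment

variable {d : ℕ}

theorem exp_mul_lowDegreeCount_le (k : ℕ) {r : ℝ} {K : ℝ}
    (hK : ∀ m : Measure (Cube d), lowDegreeCount k r m ≤ K) (t : ℝ) (m : Measure (Cube d)) :
    Real.exp (t * lowDegreeCount k r m) ≤ Real.exp (|t| * K) := by
  refine Real.exp_le_exp.2 ((le_abs_self _).trans ?_)
  rw [abs_mul, abs_of_nonneg (lowDegreeCount_nonneg k r m)]
  gcongr
  exact hK _

theorem integrable_exp_lowDegreeCount (k : ℕ) {r : ℝ} (hr : 0 < r) (t : ℝ)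
    (Q : Measure (FiniteMeasure (Cube d))) [IsFiniteMeasure Q] :
    Integrable (fun m : FiniteMeasure (Cube d) =>
      Real.exp (t * lowDegreeCount k r (m : Measure (Cube d)))) Q := by
  obtain ⟨K, hK⟩ := exists_lowDegreeCount_le d k hr
  refine Integrable.of_bound (Real.measurable_exp.comp
    ((measurable_lowDegreeCount k r).const_mul t)).aestronglyMeasurable
    (Real.exp (|t| * K)) (ae_of_all _ fun m => ?_)
  rw [Real.norm_eq_abs, Real.abs_exp]
  exact exp_mul_lowDegreeCount_le k hK t _

/-- The Mecke formula for the number of low-degree points. -/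
theorem lintegral_lowDegreeCount_mul (k : ℕ) (l : ℝ≥0) {r : ℝ} (hr : 0 ≤ r)
    {G : FiniteMeasure (Cube d) → ℝ≥0∞} (hG : Measurable G) :
    ∫⁻ m : FiniteMeasure (Cube d), ENNReal.ofReal (lowDegreeCount k r (m : Measure (Cube d))) * G m
        ∂(poissonLaw (l • volume)) =
      l * ∫⁻ x : Cube d, ∫⁻ m, (fewerThan k (torusBall x r)).indicator
        (1 : FiniteMeasure (Cube d) → ℝ≥0∞) m * G (m + pointMass x) ∂(poissonLaw (l • volume)) := by
  set S : Set (FiniteMeasure (Cube d) × Cube d) :=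
    {p | p.2 ∈ lowSet k r (p.1 : Measure (Cube d))} with hS
  have hSm : MeasurableSet S := measurableSet_mem_lowSet k r
  have hind : Measurable (S.indicator (1 : FiniteMeasure (Cube d) × Cube d → ℝ≥0∞)) :=
    measurable_one.indicator hSm
  have hF : Measurable (Function.uncurry fun (x : Cube d) (m : FiniteMeasure (Cube d)) =>
      S.indicator (1 : FiniteMeasure (Cube d) × Cube d → ℝ≥0∞) (m, x) * G m) :=
    (hind.comp measurable_swap).mul (hG.comp measurable_snd)
  have h := lintegral_poissonLaw_mecke (l • (volume : Measure (Cube d))) hF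
  rw [← Measure.coe_nnreal_smul, lintegral_smul_measure] at h
  refine Eq.trans (lintegral_congr fun m => ?_) (h.trans ?_)
  · have hm : Measurable fun x : Cube d =>
      S.indicator (1 : FiniteMeasure (Cube d) × Cube d → ℝ≥0∞) (m, x) :=
      hind.comp measurable_prodMk_left
    rw [lintegral_mul_const _ hm, lowDegreeCount_eq, ofReal_measureReal,
      ← lintegral_indicator_one (measurableSet_lowSet k r _)]
    rfl
  · rw [smul_eq_mul]
    congr 1
    refine lintegral_congr fun x => lintegral_congr fun m => ?_
    congr 1
    refine Set.indicator_eq_indicator ?_ rfl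
    change x ∈ lowSet k r _ ↔ _
    rw [FiniteMeasure.toMeasure_add, toMeasure_pointMass, mem_lowSet_add_dirac k hr]
    rfl

/-- Under the law tilted by `exp (t T)`, the mean of `T` is nearly `exp t` times the
original mean. -/
theorem lintegral_lowDegreeCount_mul_expCount {k : ℕ} (hk : 1 ≤ k) (l : ℝ≥0) {r : ℝ} (hr : 0 < r)
    (hr2 : r < 1 / 8) (t : ℝ) {u : ℝ} (hu : u = l * (unitBallVolume d * r ^ d))
    {ε : ℝ} (hε : 0 < ε) (hε1 : ε ≤ 1) :
    (∫⁻ m : FiniteMeasure (Cube d), ENNReal.ofReal (lowDegreeCount k r (m : Measure (Cube d))) *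
        expCount k r t m ∂(poissonLaw (l • volume)) ≤
      ENNReal.ofReal (l * (poissonLower k u * (Real.exp t + couplingError d k t ε u))) *
        ∫⁻ m, expCount k r t m ∂(poissonLaw (l • (volume : Measure (Cube d))))) ∧
    (ENNReal.ofReal (l * (poissonLower k u * Real.exp t)) *
        ∫⁻ m, expCount k r t m ∂(poissonLaw (l • (volume : Measure (Cube d)))) ≤
      ∫⁻ m : FiniteMeasure (Cube d), ENNReal.ofReal (lowDegreeCount k r (m : Measure (Cube d))) *
        expCount k r t m ∂(poissonLaw (l • volume)) +
      ENNReal.ofReal (l * (poissonLower k u * couplingError d k t ε u)) *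
        ∫⁻ m, expCount k r t m ∂(poissonLaw (l • (volume : Measure (Cube d))))) := by
  have h := fun x : Cube d => lintegral_fewerThan_expCount_add hk l hr hr2 t x hu hε hε1
  rw [lintegral_lowDegreeCount_mul k l hr.le (measurable_expCount k r t)]
  generalize ∫⁻ m, expCount k r t m ∂(poissonLaw (l • (volume : Measure (Cube d)))) = M at *
  rw [ENNReal.ofReal_mul l.coe_nonneg, ENNReal.ofReal_mul l.coe_nonneg,
    ENNReal.ofReal_mul l.coe_nonneg, ENNReal.ofReal_coe_nnreal, mul_assoc, mul_assoc, mul_assoc,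
    ← mul_add]
  constructor
  · gcongr
    refine (lintegral_mono fun x => (h x).1).trans ?_
    simp
  · gcongr
    have := lintegral_mono (μ := (volume : Measure (Cube d))) fun x => (h x).2
    rwa [lintegral_const, measure_univ, mul_one, lintegral_add_right _ measurable_const,
      lintegral_const, measure_univ, mul_one] at this

/-- The derivative of the moment generating function of `T` nearly satisfies the differential
equation of that of a Poisson variable with the same mean. -/
theorem integral_lowDegreeCount_mul_exp {k : ℕ} (hk : 1 ≤ k) (l : ℝ≥0) {r : ℝ} (hr : 0 < r)
    (hr2 : r < 1 / 8) (t : ℝ) {u : ℝ} (hu : u = l * (unitBallVolume d * r ^ d))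
    {ε : ℝ} (hε : 0 < ε) (hε1 : ε ≤ 1) :
    |∫ m : FiniteMeasure (Cube d), lowDegreeCount k r (m : Measure (Cube d)) *
        Real.exp (t * lowDegreeCount k r (m : Measure (Cube d))) ∂(poissonLaw (l • volume)) -
      l * poissonLower k u * Real.exp t * ∫ m : FiniteMeasure (Cube d),
        Real.exp (t * lowDegreeCount k r (m : Measure (Cube d))) ∂(poissonLaw (l • volume))| ≤
      l * poissonLower k u * couplingError d k t ε u * ∫ m : FiniteMeasure (Cube d),
        Real.exp (t * lowDegreeCount k r (m : Measure (Cube d))) ∂(poissonLaw (l • volume)) := by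
  have hT := measurable_lowDegreeCount (d := d) k r
  obtain ⟨K, hK⟩ := exists_lowDegreeCount_le d k hr
  have hT0 := fun m : FiniteMeasure (Cube d) => lowDegreeCount_nonneg k r (m : Measure (Cube d))
  have hu0 : 0 ≤ u := by have := unitBallVolume_pos d; rw [hu]; positivity
  have hp := poissonLower_nonneg k hu0
  have hc : 0 ≤ couplingError d k t ε u := by
    have := couplingConst_nonneg d k t
    have := crescentBound_nonneg d k ε u
    have := crescentBound_nonneg d k 1 u
    unfold couplingError; positivity
  have hi := integrable_exp_lowDegreeCount k hr t (poissonLaw (l • (volume : Measure (Cube d))))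
  have hTi : Integrable (fun m : FiniteMeasure (Cube d) =>
      lowDegreeCount k r (m : Measure (Cube d)) *
      Real.exp (t * lowDegreeCount k r (m : Measure (Cube d)))) (poissonLaw (l • volume)) :=
    hi.bdd_mul (c := K) hT.aestronglyMeasurable (ae_of_all _ fun m => by
      rw [Real.norm_eq_abs, abs_of_nonneg (hT0 m)]; exact hK _)
  obtain ⟨h1, h2⟩ := lintegral_lowDegreeCount_mul_expCount hk l hr hr2 t hu hε hε1
  have eT : ∫⁻ m : FiniteMeasure (Cube d),
      ENNReal.ofReal (lowDegreeCount k r (m : Measure (Cube d))) *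
        expCount k r t m ∂(poissonLaw (l • volume)) = ENNReal.ofReal
      (∫ m : FiniteMeasure (Cube d), lowDegreeCount k r (m : Measure (Cube d)) *
        Real.exp (t * lowDegreeCount k r (m : Measure (Cube d))) ∂(poissonLaw (l • volume))) := by
    rw [ofReal_integral_eq_lintegral_ofReal hTi (ae_of_all _ fun m =>
      mul_nonneg (hT0 m) (Real.exp_pos _).le)]
    exact lintegral_congr fun m => (ENNReal.ofReal_mul (hT0 m)).symm
  have eM : ∫⁻ m, expCount k r t m ∂(poissonLaw (l • (volume : Measure (Cube d)))) =
      ENNReal.ofReal (∫ m : FiniteMeasure (Cube d),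
        Real.exp (t * lowDegreeCount k r (m : Measure (Cube d))) ∂(poissonLaw (l • volume))) :=
    (ofReal_integral_eq_lintegral_ofReal hi (ae_of_all _ fun m => (Real.exp_pos _).le)).symm
  have hM0 : 0 ≤ ∫ m : FiniteMeasure (Cube d),
      Real.exp (t * lowDegreeCount k r (m : Measure (Cube d))) ∂(poissonLaw (l • volume)) :=
    integral_nonneg fun m => (Real.exp_pos _).le
  have hN0 : 0 ≤ ∫ m : FiniteMeasure (Cube d), lowDegreeCount k r (m : Measure (Cube d)) *
      Real.exp (t * lowDegreeCount k r (m : Measure (Cube d))) ∂(poissonLaw (l • volume)) :=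
    integral_nonneg fun m => mul_nonneg (hT0 m) (Real.exp_pos _).le
  rw [eT, eM] at h1 h2
  rw [← ENNReal.ofReal_mul (by positivity), ENNReal.ofReal_le_ofReal_iff (by positivity)] at h1
  rw [← ENNReal.ofReal_mul (by positivity), ← ENNReal.ofReal_mul (by positivity),
    ← ENNReal.ofReal_add hN0 (by positivity), ENNReal.ofReal_le_ofReal_iff (by positivity)] at h2
  rw [abs_le]
  constructor <;> linarith

/-- Integration of the differential inequality `integral_lowDegreeCount_mul_exp` from `0` to `t`. -/
theorem abs_log_integral_exp_lowDegreeCount_le {k : ℕ} (hk : 1 ≤ k) (l : ℝ≥0) {r : ℝ}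
    (hr : 0 < r) (hr2 : r < 1 / 8) {u : ℝ} (hu : u = l * (unitBallVolume d * r ^ d))
    {ε : ℝ} (hε : 0 < ε) (hε1 : ε ≤ 1) {t₀ κ : ℝ}
    (hκ : ∀ s, |s| ≤ t₀ → couplingError d k s ε u ≤ κ) {t : ℝ} (ht : |t| ≤ t₀) :
    |Real.log (∫ m : FiniteMeasure (Cube d),
        Real.exp (t * lowDegreeCount k r (m : Measure (Cube d))) ∂(poissonLaw (l • volume))) -
      l * poissonLower k u * (Real.exp t - 1)| ≤ l * poissonLower k u * κ * |t| := by
  have hu0 : 0 ≤ u := by have := unitBallVolume_pos d; rw [hu]; positivity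
  have hp := poissonLower_nonneg k hu0
  obtain ⟨K, hK⟩ := exists_lowDegreeCount_le d k hr
  have h := abs_log_integral_exp_sub_le (ν := poissonLaw (l • (volume : Measure (Cube d))))
    (NeZero.ne _) (measurable_lowDegreeCount k r) (C := K)
    (fun m => by rw [abs_of_nonneg (lowDegreeCount_nonneg _ _ _)]; exact hK _)
    (W := fun s => l * poissonLower k u * Real.exp s)
    (w := fun s => l * poissonLower k u * Real.exp s)
    (fun s => (Real.hasDerivAt_exp s).const_mul _) (κ := l * poissonLower k u * κ) (s₀ := t₀)
    (fun s hs => (integral_lowDegreeCount_mul_exp hk l hr hr2 s hu hε hε1).trans (by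
      refine mul_le_mul_of_nonneg_right ?_ (integral_nonneg fun m => (Real.exp_pos _).le)
      gcongr
      exact hκ s hs)) ht
  rw [probReal_univ, Real.log_one, sub_zero, Real.exp_zero, ← mul_sub] at h
  exact h

theorem tendsto_mul_crescentBound (d k : ℕ) {ε : ℝ} (hε : 0 < ε) :
    Tendsto (fun u => 2 ^ d * u * crescentBound d k ε u) atTop (𝓝 0) := by
  have hc : 0 < (ε / 4) ^ d / 2 := by positivity
  have h := (Real.tendsto_pow_mul_exp_neg_atTop_nhds_zero 1).comp
    (tendsto_id.const_mul_atTop hc)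
  have h2 := h.const_mul (2 ^ d * 2 ^ k / ((ε / 4) ^ d / 2))
  rw [mul_zero] at h2
  refine h2.congr fun u => ?_
  simp only [crescentBound, Function.comp, pow_one, id]
  rw [show (ε / 4) ^ d * u / 2 = (ε / 4) ^ d / 2 * u by ring]
  field_simp

/-- The error is small for many expected neighbours, once `ε` is chosen small; `d ≥ 1` is needed for
`ε ^ d` to be small. -/
theorem exists_couplingError_le {d : ℕ} (hd : 1 ≤ d) (k : ℕ) (t₀ : ℝ) {κ : ℝ} (hκ : 0 < κ) :
    ∃ ε : ℝ, 0 < ε ∧ ε ≤ 1 ∧ ∃ u₀ : ℝ, ∀ u ≥ u₀, ∀ s, |s| ≤ t₀ → couplingError d k s ε u ≤ κ := by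
  set C := couplingConst d k t₀ with hC
  have hC0 : 0 ≤ C := couplingConst_nonneg d k t₀
  obtain ⟨δ, hδ, hδC⟩ : ∃ δ > 0, C * (2 * δ + Real.exp t₀ * δ) ≤ κ := by
    refine ⟨κ / (C * (2 + Real.exp t₀) + 1), by positivity, ?_⟩
    rw [show C * (2 * (κ / (C * (2 + Real.exp t₀) + 1)) + Real.exp t₀ *
      (κ / (C * (2 + Real.exp t₀) + 1))) = κ * ((C * (2 + Real.exp t₀)) /
        (C * (2 + Real.exp t₀) + 1)) by ring]
    refine mul_le_of_le_one_right hκ.le ((div_le_one (by positivity)).2 (by linarith))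
  have hεk : ∃ ε : ℝ, 0 < ε ∧ ε ≤ 1 ∧ ε ^ d * k ≤ δ := by
    refine ⟨min 1 (δ / (k + 1)), by positivity, min_le_left _ _, ?_⟩
    have h1 : (min 1 (δ / (k + 1))) ^ d ≤ δ / (k + 1) :=
      (pow_le_of_le_one (by positivity) (min_le_left _ _) (by omega)).trans (min_le_right _ _)
    calc _ ≤ δ / (k + 1) * (k + 1) := by gcongr; linarith
      _ = δ := by field_simp
  obtain ⟨ε, hε, hε1, hεk⟩ := hεk
  obtain ⟨u₀, hu₀⟩ := eventually_atTop.1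
    (((tendsto_mul_crescentBound d k hε).eventually_le_const hδ).and
      (((tendsto_mul_crescentBound d k one_pos).eventually_le_const hδ).and
        (eventually_ge_atTop 0)))
  refine ⟨ε, hε, hε1, u₀, fun u hu s hs => ?_⟩
  obtain ⟨h1, h2, h3⟩ := hu₀ u hu
  have hLB := localBound_nonneg d k
  have ht₀ : 0 ≤ t₀ := (abs_nonneg s).trans hs
  have hcc := crescentBound_nonneg d k ε u
  have hcc1 := crescentBound_nonneg d k 1 u
  refine le_trans ?_ hδC
  have hCs : couplingConst d k s ≤ C := by
    rw [hC, couplingConst, couplingConst, abs_of_nonneg ht₀]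
    gcongr
  unfold couplingError
  gcongr
  · linarith
  · exact (le_abs_self s).trans hs

/-- The log-moment generating function of the number of low-degree points of a Poisson process is
nearly that of a Poisson variable with the same mean when each ball expects many points. -/
theorem exists_abs_log_integral_exp_le {d k : ℕ} (hd : 1 ≤ d) (hk : 1 ≤ k) (t : ℝ) {κ : ℝ}
    (hκ : 0 < κ) : ∃ u₀ : ℝ, ∀ (l : ℝ≥0) (r : ℝ), 0 < r → r < 1 / 8 →
      u₀ ≤ l * (unitBallVolume d * r ^ d) →
      |Real.log (∫ m : FiniteMeasure (Cube d),
        Real.exp (t * lowDegreeCount k r (m : Measure (Cube d))) ∂(poissonLaw (l • volume))) -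
      l * poissonLower k (l * (unitBallVolume d * r ^ d)) * (Real.exp t - 1)| ≤
      κ * (l * poissonLower k (l * (unitBallVolume d * r ^ d))) := by
  obtain ⟨ε, hε, hε1, u₀, h⟩ := exists_couplingError_le hd k |t| (κ := κ / (|t| + 1))
    (by positivity)
  refine ⟨u₀, fun l r hr hr2 hu => ?_⟩
  refine (abs_log_integral_exp_lowDegreeCount_le hk l hr hr2 rfl hε hε1 (h _ hu) le_rfl).trans ?_
  have hθ := unitBallVolume_pos d
  have hp := poissonLower_nonneg k (u := l * (unitBallVolume d * r ^ d)) (by positivity)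
  have : κ / (|t| + 1) * |t| ≤ κ := by
    rw [div_mul_eq_mul_div, div_le_iff₀ (by positivity)]; nlinarith [abs_nonneg t]
  calc _ = l * poissonLower k (l * (unitBallVolume d * r ^ d)) * (κ / (|t| + 1) * |t|) := by ring
    _ ≤ l * poissonLower k (l * (unitBallVolume d * r ^ d)) * κ := by gcongr
    _ = _ := by ring

end LogMoment

/-! ### The volume of the set of low-degree locations -/

section LowVolume

variable {d : ℕ}

/-- The volume of the set of locations with at most `k` points of `m` in their ball. -/
noncomputable def lowVolume (k : ℕ) (r : ℝ) (m : Measure (Cube d)) : ℝ :=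
  (volume (lowSet k r m)).toReal

theorem lowVolume_nonneg (k : ℕ) (r : ℝ) (m : Measure (Cube d)) : 0 ≤ lowVolume k r m :=
  ENNReal.toReal_nonneg

theorem lowVolume_le_one (k : ℕ) (r : ℝ) (m : Measure (Cube d)) : lowVolume k r m ≤ 1 :=
  ENNReal.toReal_le_of_le_ofReal zero_le_one (by simpa using prob_le_one)

theorem measurable_volume_lowSet (k : ℕ) (r : ℝ) :
    Measurable fun m : FiniteMeasure (Cube d) => volume (lowSet k r (m : Measure (Cube d))) :=
  measurable_measure_prodMk_left (measurableSet_mem_lowSet k r)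

theorem measurable_lowVolume (k : ℕ) (r : ℝ) :
    Measurable fun m : FiniteMeasure (Cube d) => lowVolume k r (m : Measure (Cube d)) :=
  (measurable_volume_lowSet k r).ennreal_toReal

theorem ofReal_lowVolume (k : ℕ) (r : ℝ) (m : Measure (Cube d)) :
    ENNReal.ofReal (lowVolume k r m) = volume (lowSet k r m) :=
  ENNReal.ofReal_toReal (measure_ne_top _ _)

/-- Removing the points of a ball affects the low-degree locations within two radii only. -/
theorem abs_lowVolume_sub_restrict_le (k : ℕ) {r : ℝ} (m : Measure (Cube d)) (x : Cube d) :
    |lowVolume k r m - lowVolume k r (m.restrict (torusBall x r)ᶜ)| ≤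
      (volume (torusBall x (2 * r))).toReal := by
  have hB := measurableSet_torusBall x r
  have h1 : volume (lowSet k r m) ≤ volume (lowSet k r (m.restrict (torusBall x r)ᶜ)) :=
    measure_mono fun y hy => by
      rw [mem_lowSet] at hy ⊢
      exact (Measure.restrict_apply_le _ _).trans hy
  have h2 : volume (lowSet k r (m.restrict (torusBall x r)ᶜ)) ≤
      volume (lowSet k r m) + volume (torusBall x (2 * r)) := by
    refine (measure_mono fun y hy => ?_).trans (measure_union_le _ _)
    by_cases hyV : y ∈ torusBall x (2 * r)
    · exact Or.inr hyV
    · left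
      rw [mem_lowSet, Measure.restrict_apply (measurableSet_torusBall y r)] at hy
      rw [mem_lowSet]
      have hsub : torusBall y r ⊆ (torusBall x r)ᶜ := by
        intro z hz hzx
        refine hyV ?_
        rw [mem_torusBall] at hz hzx ⊢
        have := torusDist_triangle x z y
        rw [torusDist_comm y z] at hz
        linarith
      rwa [Set.inter_eq_left.2 hsub] at hy
  have h1' := ENNReal.toReal_mono (measure_ne_top _ _) h1
  have h2' := ENNReal.toReal_mono (by finiteness) h2
  rw [ENNReal.toReal_add (by finiteness) (by finiteness)] at h2'
  unfold lowVolume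
  rw [abs_le]
  constructor
  · linarith
  · linarith [(ENNReal.toReal_nonneg : 0 ≤ (volume (torusBall x (2 * r))).toReal)]

/-- Fubini's theorem for the volume of the low-degree locations. A location need not be a point of
the configuration, so that up to `k` points are allowed in its ball. -/
theorem lintegral_lowVolume_mul (k : ℕ) (Λ : Measure (Cube d)) [IsFiniteMeasure Λ] (r : ℝ)
    {G : FiniteMeasure (Cube d) → ℝ≥0∞} (hG : Measurable G) :
    ∫⁻ m : FiniteMeasure (Cube d), ENNReal.ofReal (lowVolume k r (m : Measure (Cube d))) * G m
        ∂(poissonLaw Λ) =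
      ∫⁻ x : Cube d, ∫⁻ m, (fewerThan (k + 1) (torusBall x r)).indicator
        (1 : FiniteMeasure (Cube d) → ℝ≥0∞) m * G m ∂(poissonLaw Λ) := by
  set S : Set (FiniteMeasure (Cube d) × Cube d) :=
    {p | p.2 ∈ lowSet k r (p.1 : Measure (Cube d))} with hS
  have hSm : MeasurableSet S := measurableSet_mem_lowSet k r
  have hind : Measurable (S.indicator (1 : FiniteMeasure (Cube d) × Cube d → ℝ≥0∞)) :=
    measurable_one.indicator hSm
  have hF : Measurable fun p : Cube d × FiniteMeasure (Cube d) =>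
      S.indicator (1 : FiniteMeasure (Cube d) × Cube d → ℝ≥0∞) (p.2, p.1) * G p.2 :=
    (hind.comp measurable_swap).mul (hG.comp measurable_snd)
  have e : ∀ (x : Cube d) (m : FiniteMeasure (Cube d)),
      (fewerThan (k + 1) (torusBall x r)).indicator (1 : FiniteMeasure (Cube d) → ℝ≥0∞) m =
      S.indicator (1 : FiniteMeasure (Cube d) × Cube d → ℝ≥0∞) (m, x) := fun x m => by
    refine Set.indicator_eq_indicator ?_ rfl
    change (m : Measure (Cube d)) (torusBall x r) + 1 ≤ _ ↔ (m : Measure (Cube d)) _ ≤ _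
    rw [Nat.cast_add, Nat.cast_one, ENNReal.add_le_add_iff_right ENNReal.one_ne_top]
  simp_rw [e]
  rw [lintegral_lintegral_swap hF.aemeasurable]
  refine lintegral_congr fun m => ?_
  have hm : Measurable fun x : Cube d =>
      S.indicator (1 : FiniteMeasure (Cube d) × Cube d → ℝ≥0∞) (m, x) :=
    hind.comp measurable_prodMk_left
  rw [lintegral_mul_const _ hm, ofReal_lowVolume,
    ← lintegral_indicator_one (measurableSet_lowSet k r _)]
  rfl

theorem integrable_exp_lowDegreeCount_add (k : ℕ) {r : ℝ} (hr : 0 < r) (t s : ℝ)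
    (Q : Measure (FiniteMeasure (Cube d))) [IsFiniteMeasure Q] :
    Integrable (fun m : FiniteMeasure (Cube d) =>
      Real.exp (t * lowDegreeCount k r (m : Measure (Cube d)) +
        s * lowVolume k r (m : Measure (Cube d)))) Q := by
  obtain ⟨K, hK⟩ := exists_lowDegreeCount_le d k hr
  refine Integrable.of_bound (Real.measurable_exp.comp (((measurable_lowDegreeCount k r).const_mul
    t).add ((measurable_lowVolume k r).const_mul s))).aestronglyMeasurable
    (Real.exp (|t| * K + |s|)) (ae_of_all _ fun m => ?_)
  rw [Real.norm_eq_abs, Real.abs_exp, Real.exp_le_exp]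
  refine (le_abs_self _).trans ((abs_add_le _ _).trans ?_)
  rw [abs_mul, abs_mul, abs_of_nonneg (lowDegreeCount_nonneg _ _ _),
    abs_of_nonneg (lowVolume_nonneg _ _ _)]
  refine add_le_add (mul_le_mul_of_nonneg_left (hK _) (abs_nonneg _)) ?_
  exact mul_le_of_le_one_right (abs_nonneg _) (lowVolume_le_one _ _ _)

/-- Adding a multiple of the low-degree volume to the exponent changes the logarithm of the
exponential moment by about the mean of this volume, since the weight is nearly independent of the
number of points in a single ball. -/
theorem abs_log_integral_exp_lowVolume_le (k : ℕ) (l : ℝ≥0) {r : ℝ}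
    (hr : 0 < r) (hr2 : r < 1 / 8) {u : ℝ} (hu : u = l * (unitBallVolume d * r ^ d))
    (t c : ℝ) (hc : |c| * (2 ^ d * (unitBallVolume d * r ^ d)) ≤ 1) :
    |Real.log (∫ m : FiniteMeasure (Cube d),
        Real.exp (t * lowDegreeCount k r (m : Measure (Cube d)) +
          c * lowVolume k r (m : Measure (Cube d))) ∂(poissonLaw (l • volume))) -
      Real.log (∫ m : FiniteMeasure (Cube d),
        Real.exp (t * lowDegreeCount k r (m : Measure (Cube d))) ∂(poissonLaw (l • volume)))| ≤
      Real.exp (2 * (|t| * localBound d k + 1)) * poissonLower (k + 1) u * |c| := by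
  have hθ := unitBallVolume_pos d
  have hu0 : 0 ≤ u := by rw [hu]; positivity
  have hT := measurable_lowDegreeCount (d := d) k r
  have hV := measurable_lowVolume (d := d) k r
  obtain ⟨K, hK⟩ := exists_lowDegreeCount_le d k hr
  have hLB := localBound_nonneg d k
  set Q := poissonLaw (l • (volume : Measure (Cube d))) with hQ
  have hE := measurable_expCount (d := d) k r t
  -- the measure tilted by `exp (t T)`, under which the volume has a nearly unchanged mean
  set ν := Q.withDensity (expCount k r t) with hν
  have hint : ∀ g : FiniteMeasure (Cube d) → ℝ, ∫ m, g m ∂ν = ∫ m : FiniteMeasure (Cube d),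
      Real.exp (t * lowDegreeCount k r (m : Measure (Cube d))) * g m ∂Q := fun g => by
    rw [hν, integral_withDensity_eq_integral_toReal_smul hE
      (ae_of_all _ fun m => ENNReal.ofReal_lt_top)]
    simp only [expCount, ENNReal.toReal_ofReal (Real.exp_pos _).le, smul_eq_mul]
  have hmass : ∫⁻ m, expCount k r t m ∂Q ≤ ENNReal.ofReal (Real.exp (|t| * K)) := by
    refine (lintegral_mono (g := fun _ => ENNReal.ofReal (Real.exp (|t| * K)))
      fun m => ?_).trans_eq (by simp)
    exact ENNReal.ofReal_le_ofReal (exp_mul_lowDegreeCount_le k hK t _)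
  have : IsFiniteMeasure ν := ⟨by
    rw [hν, withDensity_apply _ MeasurableSet.univ, Measure.restrict_univ]
    exact hmass.trans_lt ENNReal.ofReal_lt_top⟩
  have hν0 : ν ≠ 0 := by
    rw [hν, Ne, withDensity_eq_zero_iff hE.aemeasurable]
    intro h0
    obtain ⟨m, hm⟩ := h0.exists
    have : (0 : ℝ≥0∞) < expCount k r t m := ENNReal.ofReal_pos.2 (Real.exp_pos _)
    exact this.ne' hm
  have hVle : ∀ m : FiniteMeasure (Cube d), |lowVolume k r (m : Measure (Cube d))| ≤ 1 :=
      fun m => by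
    rw [abs_of_nonneg (lowVolume_nonneg _ _ _)]; exact lowVolume_le_one _ _ _
  have key : ∀ s, |s| ≤ |c| → ∫⁻ m : FiniteMeasure (Cube d),
      ENNReal.ofReal (lowVolume k r (m : Measure (Cube d))) * ENNReal.ofReal
        (Real.exp (t * lowDegreeCount k r (m : Measure (Cube d)) +
          s * lowVolume k r (m : Measure (Cube d)))) ∂Q ≤
      ENNReal.ofReal (Real.exp (2 * (|t| * localBound d k + 1)) * poissonLower (k + 1) u) *
      ∫⁻ m : FiniteMeasure (Cube d), ENNReal.ofReal
        (Real.exp (t * lowDegreeCount k r (m : Measure (Cube d)) +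
          s * lowVolume k r (m : Measure (Cube d)))) ∂Q := by
    intro s hs
    rw [hQ, lintegral_lowVolume_mul k _ r (by fun_prop)]
    refine (lintegral_mono (g := fun _ => ENNReal.ofReal
      (Real.exp (2 * (|t| * localBound d k + 1)) * poissonLower (k + 1) u) *
      ∫⁻ m : FiniteMeasure (Cube d), ENNReal.ofReal
        (Real.exp (t * lowDegreeCount k r (m : Measure (Cube d)) +
          s * lowVolume k r (m : Measure (Cube d)))) ∂Q) fun x => ?_).trans_eq (by simp [hQ])
    have hB := measurableSet_torusBall x r
    have hS := measurableSet_fewerThan hB (k + 1)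
    refine (lintegral_mul_exp_le_of_local (l • (volume : Measure (Cube d))) hB
      (measurable_one.indicator hS)
      (fun m => by simp [Set.indicator_apply, fewerThan])
      (Φ := fun m : FiniteMeasure (Cube d) => t * lowDegreeCount k r (m : Measure (Cube d)) +
          s * lowVolume k r (m : Measure (Cube d))) (by fun_prop)
      (K := |t| * localBound d k + 1) fun m => ?_).trans_eq ?_
    · have e1 := abs_lowDegreeCount_sub_restrict_le k hr (ρ := 1) (by norm_num) m x
      rw [Nat.cast_one, one_mul] at e1
      have e2 := abs_lowVolume_sub_restrict_le k (r := r) m x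
      rw [volume_torusBall x (by positivity) (by linarith), ENNReal.toReal_ofReal (by positivity),
        mul_pow, mul_left_comm] at e2
      calc _ = |t * (lowDegreeCount k r (m : Measure (Cube d)) - lowDegreeCount k r
              ((m : Measure (Cube d)).restrict (torusBall x r)ᶜ)) +
            s * (lowVolume k r (m : Measure (Cube d)) - lowVolume k r
              ((m : Measure (Cube d)).restrict (torusBall x r)ᶜ))| := by
            congr 1
            rw [FiniteMeasure.restrict_measure_eq]
            ring
        _ ≤ |t| * localBound d k + |c| * (2 ^ d * (unitBallVolume d * r ^ d)) := by
            refine (abs_add_le _ _).trans ?_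
            rw [abs_mul, abs_mul]
            gcongr
        _ ≤ _ := by gcongr
    · rw [lintegral_indicator_one hS, poissonLaw_fewerThan _ hB,
        toReal_smul_volume_torusBall l x hr.le (by linarith), ← hu, ← mul_assoc,
        ← ENNReal.ofReal_mul (by positivity)]
  have hpp := poissonLower_nonneg (k + 1) hu0
  have hi := fun s => integrable_exp_lowDegreeCount_add (d := d) k hr t s Q
  have h := abs_log_integral_exp_sub_le (ν := ν) hν0 hV (C := 1) hVle
    (W := fun _ => 0) (w := fun _ => 0) (fun s => hasDerivAt_const s 0) (s₀ := |c|)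
    (κ := Real.exp (2 * (|t| * localBound d k + 1)) * poissonLower (k + 1) u)
    (fun s hs => by
      have e1 : ∀ m : FiniteMeasure (Cube d),
          Real.exp (t * lowDegreeCount k r (m : Measure (Cube d))) *
            Real.exp (s * lowVolume k r (m : Measure (Cube d))) =
          Real.exp (t * lowDegreeCount k r (m : Measure (Cube d)) +
            s * lowVolume k r (m : Measure (Cube d))) := fun m => (Real.exp_add _ _).symm
      have e2 : ∀ m : FiniteMeasure (Cube d),
          Real.exp (t * lowDegreeCount k r (m : Measure (Cube d))) *
            (lowVolume k r (m : Measure (Cube d)) *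
            Real.exp (s * lowVolume k r (m : Measure (Cube d)))) =
          lowVolume k r (m : Measure (Cube d)) *
            Real.exp (t * lowDegreeCount k r (m : Measure (Cube d)) +
            s * lowVolume k r (m : Measure (Cube d))) := fun m => by
        rw [mul_left_comm, e1]
      simp only [hint, e1, e2, zero_mul, sub_zero]
      have hk := key s hs
      have hVi : Integrable (fun m : FiniteMeasure (Cube d) =>
          lowVolume k r (m : Measure (Cube d)) *
          Real.exp (t * lowDegreeCount k r (m : Measure (Cube d)) +
            s * lowVolume k r (m : Measure (Cube d)))) Q :=
        (hi s).bdd_mul (c := 1) hV.aestronglyMeasurable (ae_of_all _ hVle)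
      have hI0 : 0 ≤ ∫ m : FiniteMeasure (Cube d),
          Real.exp (t * lowDegreeCount k r (m : Measure (Cube d)) +
            s * lowVolume k r (m : Measure (Cube d))) ∂Q :=
        integral_nonneg fun m => (Real.exp_pos _).le
      rw [← ofReal_integral_eq_lintegral_ofReal (hi s) (ae_of_all _ fun m => (Real.exp_pos _).le),
        ← ENNReal.ofReal_mul (by positivity)] at hk
      simp_rw [← ENNReal.ofReal_mul (lowVolume_nonneg k r _)] at hk
      rw [← ofReal_integral_eq_lintegral_ofReal hVi (ae_of_all _ fun m =>
        mul_nonneg (lowVolume_nonneg k r _) (Real.exp_pos _).le),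
        ENNReal.ofReal_le_ofReal_iff (by positivity)] at hk
      rwa [abs_of_nonneg (integral_nonneg fun m =>
        mul_nonneg (lowVolume_nonneg k r _) (Real.exp_pos _).le)]) le_rfl
  have hu' : ν.real Set.univ = ∫ m : FiniteMeasure (Cube d),
      Real.exp (t * lowDegreeCount k r (m : Measure (Cube d))) ∂Q := by
    have := hint fun _ => 1
    simpa using this
  simp only [hint, ← Real.exp_add, sub_self, sub_zero, hu'] at h
  exact h

end LowVolume

/-! ### Asymptotics of the radius, the scaling and the mean -/

section Asymptotics

variable {a : ℕ → ℝ}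

theorem tendsto_pow_mul_exp_neg_comp (ha : Tendsto a atTop atTop) (j : ℕ) :
    Tendsto (fun n => a n ^ j * Real.exp (-a n)) atTop (𝓝 0) :=
  (Real.tendsto_pow_mul_exp_neg_atTop_nhds_zero j).comp ha

theorem tendsto_log_natCast : Tendsto (fun n : ℕ => Real.log n) atTop atTop :=
  Real.tendsto_log_atTop.comp tendsto_natCast_atTop_atTop

/-- Either `a n` is at most half of `log n`, and then `b n` is at least of order `√n`, or
`log a n` may be replaced by `log log n`. -/
theorem tendsto_scaling {k : ℕ} (hk : 1 ≤ k) (ha : Tendsto a atTop atTop)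
    (ha' : Tendsto (fun n : ℕ => a n - Real.log n - ((k : ℝ) - 1) * Real.log (Real.log n))
      atTop atBot) :
    Tendsto (scaling k a) atTop atTop := by
  obtain ⟨k, rfl⟩ : ∃ k', k = k' + 1 := ⟨k - 1, by omega⟩
  have hlog : Tendsto (fun n => Real.log (scaling (k + 1) a n)) atTop atTop := by
    refine tendsto_atTop.2 fun C => ?_
    filter_upwards [ha.eventually_ge_atTop 1, tendsto_log_natCast.eventually_ge_atTop
      (max 1 (2 * C)),
      ha'.eventually_le_atBot (-(C + k * Real.log 2)), eventually_ge_atTop 1] with n h1 h2 h3 hn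
    have hn0 : (0 : ℝ) < n := by exact_mod_cast hn
    have ha0 : 0 < a n := by linarith
    have hL1 := (le_max_left _ _).trans h2
    have hL2 := (le_max_right _ _).trans h2
    rw [scaling, Real.log_mul (by positivity) (by positivity), Real.log_mul (by positivity)
      (by positivity), Real.log_exp, Nat.add_sub_cancel, Real.log_pow]
    push_cast at h3
    rcases le_total (a n) (Real.log n / 2) with h | h
    · have : 0 ≤ (k : ℝ) * Real.log (a n) := mul_nonneg (by positivity) (Real.log_nonneg h1)
      linarith
    · have h4 : Real.log (Real.log n / 2) ≤ Real.log (a n) :=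
        Real.log_le_log (by linarith) h
      rw [Real.log_div (by linarith) (by norm_num)] at h4
      have h5 := mul_le_mul_of_nonneg_left h4 (Nat.cast_nonneg (α := ℝ) k)
      nlinarith
  refine (Real.tendsto_exp_atTop.comp hlog).congr' ?_
  filter_upwards [ha.eventually_ge_atTop 1, eventually_ge_atTop 1] with n h1 hn
  have hn0 : (0 : ℝ) < n := by exact_mod_cast hn
  have ha0 : 0 < a n := by linarith
  exact Real.exp_log (by unfold scaling; positivity)

/-- The upper bound on `a` makes the radii tend to zero. -/
theorem tendsto_div_natCast {k : ℕ} (ha : Tendsto a atTop atTop)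
    (ha' : Tendsto (fun n : ℕ => a n - Real.log n - ((k : ℝ) - 1) * Real.log (Real.log n))
      atTop atBot) :
    Tendsto (fun n : ℕ => a n / n) atTop (𝓝 0) := by
  have hlog : Tendsto (fun n : ℕ => ((k : ℝ) + 2) * (Real.log n / n)) atTop (𝓝 0) := by
    have h := (Real.isLittleO_log_id_atTop.tendsto_div_nhds_zero.comp
      tendsto_natCast_atTop_atTop).const_mul ((k : ℝ) + 2)
    rwa [mul_zero] at h
  refine tendsto_of_tendsto_of_tendsto_of_le_of_le' tendsto_const_nhds hlog ?_ ?_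
  · filter_upwards [ha.eventually_ge_atTop 0] with n h
    positivity
  · filter_upwards [ha'.eventually_le_atBot 0, tendsto_log_natCast.eventually_ge_atTop 1,
      eventually_ge_atTop 1] with n h hL hn
    have hn0 : (0 : ℝ) < n := by exact_mod_cast hn
    rw [← mul_div_assoc]
    gcongr
    have h1 : Real.log (Real.log n) ≤ Real.log n := Real.log_le_self (by linarith)
    have h2 : 0 ≤ Real.log (Real.log n) := Real.log_nonneg hL
    have hk0 : (0 : ℝ) ≤ k := Nat.cast_nonneg k
    nlinarith

variable {d : ℕ} {s₀ : ℝ}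

theorem mul_radius_pow (hd : 1 ≤ d) {n : ℕ} (hn : 1 ≤ n) (h : 0 ≤ a n + s₀) :
    (n : ℝ) * (unitBallVolume d * radius d a s₀ n ^ d) = a n + s₀ := by
  have hθ := unitBallVolume_pos d
  have hn0 : (0 : ℝ) < n := by exact_mod_cast hn
  rw [radius, one_div, Real.rpow_inv_natCast_pow (by positivity) (by omega)]
  field_simp

theorem radius_pos {n : ℕ} (hn : 1 ≤ n) (h : 0 < a n + s₀) : 0 < radius d a s₀ n := by
  have hθ := unitBallVolume_pos d
  have hn0 : (0 : ℝ) < n := by exact_mod_cast hn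
  exact Real.rpow_pos_of_pos (by positivity) _

theorem tendsto_radius (hd : 1 ≤ d) {k : ℕ} (ha : Tendsto a atTop atTop)
    (ha' : Tendsto (fun n : ℕ => a n - Real.log n - ((k : ℝ) - 1) * Real.log (Real.log n))
      atTop atBot) :
    Tendsto (radius d a s₀) atTop (𝓝 0) := by
  have hθ := unitBallVolume_pos d
  have h1 : Tendsto (fun n : ℕ => (a n + s₀) / (n * unitBallVolume d)) atTop (𝓝 0) := by
    have h := ((tendsto_div_natCast ha ha').add
      (tendsto_const_div_atTop_nhds_zero_nat s₀)).div_const (unitBallVolume d)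
    rw [add_zero, zero_div] at h
    refine h.congr fun n => ?_
    rw [← add_div, div_div]
  have h2 := h1.rpow_const (p := 1 / (d : ℝ)) (Or.inr (by positivity))
  rwa [Real.zero_rpow (by positivity)] at h2

theorem eventually_radius (hd : 1 ≤ d) {k : ℕ} (ha : Tendsto a atTop atTop)
    (ha' : Tendsto (fun n : ℕ => a n - Real.log n - ((k : ℝ) - 1) * Real.log (Real.log n))
      atTop atBot) :
    ∀ᶠ n : ℕ in atTop, 0 < radius d a s₀ n ∧ radius d a s₀ n < 1 / 8 ∧
      (n : ℝ) * (unitBallVolume d * radius d a s₀ n ^ d) = a n + s₀ := by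
  filter_upwards [(tendsto_radius (s₀ := s₀) hd ha ha').eventually_lt_const
      (by norm_num : (0 : ℝ) < 1 / 8), ha.eventually_gt_atTop (-s₀), eventually_ge_atTop 1]
    with n h1 h2 hn
  exact ⟨radius_pos hn (by linarith), h1, mul_radius_pow hd hn (by linarith)⟩

/-- In the Poisson probability of fewer than `k` points, the term with `k - 1` points dominates. -/
theorem tendsto_poissonLower_div {k : ℕ} (hk : 1 ≤ k) (ha : Tendsto a atTop atTop) {v : ℕ → ℝ}
    (hv : Tendsto (fun n => v n - a n) atTop (𝓝 s₀)) :
    Tendsto (fun n => poissonLower k (v n) / (a n ^ (k - 1) * Real.exp (-a n))) atTop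
      (𝓝 (Real.exp (-s₀) / (k - 1).factorial)) := by
  obtain ⟨k, rfl⟩ : ∃ k', k = k' + 1 := ⟨k - 1, by omega⟩
  rw [Nat.add_sub_cancel]
  have hinv : Tendsto (fun n => (a n)⁻¹) atTop (𝓝 0) := tendsto_inv_atTop_zero.comp ha
  have hratio : Tendsto (fun n => v n / a n) atTop (𝓝 1) := by
    have h := (hv.mul hinv).const_add 1
    rw [mul_zero, add_zero] at h
    refine h.congr' ?_
    filter_upwards [ha.eventually_gt_atTop 0] with n hn
    field_simp
    ring
  have hsum : Tendsto (fun n => ∑ j ∈ Finset.range (k + 1),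
      (v n / a n) ^ j * (a n)⁻¹ ^ (k - j) / j.factorial) atTop (𝓝 (1 / k.factorial)) := by
    have h := tendsto_finsetSum (Finset.range (k + 1)) fun j _ =>
      ((hratio.pow j).mul (hinv.pow (k - j))).div_const (j.factorial : ℝ)
    convert h using 2
    rw [Finset.sum_range_succ, Finset.sum_eq_zero, Nat.sub_self]
    · simp
    · intro j hj
      have := Finset.mem_range.1 hj
      rw [zero_pow (by omega)]
      simp
  have hexp : Tendsto (fun n => Real.exp (-(v n - a n))) atTop (𝓝 (Real.exp (-s₀))) :=
    (Real.continuous_exp.tendsto _).comp hv.neg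
  have h := hexp.mul hsum
  rw [mul_one_div] at h
  refine h.congr' ?_
  filter_upwards [ha.eventually_gt_atTop 0] with n hn
  have e1 : Real.exp (-(v n - a n)) = Real.exp (-v n) / Real.exp (-a n) := by
    rw [← Real.exp_sub]; congr 1; ring
  have e2 : ∑ j ∈ Finset.range (k + 1), (v n / a n) ^ j * (a n)⁻¹ ^ (k - j) / j.factorial =
      (∑ j ∈ Finset.range (k + 1), v n ^ j / j.factorial) / a n ^ k := by
    rw [Finset.sum_div]
    refine Finset.sum_congr rfl fun j hj => ?_
    have hjk : a n ^ k = a n ^ j * a n ^ (k - j) := by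
      rw [← pow_add]; congr 1; have := Finset.mem_range.1 hj; omega
    rw [hjk, div_pow, inv_pow]
    field_simp
  rw [e1, e2, poissonLower, div_mul_div_comm, mul_comm (Real.exp (-a n))]

/-- The mean number of low-degree points is asymptotic to `α b n`, with `α = exp (-s₀) / (k - 1)!`,
also after small changes of the intensity `n`. -/
theorem tendsto_mul_poissonLower_div_scaling {k : ℕ} (hk : 1 ≤ k) (ha : Tendsto a atTop atTop)
    {l v : ℕ → ℝ} (hl : Tendsto (fun n : ℕ => l n / n) atTop (𝓝 1))
    (hv : Tendsto (fun n => v n - a n) atTop (𝓝 s₀)) :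
    Tendsto (fun n => l n * poissonLower k (v n) / scaling k a n) atTop
      (𝓝 (Real.exp (-s₀) / (k - 1).factorial)) := by
  have h := hl.mul (tendsto_poissonLower_div hk ha hv)
  rw [one_mul] at h
  refine h.congr fun n => ?_
  rw [div_mul_div_comm, scaling, mul_assoc]

/-- The logarithm of the exponential moments of the number of low-degree points of a Poisson
process, at the scale `b n`. -/
theorem tendsto_log_integral_exp_div {k : ℕ} (hd : 1 ≤ d) (hk : 1 ≤ k)
    (ha : Tendsto a atTop atTop)
    (ha' : Tendsto (fun n : ℕ => a n - Real.log n - ((k : ℝ) - 1) * Real.log (Real.log n))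
      atTop atBot) {l : ℕ → ℝ≥0} (hl : Tendsto (fun n : ℕ => (l n : ℝ) / n) atTop (𝓝 1))
    (hv : Tendsto (fun n : ℕ => l n * (unitBallVolume d * radius d a s₀ n ^ d) - a n) atTop (𝓝 s₀))
    (t : ℝ) :
    Tendsto (fun n => Real.log (∫ m : FiniteMeasure (Cube d), Real.exp (t *
      lowDegreeCount k (radius d a s₀ n) (m : Measure (Cube d))) ∂(poissonLaw (l n • volume))) /
        scaling k a n) atTop
      (𝓝 (Real.exp (-s₀) / (k - 1).factorial * (Real.exp t - 1))) := by
  set α := Real.exp (-s₀) / ((k - 1).factorial : ℝ) with hα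
  set v := fun n => l n * (unitBallVolume d * radius d a s₀ n ^ d) with hvdef
  have hlim := tendsto_mul_poissonLower_div_scaling hk ha hl hv
  have hvtop : Tendsto v atTop atTop := by
    have h := hv.add_atTop ha
    exact h.congr fun n => by ring
  have hb := tendsto_scaling hk ha ha'
  have hdiff : Tendsto (fun n => Real.log (∫ m : FiniteMeasure (Cube d), Real.exp (t *
      lowDegreeCount k (radius d a s₀ n) (m : Measure (Cube d))) ∂(poissonLaw (l n • volume))) /
        scaling k a n - l n * poissonLower k (v n) / scaling k a n * (Real.exp t - 1))
      atTop (𝓝 0) := by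
    rw [Metric.tendsto_atTop']
    intro δ hδ
    have hα0 : 0 < α := by positivity
    obtain ⟨u₀, hu₀⟩ := exists_abs_log_integral_exp_le hd hk t (κ := δ / (2 * (α + 1)))
      (by positivity)
    obtain ⟨N, hN⟩ := eventually_atTop.1 (((eventually_radius (s₀ := s₀) hd ha ha').and
      (hvtop.eventually_ge_atTop u₀)).and ((hlim.eventually_le_const (lt_add_one α)).and
        (hb.eventually_gt_atTop 0)))
    refine ⟨N, fun n hn => ?_⟩
    obtain ⟨⟨⟨h1, h2, h3⟩, h4⟩, h5, h6⟩ := hN n hn.le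
    have h := hu₀ (l n) (radius d a s₀ n) h1 h2 h4
    rw [Real.dist_eq, sub_zero, ← mul_div_right_comm, ← sub_div, abs_div, abs_of_pos h6,
      div_lt_iff₀ h6]
    refine h.trans_lt ?_
    rw [div_le_iff₀ h6] at h5
    calc _ ≤ δ / (2 * (α + 1)) * ((α + 1) * scaling k a n) := by gcongr
      _ = δ / 2 * scaling k a n := by field_simp
      _ < _ := by gcongr; linarith
  have h := hdiff.add (hlim.mul_const (Real.exp t - 1))
  rw [zero_add] at h
  exact h.congr fun n => by ring

/-- A reformulation of `HasPoissonLogMGF` by a limit of logarithms. -/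
theorem hasPoissonLogMGF_of_tendsto_log {μ : ℕ → Measure ℝ} {b : ℕ → ℝ} {α : ℝ}
    (hb : Tendsto b atTop atTop) {M : ℝ → ℕ → ℝ} (hM : ∀ t, ∀ᶠ n in atTop, 0 < M t n)
    (hμ : ∀ t, ∀ᶠ n in atTop, ∫⁻ y, ENNReal.ofReal (Real.exp (t * (b n * y))) ∂μ n =
      ENNReal.ofReal (M t n))
    (hlim : ∀ t, Tendsto (fun n => Real.log (M t n) / b n) atTop (𝓝 (α * (Real.exp t - 1)))) :
    HasPoissonLogMGF μ b α := by
  intro t ε hε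
  filter_upwards [hM t, hμ t, hb.eventually_gt_atTop 0,
    (hlim t).eventually_le_const (lt_add_of_pos_right _ hε),
    (hlim t).eventually_const_le (sub_lt_self _ hε)] with n h1 h2 h3 h4 h5
  rw [h2]
  constructor <;> refine ENNReal.ofReal_le_ofReal ?_
  · rw [← Real.le_log_iff_exp_le h1, mul_comm]
    exact (le_div_iff₀ h3).1 h5
  · rw [← Real.log_le_iff_le_exp h1, mul_comm]
    exact (div_le_iff₀ h3).1 h4

end Asymptotics

/-! ### The large deviation principle for the Poisson process -/

section PoissonProcess

/-- A Poisson process of finite intensity measure is almost surely a finite measure. -/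
theorem IsPoissonProcess.exists_finiteMeasure {Ω E : Type*} [MeasurableSpace Ω] [MeasurableSpace E]
    {P : Measure Ω} {Λ : Measure E} [IsFiniteMeasure Λ] {η : Ω → Measure E}
    (hη : IsPoissonProcess P Λ η) : ∃ ζ : Ω → FiniteMeasure E, Measurable ζ ∧
      ∀ᵐ ω ∂P, (ζ ω : Measure E) = η ω := by
  classical
  have hm : Measurable fun ω => η ω Set.univ :=
    (Measure.measurable_coe MeasurableSet.univ).comp hη.measurable
  have hfin : ∀ᵐ ω ∂P, η ω Set.univ < ∞ := by
    have h := congrArg (fun μ => μ {∞}) (hη.poisson Set.univ MeasurableSet.univ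
      (measure_ne_top _ _))
    rw [Measure.map_apply hm (measurableSet_singleton _),
      Measure.map_apply (by fun_prop) (measurableSet_singleton _)] at h
    have h0 : (fun j : ℕ => (j : ℝ≥0∞)) ⁻¹' {∞} = ∅ := by
      ext j
      simp
    rw [h0, measure_empty] at h
    rw [ae_iff]
    refine le_antisymm ((measure_mono fun ω hω => ?_).trans h.le) zero_le
    simpa using hω
  have hf : ∀ ω, IsFiniteMeasure (if η ω Set.univ < ∞ then η ω else 0) := fun ω => by
    split_ifs with h
    · exact ⟨h⟩
    · infer_instance
  refine ⟨fun ω => (⟨if η ω Set.univ < ∞ then η ω else 0, hf ω⟩ : FiniteMeasure E), ?_, ?_⟩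
  · refine measurable_finiteMeasure_of_apply fun A hA => ?_
    have e : (fun ω => (if η ω Set.univ < ∞ then η ω else 0) A) =
        fun ω => if η ω Set.univ < ∞ then η ω A else 0 := by
      ext ω
      split_ifs with h <;> simp
    change Measurable fun ω => (if η ω Set.univ < ∞ then η ω else 0) A
    rw [e]
    exact Measurable.ite (measurableSet_lt hm measurable_const)
      ((Measure.measurable_coe hA).comp hη.measurable) measurable_const
  · filter_upwards [hfin] with ω h
    change (if η ω Set.univ < ∞ then η ω else 0) = η ω
    rw [if_pos h]

variable {d : ℕ} {a : ℕ → ℝ} {s₀ : ℝ}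

theorem satisfiesLDP_poisson {k : ℕ} (hd : 1 ≤ d) (hk : 1 ≤ k) (ha : Tendsto a atTop atTop)
    (ha' : Tendsto (fun n : ℕ => a n - Real.log n - ((k : ℝ) - 1) * Real.log (Real.log n))
      atTop atBot)
    {Ω : Type*} [MeasurableSpace Ω] (P : Measure Ω) [IsProbabilityMeasure P]
    (η : ℕ → Ω → Measure (Cube d))
    (hη : ∀ n : ℕ, 1 ≤ n → IsPoissonProcess P ((n : ℝ≥0∞) • (volume : Measure (Cube d))) (η n)) :
    SatisfiesLDP (fun n => P.map (fun ω =>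
        lowDegreeCount k (radius d a s₀ n) (η n ω) / scaling k a n)) (scaling k a)
      (poissonRate (Real.exp (-s₀) / ((k - 1).factorial : ℝ))) := by
  have hb := tendsto_scaling hk ha ha'
  refine HasPoissonLogMGF.satisfiesLDP ?_ hb (by positivity) (Eventually.of_forall fun n => ?_)
  swap
  · by_cases hm : AEMeasurable (fun ω =>
      lowDegreeCount k (radius d a s₀ n) (η n ω) / scaling k a n) P
    · rw [Measure.map_apply_of_aemeasurable hm MeasurableSet.univ]
      exact prob_le_one
    · rw [Measure.map_of_not_aemeasurable hm]
      simp
  have hint : ∀ᶠ n : ℕ in atTop, ∀ t : ℝ, Integrable (fun m : FiniteMeasure (Cube d) =>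
      Real.exp (t * lowDegreeCount k (radius d a s₀ n) (m : Measure (Cube d))))
      (poissonLaw ((n : ℝ≥0) • volume)) := by
    filter_upwards [eventually_radius (s₀ := s₀) hd ha ha'] with n hn t
    exact integrable_exp_lowDegreeCount k hn.1 t _
  refine hasPoissonLogMGF_of_tendsto_log hb (M := fun t n => ∫ m : FiniteMeasure (Cube d),
    Real.exp (t * lowDegreeCount k (radius d a s₀ n) (m : Measure (Cube d)))
      ∂(poissonLaw ((n : ℝ≥0) • volume))) ?_ ?_ ?_
  · intro t
    filter_upwards [hint] with n hn
    exact integral_exp_pos (hn t)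
  · intro t
    filter_upwards [hint, eventually_ge_atTop 1, hb.eventually_gt_atTop 0] with n hn hn1 hb0
    have hΛ : (n : ℝ≥0∞) • (volume : Measure (Cube d)) = (n : ℝ≥0) • volume := by
      rw [← Measure.coe_nnreal_smul]
      simp
    have hηn := hη n hn1
    rw [hΛ] at hηn
    obtain ⟨ζ, hζ, hζη⟩ := hηn.exists_finiteMeasure
    have hlaw := hηn.map_eq_poissonLaw hζ hζη
    have hT := measurable_lowDegreeCount (d := d) k (radius d a s₀ n)
    have hae : (fun ω => lowDegreeCount k (radius d a s₀ n) (η n ω) / scaling k a n) =ᵐ[P]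
        fun ω => lowDegreeCount k (radius d a s₀ n) (ζ ω : Measure (Cube d)) / scaling k a n := by
      filter_upwards [hζη] with ω h
      rw [h]
    have hmeas : Measurable fun ω =>
        lowDegreeCount k (radius d a s₀ n) (ζ ω : Measure (Cube d)) / scaling k a n :=
      (hT.comp hζ).div_const _
    rw [Measure.map_congr hae, lintegral_map (by fun_prop) hmeas,
      ofReal_integral_eq_lintegral_ofReal (hn t) (ae_of_all _ fun m => (Real.exp_pos _).le),
      ← hlaw, lintegral_map (by fun_prop) hζ]
    refine lintegral_congr fun ω => ?_
    congr 3
    field_simp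
  · intro t
    refine tendsto_log_integral_exp_div hd hk ha ha' ?_ ?_ t
    · refine tendsto_const_nhds.congr' ?_
      filter_upwards [eventually_ge_atTop 1] with n hn
      have hn0 : (n : ℝ) ≠ 0 := by positivity
      rw [NNReal.coe_natCast, div_self hn0]
    · refine tendsto_const_nhds.congr' ?_
      filter_upwards [eventually_radius (s₀ := s₀) hd ha ha'] with n hn
      rw [NNReal.coe_natCast, hn.2.2]
      ring

end PoissonProcess

/-! ### Finite tuples of independent points -/

section TupleLaw

variable {E : Type*} [MeasurableSpace E] (Λ : Measure E)

theorem lintegral_tupleLaw_smul [IsFiniteMeasure Λ] (c : ℝ≥0) (j : ℕ)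
    {F : FiniteMeasure E → ℝ≥0∞} (hF : Measurable F) :
    ∫⁻ m, F m ∂(tupleLaw (c • Λ) j) = (c : ℝ≥0∞) ^ j * ∫⁻ m, F m ∂(tupleLaw Λ j) := by
  induction j generalizing F with
  | zero => simp [lintegral_tupleLaw_zero _ hF]
  | succ j ih =>
    have hG : Measurable fun p : E × FiniteMeasure E => F (p.2 + pointMass p.1) := by fun_prop
    have hG' : Measurable fun x : E => ∫⁻ m, F (m + pointMass x) ∂(tupleLaw Λ j) :=
      hG.lintegral_prod_right'
    rw [lintegral_tupleLaw_succ _ hF, lintegral_tupleLaw_succ _ hF, ← Measure.coe_nnreal_smul,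
      lintegral_smul_measure, smul_eq_mul, Measure.coe_nnreal_smul]
    simp_rw [fun x => ih (F := fun m => F (m + pointMass x)) (by fun_prop)]
    rw [lintegral_const_mul _ hG', pow_succ', mul_assoc]

/-- A Poisson process is a Poisson number of independent points. -/
theorem lintegral_poissonLaw_smul [IsProbabilityMeasure Λ] (c : ℝ≥0)
    {F : FiniteMeasure E → ℝ≥0∞} (hF : Measurable F) :
    ∫⁻ m, F m ∂(poissonLaw (c • Λ)) =
      ∫⁻ j : ℕ, ∫⁻ m, F m ∂(tupleLaw Λ j) ∂(poissonMeasure c) := by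
  rw [lintegral_poissonLaw, lintegral_poissonMeasure]
  simp_rw [lintegral_tupleLaw_smul Λ c _ hF]
  have : ((c • Λ) Set.univ).toReal = c := by
    rw [Measure.smul_apply, measure_univ, ENNReal.toReal_smul]
    simp [NNReal.smul_def]
  rw [this]

instance [IsProbabilityMeasure Λ] (j : ℕ) : IsProbabilityMeasure (tupleLaw Λ j) := ⟨by
  have := lintegral_tupleLaw_mass Λ (F := fun _ => 1) measurable_const j
  simpa using this⟩

theorem lintegral_tupleLaw_add_index [IsFiniteMeasure Λ] (j i : ℕ)
    {F : FiniteMeasure E → ℝ≥0∞} (hF : Measurable F) :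
    ∫⁻ m, F m ∂(tupleLaw Λ (j + i)) =
      ∫⁻ m, ∫⁻ m', F (m + m') ∂(tupleLaw Λ i) ∂(tupleLaw Λ j) := by
  induction i generalizing F with
  | zero =>
    refine lintegral_congr fun m => ?_
    rw [lintegral_tupleLaw_zero _ (by fun_prop), add_zero]
  | succ i ih =>
    have hG : Measurable fun p : FiniteMeasure E × E => F (p.1 + pointMass p.2) := by fun_prop
    rw [← add_assoc, lintegral_tupleLaw_succ _ hF,
      lintegral_lintegral_swap (f := fun x m => F (m + pointMass x))
        (hG.comp measurable_swap).aemeasurable,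
      ih (F := fun m => ∫⁻ x, F (m + pointMass x) ∂Λ) hG.lintegral_prod_right']
    refine lintegral_congr fun m => ?_
    have hG' : Measurable fun p : FiniteMeasure E × E => F (m + p.1 + pointMass p.2) := by fun_prop
    rw [lintegral_tupleLaw_succ _ (by fun_prop),
      lintegral_lintegral_swap (f := fun m' x => F (m + m' + pointMass x)) hG'.aemeasurable]
    simp only [add_assoc]

/-- An inequality between functionals only has to be checked on finite sums of Dirac measures. -/
theorem lintegral_tupleLaw_mono [IsFiniteMeasure Λ] (j : ℕ) {F G : FiniteMeasure E → ℝ≥0∞}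
    (hF : Measurable F) (hG : Measurable G)
    (h : ∀ s : List E, F (s.map pointMass).sum ≤ G (s.map pointMass).sum) :
    ∫⁻ m, F m ∂(tupleLaw Λ j) ≤ ∫⁻ m, G m ∂(tupleLaw Λ j) := by
  induction j generalizing F G with
  | zero =>
    rw [lintegral_tupleLaw_zero _ hF, lintegral_tupleLaw_zero _ hG]
    simpa using h []
  | succ j ih =>
    rw [lintegral_tupleLaw_succ _ hF, lintegral_tupleLaw_succ _ hG]
    refine lintegral_mono fun x => ih (by fun_prop) (by fun_prop) fun s => ?_
    simpa [add_comm] using h (x :: s)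

/-- The expectation of a product over independent points is a product of expectations. -/
theorem lintegral_tupleLaw_of_multiplicative [IsFiniteMeasure Λ] {G : FiniteMeasure E → ℝ≥0∞}
    {g : E → ℝ≥0∞} (hG : Measurable G) (h0 : G 0 = 1)
    (hadd : ∀ m x, G (m + pointMass x) = g x * G m) (hg : Measurable g) (j : ℕ) :
    ∫⁻ m, G m ∂(tupleLaw Λ j) = (∫⁻ x, g x ∂Λ) ^ j := by
  induction j with
  | zero => rw [lintegral_tupleLaw_zero _ hG, h0, pow_zero]
  | succ j ih =>
    rw [lintegral_tupleLaw_succ _ hG]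
    simp_rw [hadd, lintegral_const_mul _ hG, ih]
    rw [lintegral_mul_const _ hg, pow_succ']

/-- The law of the empirical sum of `n` independent points. -/
theorem map_sum_pointMass_eq_tupleLaw {Ω : Type*} [MeasurableSpace Ω] {P : Measure Ω}
    [IsProbabilityMeasure P] {X : ℕ → Ω → E} (hX : ∀ i, Measurable (X i)) (hind : iIndepFun X P)
    (hlaw : ∀ i, P.map (X i) = Λ) [IsFiniteMeasure Λ] (n : ℕ) :
    P.map (fun ω => ∑ i ∈ Finset.range n, pointMass (X i ω)) = tupleLaw Λ n := by
  have hY : ∀ i, Measurable fun ω => pointMass (X i ω) := fun i => by have := hX i; fun_prop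
  have hYind : iIndepFun (fun i ω => pointMass (X i ω)) P :=
    hind.comp (fun _ => pointMass) fun _ => measurable_pointMass
  have hS : ∀ n, Measurable fun ω => ∑ i ∈ Finset.range n, pointMass (X i ω) := fun n =>
    Finset.measurable_sum _ fun i _ => hY i
  induction n with
  | zero =>
    simp only [Finset.range_zero, Finset.sum_empty]
    rw [Measure.map_const, measure_univ, one_smul]
    rfl
  | succ n ih =>
    have h := hYind.indepFun_sum_range_succ hY n
    have h2 : P.map (fun ω => (∑ i ∈ Finset.range n, pointMass (X i ω), pointMass (X n ω))) =
        (tupleLaw Λ n).prod (Λ.map pointMass) := by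
      have e : (∑ i ∈ Finset.range n, fun ω => pointMass (X i ω)) =
          fun ω => ∑ i ∈ Finset.range n, pointMass (X i ω) := by
        ext1 ω
        rw [Finset.sum_apply]
      rw [e] at h
      rw [(indepFun_iff_map_prod_eq_prod_map_map (hS n).aemeasurable (hY n).aemeasurable).1 h, ih,
        ← hlaw n, Measure.map_map measurable_pointMass (hX n)]
      rfl
    refine Measure.ext_of_lintegral _ fun F hF => ?_
    have hF2 : Measurable fun p : FiniteMeasure E × FiniteMeasure E => F (p.1 + p.2) := by fun_prop
    have hF3 : Measurable fun m : FiniteMeasure E => ∫⁻ m', F (m' + m) ∂(tupleLaw Λ n) :=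
      (hF2.comp measurable_swap).lintegral_prod_right'
    rw [lintegral_map hF (hS _), lintegral_tupleLaw_succ _ hF]
    simp_rw [Finset.sum_range_succ]
    rw [← lintegral_map (f := fun p : FiniteMeasure E × FiniteMeasure E => F (p.1 + p.2)) hF2
      ((hS n).prodMk (hY n)), h2, lintegral_prod_symm' _ hF2, lintegral_map hF3
        measurable_pointMass]

end TupleLaw

/-! ### The influence of additional points -/

section Influence

variable {d : ℕ}

/-- Fubini's theorem for the symmetric relation of being at distance at most `r`. -/
theorem lintegral_apply_torusBall_inter (r : ℝ) (m m' : Measure (Cube d)) [IsFiniteMeasure m]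
    [IsFiniteMeasure m'] (S : Set (Cube d)) :
    ∫⁻ x, m (torusBall x r ∩ S) ∂m' = ∫⁻ y in S, m' (torusBall y r) ∂m := by
  obtain ⟨D, hDdef⟩ : ∃ D, D = {p : Cube d × Cube d | torusDist p.1 p.2 ≤ r} := ⟨_, rfl⟩
  have hD : MeasurableSet D := hDdef ▸ measurableSet_torusDist_le r
  have e1 : ∀ x : Cube d, Prod.mk x ⁻¹' D = torusBall x r := fun x => by rw [hDdef]; rfl
  have e2 : ∀ y : Cube d, (fun x => (x, y)) ⁻¹' D = torusBall y r := fun y => by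
    ext x
    rw [mem_torusBall_comm, hDdef]
    rfl
  have h1 := Measure.prod_apply (μ := m') (ν := m.restrict S) hD
  rw [Measure.prod_apply_symm hD] at h1
  simp only [e1, e2] at h1
  rw [h1]
  exact lintegral_congr fun x => (Measure.restrict_apply (measurableSet_torusBall x r)).symm

/-- A bound for the effect of an additional point at `y` on the number of low-degree points: the
point itself, if it is of low degree, and the low-degree points that it can raise. -/
noncomputable def influence (k : ℕ) (r : ℝ) (m : Measure (Cube d)) (y : Cube d) : ℝ≥0∞ :=
  (lowSet k r m).indicator 1 y + m (torusBall y r ∩ lowSet k r m)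

/-- A uniform bound for `influence`. -/
noncomputable def influenceBound (d k : ℕ) : ℕ := 1 + coverNumber d 1 * k

theorem influence_le (k : ℕ) {r : ℝ} (hr : 0 < r) (m : Measure (Cube d)) (y : Cube d) :
    influence k r m y ≤ influenceBound d k := by
  have h := measure_torusBall_inter_lowSet_le k hr 1 m y
  rw [one_mul] at h
  rw [influence, influenceBound, Nat.cast_add, Nat.cast_one]
  exact add_le_add (Set.indicator_le_self' (fun _ _ => zero_le_one) y) h

variable (m : FiniteMeasure (Cube d))

theorem measurable_influence (k : ℕ) (r : ℝ) :
    Measurable (influence k r (m : Measure (Cube d))) :=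
  (measurable_one.indicator (measurableSet_lowSet k r _)).add
    ((measurable_apply_torusBall_inter r (measurableSet_lowSet k r (m : Measure (Cube d)))).comp
      (measurable_prodMk_left (x := m)))

theorem lintegral_influence (k : ℕ) (r : ℝ) (m' : Measure (Cube d)) [IsFiniteMeasure m'] :
    ∫⁻ y, influence k r (m : Measure (Cube d)) y ∂m' = m' (lowSet k r m) +
      ∫⁻ y in lowSet k r (m : Measure (Cube d)), m' (torusBall y r) ∂(m : Measure (Cube d)) := by
  have hS := measurableSet_lowSet k r (m : Measure (Cube d))
  unfold influence
  rw [lintegral_add_left (measurable_one.indicator hS), lintegral_indicator_one hS,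
    lintegral_apply_torusBall_inter]

theorem lintegral_influence_volume (k : ℕ) {r : ℝ} (hr : 0 ≤ r) (hr2 : r < 1 / 2) :
    ∫⁻ y, influence k r (m : Measure (Cube d)) y = ENNReal.ofReal
      (lowVolume k r (m : Measure (Cube d)) +
      unitBallVolume d * r ^ d * lowDegreeCount k r (m : Measure (Cube d))) := by
  have hθ := unitBallVolume_pos d
  rw [lintegral_influence]
  simp_rw [volume_torusBall _ hr hr2]
  rw [setLIntegral_const, lowDegreeCount_eq, ENNReal.ofReal_add (lowVolume_nonneg k r _)
    (by positivity), ofReal_lowVolume,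
    ENNReal.ofReal_mul (p := unitBallVolume d * r ^ d) (by positivity), ofReal_measureReal]

/-- A configuration has either no point or at least one point in a set. -/
theorem list_sum_pointMass_apply_eq_zero_or (s : List (Cube d)) {A : Set (Cube d)}
    (hA : MeasurableSet A) :
    ((s.map pointMass).sum : Measure (Cube d)) A = 0 ∨
      1 ≤ ((s.map pointMass).sum : Measure (Cube d)) A := by
  induction s with
  | nil => simp
  | cons x s ih =>
    rw [List.map_cons, List.sum_cons, FiniteMeasure.toMeasure_add, Measure.add_apply,
      toMeasure_pointMass]
    by_cases hx : x ∈ A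
    · right
      rw [Measure.dirac_apply_of_mem hx]
      exact le_self_add
    · rw [Measure.dirac_apply' _ hA, Set.indicator_of_notMem hx, zero_add]
      exact ih

/-- Additional points change the number of low-degree points by at most their total influence. -/
theorem abs_lowDegreeCount_add_list_sum_sub_le (k : ℕ) (r : ℝ) (s : List (Cube d)) :
    |lowDegreeCount k r ((m : Measure (Cube d)) +
      (((s.map pointMass).sum : FiniteMeasure (Cube d)) : Measure (Cube d))) -
      lowDegreeCount k r (m : Measure (Cube d))| ≤
      (∫⁻ y, influence k r (m : Measure (Cube d)) y
        ∂((s.map pointMass).sum : Measure (Cube d))).toReal := by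
  have hint : ∀ A : Set (Cube d), MeasurableSet A →
      ((s.map pointMass).sum : Measure (Cube d)) A = 0 ∨
        1 ≤ ((s.map pointMass).sum : Measure (Cube d)) A :=
    fun A hA => list_sum_pointMass_apply_eq_zero_or s hA
  generalize ((s.map pointMass).sum : FiniteMeasure (Cube d)) = m' at *
  have hfin : ∫⁻ y in lowSet k r (m : Measure (Cube d)), (m' : Measure (Cube d)) (torusBall y r)
      ∂(m : Measure (Cube d)) ≠ ∞ := by
    refine ((lintegral_mono (g := fun _ => (m' : Measure (Cube d)) Set.univ)
      fun y => measure_mono (Set.subset_univ _)).trans_lt ?_).ne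
    rw [lintegral_const]
    finiteness
  have hsub : lowSet k r ((m : Measure (Cube d)) + (m' : Measure (Cube d))) ⊆ lowSet k r
    (m : Measure (Cube d)) :=
    lowSet_anti k r (Measure.le_add_right le_rfl)
  have hlost : (m : Measure (Cube d)) (lowSet k r m \ lowSet k r
    ((m : Measure (Cube d)) + (m' : Measure (Cube d)))) ≤
      ∫⁻ y in lowSet k r (m : Measure (Cube d)), (m' : Measure (Cube d)) (torusBall y r)
      ∂(m : Measure (Cube d)) := by
    have hS := measurableSet_lowSet k r (m : Measure (Cube d))
    have hS' := measurableSet_lowSet k r ((m : Measure (Cube d)) + (m' : Measure (Cube d)))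
    rw [← lintegral_indicator_one (hS.diff hS'), ← lintegral_indicator hS]
    refine lintegral_mono fun y => ?_
    by_cases hy : y ∈ lowSet k r (m : Measure (Cube d)) \
        lowSet k r ((m : Measure (Cube d)) + (m' : Measure (Cube d)))
    · rw [Set.indicator_of_mem hy, Set.indicator_of_mem hy.1]
      -- a point which loses its low degree has an additional point in its ball
      rcases hint _ (measurableSet_torusBall y r) with h | h
      · exact absurd (by rw [mem_lowSet, Measure.add_apply, h, add_zero]; exact hy.1) hy.2
      · exact h
    · rw [Set.indicator_of_notMem hy]
      exact zero_le
  rw [lowDegreeCount_add, lintegral_influence, ENNReal.toReal_add (by finiteness) hfin]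
  have h1 := ENNReal.toReal_mono hfin hlost
  have h2 := ENNReal.toReal_mono (by finiteness)
    (measure_mono (μ := (m' : Measure (Cube d))) hsub)
  have h3 : 0 ≤ (m' : Measure (Cube d)).real (lowSet k r
    ((m : Measure (Cube d)) + (m' : Measure (Cube d)))) :=
    measureReal_nonneg
  have h4 : 0 ≤ (m : Measure (Cube d)).real
    (lowSet k r m \ lowSet k r ((m : Measure (Cube d)) + (m' : Measure (Cube d)))) :=
      measureReal_nonneg
  simp only [Measure.real] at h3 h4 ⊢
  rw [abs_le]
  constructor <;> linarith

end Influence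

/-! ### Exponential moments of bounded variables -/

section ExpBounds

variable {Ω : Type*} [MeasurableSpace Ω] {μ : Measure Ω} [IsProbabilityMeasure μ]

/-- An exponential moment of a bounded nonnegative variable is bounded in terms of its mean. -/
theorem lintegral_exp_le_exp_integral {h : Ω → ℝ} (hm : Measurable h) (h0 : ∀ ω, 0 ≤ h ω) {H : ℝ}
    (hH : ∀ ω, h ω ≤ H) {s : ℝ} (hs : 0 ≤ s) :
    ∫⁻ ω, ENNReal.ofReal (Real.exp (s * h ω)) ∂μ ≤
      ENNReal.ofReal (Real.exp (s * Real.exp (s * H) * ∫ ω, h ω ∂μ)) := by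
  have hi : Integrable h μ := Integrable.of_bound hm.aestronglyMeasurable H (ae_of_all _ fun ω => by
    rw [Real.norm_eq_abs, abs_of_nonneg (h0 ω)]; exact hH ω)
  have hpt : ∀ ω, Real.exp (s * h ω) ≤ 1 + s * Real.exp (s * H) * h ω := fun ω => by
    have h1 := exp_le_exp_add (a := s * h ω) (b := 0) (c := s * H) (δ := s * h ω) (by simp)
      (mul_nonneg hs (h0 ω)) (mul_le_mul_of_nonneg_left (hH ω) hs)
    rw [Real.exp_zero] at h1
    linarith
  have hI : 0 ≤ ∫ ω, h ω ∂μ := integral_nonneg h0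
  calc _ ≤ ∫⁻ ω, ENNReal.ofReal (1 + s * Real.exp (s * H) * h ω) ∂μ :=
        lintegral_mono fun ω => ENNReal.ofReal_le_ofReal (hpt ω)
    _ = ENNReal.ofReal (∫ ω, (1 + s * Real.exp (s * H) * h ω) ∂μ) := by
        refine (ofReal_integral_eq_lintegral_ofReal ((integrable_const _).add (hi.const_mul _))
          (ae_of_all _ fun ω => ?_)).symm
        have := h0 ω
        simp only [Pi.zero_apply, Pi.add_apply]
        positivity
    _ ≤ _ := by
        refine ENNReal.ofReal_le_ofReal ?_
        rw [integral_add (integrable_const _) (hi.const_mul _), integral_const_mul]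
        simp only [integral_const, probReal_univ, smul_eq_mul, one_mul]
        linarith [Real.add_one_le_exp (s * Real.exp (s * H) * ∫ ω, h ω ∂μ)]

/-- Jensen's inequality for the exponential function. -/
theorem exp_integral_le_lintegral_exp {h : Ω → ℝ} (hm : Measurable h) (h0 : ∀ ω, 0 ≤ h ω) {H : ℝ}
    (hH : ∀ ω, h ω ≤ H) {s : ℝ} (hs : 0 ≤ s) :
    ENNReal.ofReal (Real.exp (-(s * ∫ ω, h ω ∂μ))) ≤
      ∫⁻ ω, ENNReal.ofReal (Real.exp (-s * h ω)) ∂μ := by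
  have hi : Integrable h μ := Integrable.of_bound hm.aestronglyMeasurable H (ae_of_all _ fun ω => by
    rw [Real.norm_eq_abs, abs_of_nonneg (h0 ω)]; exact hH ω)
  have hei : Integrable (fun ω => Real.exp (-s * h ω)) μ :=
    Integrable.of_bound (by fun_prop) 1 (ae_of_all _ fun ω => by
      rw [Real.norm_eq_abs, Real.abs_exp, Real.exp_le_one_iff, neg_mul]
      exact neg_nonpos.2 (mul_nonneg hs (h0 ω)))
  rw [← ofReal_integral_eq_lintegral_ofReal hei (ae_of_all _ fun ω => (Real.exp_pos _).le)]
  refine ENNReal.ofReal_le_ofReal ?_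
  set A := Real.exp (-(s * ∫ ω, h ω ∂μ)) with hA
  -- the graph of the exponential function lies above its tangent at the mean
  have hpt : ∀ ω, A + -(A * s) * (h ω - ∫ ω, h ω ∂μ) ≤ Real.exp (-s * h ω) := fun ω => by
    have h1 := Real.add_one_le_exp (-s * h ω + s * ∫ ω, h ω ∂μ)
    have h2 : Real.exp (-s * h ω) = A * Real.exp (-s * h ω + s * ∫ ω, h ω ∂μ) := by
      rw [hA, ← Real.exp_add]; congr 1; ring
    have h3 : 0 < A := Real.exp_pos _
    rw [h2]
    nlinarith
  have hsub : Integrable (fun ω => h ω - ∫ ω, h ω ∂μ) μ := hi.sub (integrable_const _)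
  have h := integral_mono ((integrable_const A).add (hsub.const_mul (-(A * s)))) hei hpt
  simp only [Pi.add_apply] at h
  rw [integral_add (integrable_const A) (hsub.const_mul _), integral_const_mul,
    integral_sub hi (integrable_const _)] at h
  simpa using h

end ExpBounds

/-! ### Exponential moments for different numbers of points -/

section Block

variable {d : ℕ}

/-- The relative weight of the total influence in the exponential moment of order `t`. -/
noncomputable def influenceConst (d k : ℕ) (t : ℝ) : ℝ :=
  |t| * Real.exp (|t| * influenceBound d k)

theorem influenceConst_nonneg (d k : ℕ) (t : ℝ) : 0 ≤ influenceConst d k t := by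
  unfold influenceConst; positivity

/-- The influences of independent points are independent. -/
theorem lintegral_tupleLaw_exp_influence (k : ℕ) {r : ℝ} (hr : 0 < r) (m : FiniteMeasure (Cube d))
    (s : ℝ) (i : ℕ) :
    ∫⁻ m' : FiniteMeasure (Cube d), ENNReal.ofReal (Real.exp (s *
        (∫⁻ y, influence k r (m : Measure (Cube d)) y ∂(m' : Measure (Cube d))).toReal))
        ∂(tupleLaw (volume : Measure (Cube d)) i) =
      (∫⁻ y : Cube d, ENNReal.ofReal (Real.exp
        (s * (influence k r (m : Measure (Cube d)) y).toReal))) ^ i := by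
  have hI := measurable_influence m k r
  have hfin : ∀ m' : FiniteMeasure (Cube d),
      ∫⁻ y, influence k r (m : Measure (Cube d)) y ∂(m' : Measure (Cube d)) ≠ ∞ := fun m' => by
    refine ((lintegral_mono fun y => influence_le k hr _ y).trans_lt ?_).ne
    rw [lintegral_const]
    finiteness
  have hm : Measurable fun m' : FiniteMeasure (Cube d) =>
      ∫⁻ y, influence k r (m : Measure (Cube d)) y ∂(m' : Measure (Cube d)) :=
    measurable_finiteMeasure_lintegral_id (F := fun p => influence k r (m : Measure (Cube d)) p.2)
      (hI.comp measurable_snd)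
  refine lintegral_tupleLaw_of_multiplicative _ (by fun_prop) (by simp) (fun m' x => ?_)
    (by fun_prop) i
  rw [FiniteMeasure.toMeasure_add, toMeasure_pointMass, lintegral_add_measure,
    lintegral_dirac' _ hI, ENNReal.toReal_add (hfin m')
      ((influence_le k hr _ x).trans_lt (ENNReal.natCast_lt_top _)).ne, mul_add, Real.exp_add,
    ENNReal.ofReal_mul (Real.exp_pos _).le, mul_comm]

/-- The mean influence of a uniform point. A low-degree point is near a uniform point with
probability `θ r ^ d`. -/
theorem integral_influence (k : ℕ) {r : ℝ} (hr : 0 < r) (hr2 : r < 1 / 2)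
    (m : FiniteMeasure (Cube d)) :
    ∫ y : Cube d, (influence k r (m : Measure (Cube d)) y).toReal = lowVolume k r
      (m : Measure (Cube d)) +
      unitBallVolume d * r ^ d * lowDegreeCount k r (m : Measure (Cube d)) := by
  have hθ := unitBallVolume_pos d
  have := lowVolume_nonneg k r (m : Measure (Cube d))
  have := lowDegreeCount_nonneg k r (m : Measure (Cube d))
  rw [integral_toReal (measurable_influence m k r).aemeasurable (ae_of_all _ fun y =>
    (influence_le k hr _ y).trans_lt (ENNReal.natCast_lt_top _)),
    lintegral_influence_volume m k hr.le hr2, ENNReal.toReal_ofReal (by positivity)]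

/-- The mean effect of `i` additional uniform points on the exponential moment. -/
theorem lintegral_tupleLaw_expCount_add (k : ℕ) {r : ℝ} (hr : 0 < r) (hr2 : r < 1 / 2) (t : ℝ)
    (m : FiniteMeasure (Cube d)) (i : ℕ) :
    ∫⁻ m', expCount k r t (m + m') ∂(tupleLaw (volume : Measure (Cube d)) i) ≤
      ENNReal.ofReal (Real.exp (t * lowDegreeCount k r (m : Measure (Cube d)) +
        i * (influenceConst d k t * (lowVolume k r (m : Measure (Cube d)) +
          unitBallVolume d * r ^ d * lowDegreeCount k r (m : Measure (Cube d)))))) ∧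
    ENNReal.ofReal (Real.exp (t * lowDegreeCount k r (m : Measure (Cube d)) -
        i * (influenceConst d k t * (lowVolume k r (m : Measure (Cube d)) +
          unitBallVolume d * r ^ d * lowDegreeCount k r (m : Measure (Cube d)))))) ≤
      ∫⁻ m', expCount k r t (m + m') ∂(tupleLaw (volume : Measure (Cube d)) i) := by
  have hθ := unitBallVolume_pos d
  have hI := measurable_influence m k r
  have hV := lowVolume_nonneg k r (m : Measure (Cube d))
  have hT := lowDegreeCount_nonneg k r (m : Measure (Cube d))
  have hm : Measurable fun m' : FiniteMeasure (Cube d) =>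
      ∫⁻ y, influence k r (m : Measure (Cube d)) y ∂(m' : Measure (Cube d)) :=
    measurable_finiteMeasure_lintegral_id (F := fun p => influence k r (m : Measure (Cube d)) p.2)
      (hI.comp measurable_snd)
  have hE : Measurable fun m' => expCount k r t (m + m') :=
    (measurable_expCount k r t).comp (measurable_id.const_add m)
  have hh0 : ∀ y, 0 ≤ (influence k r (m : Measure (Cube d)) y).toReal :=
    fun y => ENNReal.toReal_nonneg
  have hhH : ∀ y, (influence k r (m : Measure (Cube d)) y).toReal ≤ influenceBound d k := fun y =>
    (ENNReal.toReal_mono (ENNReal.natCast_ne_top _) (influence_le k hr _ y)).trans_eq (by simp)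
  have hbase : ∀ s : List (Cube d), |t * lowDegreeCount k r
      ((m + (s.map pointMass).sum : FiniteMeasure (Cube d)) : Measure (Cube d)) -
      t * lowDegreeCount k r (m : Measure (Cube d))| ≤ |t| * (∫⁻ y, influence k r
        (m : Measure (Cube d)) y ∂((s.map pointMass).sum : Measure (Cube d))).toReal := fun s => by
    rw [← mul_sub, abs_mul, FiniteMeasure.toMeasure_add]
    exact mul_le_mul_of_nonneg_left (abs_lowDegreeCount_add_list_sum_sub_le m k r s) (abs_nonneg t)
  have hG : ∀ s : ℝ, Measurable fun m' : FiniteMeasure (Cube d) =>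
      ENNReal.ofReal (Real.exp (s *
        (∫⁻ y, influence k r (m : Measure (Cube d)) y ∂(m' : Measure (Cube d))).toReal)) :=
    fun s => by fun_prop
  have hGc : ∀ s : ℝ, Measurable fun m' : FiniteMeasure (Cube d) =>
      ENNReal.ofReal (Real.exp (t * lowDegreeCount k r (m : Measure (Cube d)))) *
      ENNReal.ofReal (Real.exp (s *
        (∫⁻ y, influence k r (m : Measure (Cube d)) y ∂(m' : Measure (Cube d))).toReal)) :=
    fun s => Measurable.const_mul (hG s) _
  rw [← integral_influence k hr hr2 m]
  constructor
  · refine le_trans (lintegral_tupleLaw_mono (volume : Measure (Cube d)) i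
    (F := fun m' => expCount k r t (m + m'))
      (G := fun m' =>
      ENNReal.ofReal (Real.exp (t * lowDegreeCount k r (m : Measure (Cube d)))) *
      ENNReal.ofReal (Real.exp (|t| * (∫⁻ y, influence k r (m : Measure (Cube d)) y
        ∂(m' : Measure (Cube d))).toReal))) hE (hGc |t|) fun s => ?_) ?_
    · have hb := sub_le_iff_le_add'.1 (abs_le.1 (hbase s)).2
      rw [← ENNReal.ofReal_mul (Real.exp_pos _).le, ← Real.exp_add, expCount]
      exact ENNReal.ofReal_le_ofReal (Real.exp_le_exp.2 hb)
    · rw [lintegral_const_mul _ (hG |t|), lintegral_tupleLaw_exp_influence k hr m,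
        Real.exp_add, ENNReal.ofReal_mul (Real.exp_pos _).le, Real.exp_nat_mul,
        ENNReal.ofReal_pow (Real.exp_pos _).le]
      gcongr
      exact lintegral_exp_le_exp_integral hI.ennreal_toReal hh0 hhH (abs_nonneg t)
  · refine le_trans ?_ (lintegral_tupleLaw_mono (volume : Measure (Cube d)) i (F := fun m' =>
      ENNReal.ofReal (Real.exp (t * lowDegreeCount k r (m : Measure (Cube d)))) *
      ENNReal.ofReal (Real.exp (-|t| * (∫⁻ y, influence k r (m : Measure (Cube d)) y
        ∂(m' : Measure (Cube d))).toReal))) (G := fun m' => expCount k r t (m + m'))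
        (hGc (-|t|)) hE fun s => ?_)
    · rw [lintegral_const_mul _ (hG (-|t|)), lintegral_tupleLaw_exp_influence k hr m,
      sub_eq_add_neg,
        ← mul_neg, Real.exp_add, ENNReal.ofReal_mul (Real.exp_pos _).le, Real.exp_nat_mul,
        ENNReal.ofReal_pow (Real.exp_pos _).le]
      gcongr
      refine le_trans (ENNReal.ofReal_le_ofReal (Real.exp_le_exp.2 (neg_le_neg ?_)))
        (exp_integral_le_lintegral_exp hI.ennreal_toReal hh0 hhH (abs_nonneg t))
      refine mul_le_mul_of_nonneg_right ?_ (integral_nonneg hh0)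
      exact le_mul_of_one_le_right (abs_nonneg t) (Real.one_le_exp (by positivity))
    · have hb := le_sub_iff_add_le'.1 (abs_le.1 (hbase s)).1
      rw [← neg_mul] at hb
      rw [← ENNReal.ofReal_mul (Real.exp_pos _).le, ← Real.exp_add, expCount]
      exact ENNReal.ofReal_le_ofReal (Real.exp_le_exp.2 hb)

/-- Comparison of the exponential moments for different numbers of points. -/
theorem lintegral_tupleLaw_expCount_le (k : ℕ) {r : ℝ} (hr : 0 < r) (hr2 : r < 1 / 2) (t : ℝ)
    {j n : ℕ} (hjn : j ≤ n) {c η : ℝ} (hc : ((n : ℝ) - j) * influenceConst d k t ≤ c)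
    (hη : c * (unitBallVolume d * r ^ d) ≤ η) :
    ∫⁻ m, expCount k r t m ∂(tupleLaw (volume : Measure (Cube d)) n) ≤
      ∫⁻ m : FiniteMeasure (Cube d), ENNReal.ofReal (Real.exp ((t + η) *
        lowDegreeCount k r (m : Measure (Cube d)) + c * lowVolume k r (m : Measure (Cube d))))
        ∂(tupleLaw (volume : Measure (Cube d)) j) ∧
    ∫⁻ m : FiniteMeasure (Cube d), ENNReal.ofReal (Real.exp ((t - η) *
        lowDegreeCount k r (m : Measure (Cube d)) + -c * lowVolume k r (m : Measure (Cube d))))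
        ∂(tupleLaw (volume : Measure (Cube d)) j) ≤
      ∫⁻ m, expCount k r t m ∂(tupleLaw (volume : Measure (Cube d)) n) := by
  obtain ⟨i, rfl⟩ := Nat.exists_eq_add_of_le hjn
  rw [lintegral_tupleLaw_add_index _ j i (measurable_expCount k r t)]
  have hθ := unitBallVolume_pos d
  have hc0 : 0 ≤ c := le_trans (mul_nonneg (by simp) (influenceConst_nonneg d k t)) hc
  have hkey : ∀ m : FiniteMeasure (Cube d), i * (influenceConst d k t *
    (lowVolume k r (m : Measure (Cube d)) +
      unitBallVolume d * r ^ d * lowDegreeCount k r (m : Measure (Cube d)))) ≤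
      c * lowVolume k r (m : Measure (Cube d)) +
        η * lowDegreeCount k r (m : Measure (Cube d)) := fun m => by
    have hV := lowVolume_nonneg k r (m : Measure (Cube d))
    have hT := lowDegreeCount_nonneg k r (m : Measure (Cube d))
    rw [Nat.cast_add] at hc
    rw [add_sub_cancel_left] at hc
    calc _ = i * influenceConst d k t * (lowVolume k r (m : Measure (Cube d)) +
          unitBallVolume d * r ^ d * lowDegreeCount k r (m : Measure (Cube d))) := by ring
      _ ≤ c * (lowVolume k r (m : Measure (Cube d)) +
          unitBallVolume d * r ^ d * lowDegreeCount k r (m : Measure (Cube d))) := by gcongr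
      _ = c * lowVolume k r (m : Measure (Cube d)) + c * (unitBallVolume d * r ^ d) *
          lowDegreeCount k r (m : Measure (Cube d)) := by ring
      _ ≤ _ := by gcongr
  constructor
  · refine lintegral_mono fun m => (lintegral_tupleLaw_expCount_add k hr hr2 t m i).1.trans ?_
    refine ENNReal.ofReal_le_ofReal (Real.exp_le_exp.2 ?_)
    linarith [hkey m]
  · refine lintegral_mono fun m => le_trans ?_ (lintegral_tupleLaw_expCount_add k hr hr2 t m i).2
    refine ENNReal.ofReal_le_ofReal (Real.exp_le_exp.2 ?_)
    linarith [hkey m]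

end Block

/-! ### Deviations of a Poisson variable -/

section PoissonTail

/-- The moment generating function of a centred Poisson variable. -/
theorem lintegral_exp_poissonMeasure (c : ℝ≥0) (s : ℝ) :
    ∫⁻ j : ℕ, ENNReal.ofReal (Real.exp (s * (j - c))) ∂(poissonMeasure c) =
      ENNReal.ofReal (Real.exp (c * (Real.exp s - 1 - s))) := by
  have e : ∀ j : ℕ, (j.factorial : ℝ≥0∞)⁻¹ * ((c : ℝ≥0∞) ^ j *
      ENNReal.ofReal (Real.exp (s * (j - c)))) = ENNReal.ofReal (Real.exp (-(s * c))) *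
        ENNReal.ofReal ((c * Real.exp s) ^ j / j.factorial) := fun j => by
    rw [← ENNReal.ofReal_mul (Real.exp_pos _).le, ← ENNReal.ofReal_coe_nnreal,
      ← ENNReal.ofReal_pow c.coe_nonneg, ← ENNReal.ofReal_mul (by positivity),
      ← ENNReal.ofReal_natCast, ← ENNReal.ofReal_inv_of_pos (by positivity),
      ← ENNReal.ofReal_mul (by positivity), mul_pow, ← Real.exp_nat_mul,
      show s * ((j : ℝ) - c) = -(s * c) + j * s by ring, Real.exp_add]
    congr 1
    field_simp
  have hs := NormedSpace.expSeries_div_hasSum_exp (𝔸 := ℝ) (c * Real.exp s)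
  rw [← Real.exp_eq_exp_ℝ] at hs
  rw [lintegral_poissonMeasure]
  simp_rw [e]
  rw [ENNReal.tsum_mul_left, ← ENNReal.ofReal_tsum_of_nonneg (fun j => by positivity) hs.summable,
    hs.tsum_eq, ← ENNReal.ofReal_mul (by positivity), ← ENNReal.ofReal_mul (by positivity),
    ← Real.exp_add, ← Real.exp_add]
  congr 2
  ring

/-- A Chernoff bound for the deviation of a Poisson variable from its mean. -/
theorem poissonMeasure_deviation_le {c : ℝ≥0} {n K : ℝ} (hn : 0 < n) (hc : c ≤ n) (hK : 0 ≤ K)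
    (hKn : K ≤ 2 * n) :
    poissonMeasure c {j : ℕ | |(j : ℝ) - c| ≤ K}ᶜ ≤
      ENNReal.ofReal (2 * Real.exp (-(K ^ 2 / (4 * n)))) := by
  set s := K / (2 * n) with hs
  have hs0 : 0 ≤ s := by positivity
  have hs1 : s ≤ 1 := (div_le_one (by positivity)).2 hKn
  have hmgf : ∀ σ : ℝ, |σ| = s →
      ∫⁻ j : ℕ, ENNReal.ofReal (Real.exp (σ * (j - c))) ∂(poissonMeasure c) ≤
        ENNReal.ofReal (Real.exp (n * s ^ 2)) := fun σ hσ => by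
    rw [lintegral_exp_poissonMeasure]
    refine ENNReal.ofReal_le_ofReal (Real.exp_le_exp.2 ?_)
    have h := Real.abs_exp_sub_one_sub_id_le (x := σ) (by rw [hσ]; exact hs1)
    rw [← sq_abs σ, hσ] at h
    calc (c : ℝ) * (Real.exp σ - 1 - σ) ≤ c * s ^ 2 := by
          gcongr
          exact (le_abs_self _).trans h
      _ ≤ _ := by gcongr
  have hpt : ∀ j : ℕ, ({j : ℕ | |(j : ℝ) - c| ≤ K}ᶜ).indicator (1 : ℕ → ℝ≥0∞) j ≤
      ENNReal.ofReal (Real.exp (-(s * K))) * (ENNReal.ofReal (Real.exp (s * (j - c))) +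
        ENNReal.ofReal (Real.exp (-s * (j - c)))) := by
    intro j
    by_cases hj : j ∈ {j : ℕ | |(j : ℝ) - c| ≤ K}ᶜ
    · rw [Set.indicator_of_mem hj, Pi.one_apply, ← ENNReal.ofReal_add (by positivity)
        (by positivity), ← ENNReal.ofReal_mul (by positivity), ← ENNReal.ofReal_one]
      refine ENNReal.ofReal_le_ofReal ?_
      have hj' : K < |(j : ℝ) - c| := not_le.1 hj
      rw [mul_add, ← Real.exp_add, ← Real.exp_add]
      rcases abs_cases ((j : ℝ) - c) with ⟨h, _⟩ | ⟨h, _⟩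
      · have : 1 ≤ Real.exp (-(s * K) + s * (j - c)) :=
          Real.one_le_exp (by rw [h] at hj'; nlinarith)
        linarith [Real.exp_pos (-(s * K) + -s * (j - c))]
      · have : 1 ≤ Real.exp (-(s * K) + -s * (j - c)) :=
          Real.one_le_exp (by rw [h] at hj'; nlinarith)
        linarith [Real.exp_pos (-(s * K) + s * (j - c))]
    · rw [Set.indicator_of_notMem hj]
      exact zero_le
  have hme : ∀ f : ℕ → ℝ≥0∞, Measurable f := fun f => measurable_of_countable f
  rw [← lintegral_indicator_one (MeasurableSet.of_discrete)]
  refine (lintegral_mono hpt).trans ?_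
  rw [lintegral_const_mul _ (hme _), lintegral_add_left (hme _)]
  refine (mul_le_mul_right (add_le_add (hmgf s (abs_of_nonneg hs0))
    (hmgf (-s) (by rw [abs_neg, abs_of_nonneg hs0]))) _).trans_eq ?_
  rw [← two_mul, ← ENNReal.ofReal_ofNat, ← ENNReal.ofReal_mul (by norm_num),
    ← ENNReal.ofReal_mul (by positivity), mul_left_comm, ← Real.exp_add]
  congr 3
  rw [hs]
  field_simp
  ring

end PoissonTail

/-! ### Comparison of the binomial and the Poisson process -/

section Depoissonization

variable {d : ℕ}

theorem measurable_exp_lowDegreeCount_add (k : ℕ) (r s c : ℝ) :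
    Measurable fun m : FiniteMeasure (Cube d) => ENNReal.ofReal (Real.exp (s *
      lowDegreeCount k r (m : Measure (Cube d)) + c * lowVolume k r (m : Measure (Cube d)))) := by
  have := measurable_lowDegreeCount (d := d) k r
  have := measurable_lowVolume (d := d) k r
  fun_prop

/-- For numbers of points near `n`, the exponential moments are bounded by those of a Poisson
process, up to a small change of the exponent. -/
theorem lintegral_tupleLaw_mul_poissonMeasure_le (k : ℕ) {r : ℝ} (hr : 0 < r) (hr2 : r < 1 / 2)
    (t : ℝ) {n : ℕ} {l : ℝ≥0} {K c η : ℝ} (hl : l + K = n) (hc : 2 * K * influenceConst d k t ≤ c)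
    (hη : c * (unitBallVolume d * r ^ d) ≤ η) :
    (∫⁻ m, expCount k r t m ∂(tupleLaw (volume : Measure (Cube d)) n)) *
        poissonMeasure l {j : ℕ | |(j : ℝ) - l| ≤ K} ≤
      ∫⁻ m : FiniteMeasure (Cube d), ENNReal.ofReal (Real.exp ((t + η) *
        lowDegreeCount k r (m : Measure (Cube d)) + c * lowVolume k r (m : Measure (Cube d))))
        ∂(poissonLaw (l • (volume : Measure (Cube d)))) := by
  rw [lintegral_poissonLaw_smul _ _ (measurable_exp_lowDegreeCount_add k r _ _),
    ← setLIntegral_const]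
  refine (setLIntegral_mono' MeasurableSet.of_discrete fun j hj => ?_).trans
    (setLIntegral_le_lintegral _ _)
  obtain ⟨h1, h2⟩ := abs_le.1 (show |(j : ℝ) - l| ≤ K from hj)
  have hjn : j ≤ n := by
    have : (j : ℝ) ≤ n := by linarith
    exact_mod_cast this
  refine (lintegral_tupleLaw_expCount_le k hr hr2 t hjn ?_ hη).1
  refine le_trans (mul_le_mul_of_nonneg_right ?_ (influenceConst_nonneg d k t)) hc
  linarith

/-- A consequence of the inequality of the arithmetic and the geometric mean, which replaces the
Cauchy–Schwarz inequality in the estimate of the moment on an event of small probability. -/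
theorem exp_le_mul_exp_add {x y γ : ℝ} (hγ : 0 < γ) (hxy : x ≤ y) :
    Real.exp x ≤ γ * Real.exp (2 * y) + γ⁻¹ := by
  refine (Real.exp_le_exp.2 hxy).trans ?_
  rw [two_mul, Real.exp_add]
  have h := Real.exp_pos y
  rw [← mul_le_mul_iff_right₀ hγ, mul_add, mul_inv_cancel₀ hγ.ne']
  nlinarith [sq_nonneg (γ * Real.exp y - 1), mul_pos hγ h]

/-- The converse comparison, up to the contribution of numbers of points far from `n`. -/
theorem lintegral_poissonLaw_le_lintegral_tupleLaw (k : ℕ) {r : ℝ} (hr : 0 < r) (hr2 : r < 1 / 2)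
    (t : ℝ) {n : ℕ} {l : ℝ≥0} {K c η γ : ℝ} (hl : l + K = n) (hK : 0 ≤ K) (hγ : 0 < γ)
    (hc : 2 * K * influenceConst d k t ≤ c) (hη : c * (unitBallVolume d * r ^ d) ≤ η) :
    ∫⁻ m : FiniteMeasure (Cube d), ENNReal.ofReal (Real.exp ((t - η) *
        lowDegreeCount k r (m : Measure (Cube d)) + -c * lowVolume k r (m : Measure (Cube d))))
        ∂(poissonLaw (l • (volume : Measure (Cube d)))) ≤
      ∫⁻ m, expCount k r t m ∂(tupleLaw (volume : Measure (Cube d)) n) +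
      (ENNReal.ofReal γ * ∫⁻ m, expCount k r (2 * (t - η)) m
        ∂(poissonLaw (l • (volume : Measure (Cube d)))) +
      ENNReal.ofReal γ⁻¹ * poissonMeasure l {j : ℕ | |(j : ℝ) - l| ≤ K}ᶜ) := by
  have hc0 : 0 ≤ c := le_trans
    (mul_nonneg (by positivity) (influenceConst_nonneg d k t)) hc
  have hme : ∀ f : ℕ → ℝ≥0∞, Measurable f := fun f => measurable_of_countable f
  rw [lintegral_poissonLaw_smul _ _ (measurable_exp_lowDegreeCount_add k r _ _),
    lintegral_poissonLaw_smul _ _ (measurable_expCount k r _),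
    ← lintegral_add_compl _ (MeasurableSet.of_discrete (s := {j : ℕ | |(j : ℝ) - l| ≤ K}))]
  refine add_le_add ?_ ?_
  · refine (setLIntegral_mono' MeasurableSet.of_discrete fun j hj => ?_).trans
      ((setLIntegral_le_lintegral _ _).trans_eq (by rw [lintegral_const, measure_univ, mul_one]))
    obtain ⟨h1, h2⟩ := abs_le.1 (show |(j : ℝ) - l| ≤ K from hj)
    have hjn : j ≤ n := by
      have : (j : ℝ) ≤ n := by linarith
      exact_mod_cast this
    refine (lintegral_tupleLaw_expCount_le k hr hr2 t hjn ?_ hη).2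
    refine le_trans (mul_le_mul_of_nonneg_right ?_ (influenceConst_nonneg d k t)) hc
    linarith
  · rw [← lintegral_const_mul _ (hme _), ← setLIntegral_const]
    refine le_trans ?_ (add_le_add_left (setLIntegral_le_lintegral
      {j : ℕ | |(j : ℝ) - l| ≤ K}ᶜ _) _)
    rw [← lintegral_add_left (hme _)]
    refine lintegral_mono fun j => ?_
    rw [← lintegral_const_mul _ (measurable_expCount k r _)]
    refine le_trans (lintegral_mono (g := fun m => ENNReal.ofReal γ * expCount k r (2 * (t - η)) m +
      ENNReal.ofReal γ⁻¹) fun m => ?_) ?_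
    · simp only [expCount]
      rw [← ENNReal.ofReal_mul hγ.le, ← ENNReal.ofReal_add (by positivity)
        (by positivity)]
      refine ENNReal.ofReal_le_ofReal ?_
      rw [mul_assoc 2]
      -- the volume term is nonpositive
      refine exp_le_mul_exp_add hγ ?_
      have := mul_nonneg hc0 (lowVolume_nonneg k r (m : Measure (Cube d)))
      linarith
    · rw [lintegral_add_right _ measurable_const, lintegral_const, measure_univ, mul_one]

end Depoissonization

/-! ### The large deviation principle for the binomial process -/

section Binomial

variable {d : ℕ} {a : ℕ → ℝ} {s₀ : ℝ}

/-- A volume term with a coefficient of order `n / (a n)²` does not change the exponential moments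
at the scale `b n`. -/
theorem tendsto_log_integral_exp_add_div {k : ℕ} (hd : 1 ≤ d) (hk : 1 ≤ k)
    (ha : Tendsto a atTop atTop)
    (ha' : Tendsto (fun n : ℕ => a n - Real.log n - ((k : ℝ) - 1) * Real.log (Real.log n))
      atTop atBot) {l : ℕ → ℝ≥0} (hl : Tendsto (fun n : ℕ => (l n : ℝ) / n) atTop (𝓝 1))
    (hv : Tendsto (fun n : ℕ => l n * (unitBallVolume d * radius d a s₀ n ^ d) - a n) atTop (𝓝 s₀))
    (t : ℝ) {D : ℝ} {c : ℕ → ℝ} (hc : ∀ n : ℕ, |c n| ≤ D * (n / a n ^ 2)) :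
    Tendsto (fun n => Real.log (∫ m : FiniteMeasure (Cube d), Real.exp (t *
      lowDegreeCount k (radius d a s₀ n) (m : Measure (Cube d)) +
        c n * lowVolume k (radius d a s₀ n) (m : Measure (Cube d)))
        ∂(poissonLaw (l n • volume))) / scaling k a n) atTop
      (𝓝 (Real.exp (-s₀) / (k - 1).factorial * (Real.exp t - 1))) := by
  have hθ := unitBallVolume_pos d
  have hmain := tendsto_log_integral_exp_div hd hk ha ha' hl hv t
  have hinv : Tendsto (fun n => (a n)⁻¹) atTop (𝓝 0) := tendsto_inv_atTop_zero.comp ha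
  have hp := tendsto_poissonLower_div (k := k + 1) (by omega) ha hv
  rw [Nat.add_sub_cancel] at hp
  set A := Real.exp (2 * (|t| * localBound d k + 1)) with hA
  have herr : Tendsto (fun n => A * D * (poissonLower (k + 1)
      (l n * (unitBallVolume d * radius d a s₀ n ^ d)) / (a n ^ k * Real.exp (-a n)) * (a n)⁻¹))
      atTop (𝓝 0) := by
    have h := (hp.mul hinv).const_mul (A * D)
    rwa [mul_zero, mul_zero] at h
  have hsmall : Tendsto (fun n => D * 2 ^ d * ((a n + s₀) * ((a n)⁻¹ * (a n)⁻¹))) atTop (𝓝 0) := by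
    have h1 : Tendsto (fun n => (a n)⁻¹ + s₀ * ((a n)⁻¹ * (a n)⁻¹)) atTop (𝓝 0) := by
      have h := hinv.add ((hinv.mul hinv).const_mul s₀)
      rwa [mul_zero, mul_zero, add_zero] at h
    have h2 := h1.const_mul (D * 2 ^ d)
    rw [mul_zero] at h2
    refine h2.congr' ?_
    filter_upwards [ha.eventually_gt_atTop 0] with n hn
    field_simp
  have hdiff : Tendsto (fun n => Real.log (∫ m : FiniteMeasure (Cube d), Real.exp (t *
      lowDegreeCount k (radius d a s₀ n) (m : Measure (Cube d)) +
        c n * lowVolume k (radius d a s₀ n) (m : Measure (Cube d)))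
        ∂(poissonLaw (l n • volume))) / scaling k a n -
      Real.log (∫ m : FiniteMeasure (Cube d), Real.exp (t *
      lowDegreeCount k (radius d a s₀ n) (m : Measure (Cube d))) ∂(poissonLaw (l n • volume))) /
        scaling k a n) atTop (𝓝 0) := by
    refine squeeze_zero_norm' ?_ herr
    filter_upwards [eventually_radius (s₀ := s₀) hd ha ha', hsmall.eventually_le_const one_pos,
      ha.eventually_gt_atTop 0, eventually_ge_atTop 1] with n hr hs ha0 hn
    have hn0 : (0 : ℝ) < n := by exact_mod_cast hn
    obtain ⟨hr0, hr1, hr2⟩ := hr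
    obtain ⟨k, rfl⟩ : ∃ k', k = k' + 1 := ⟨k - 1, by omega⟩
    have hb : 0 < scaling (k + 1) a n := by unfold scaling; positivity
    have h := abs_log_integral_exp_lowVolume_le (k + 1) (l n) hr0 hr1 rfl t (c n) (by
      refine (mul_le_mul_of_nonneg_right (hc n) (by positivity)).trans (le_of_eq_of_le ?_ hs)
      rw [← hr2]
      field_simp)
    have hpl := poissonLower_nonneg (k + 1 + 1)
      (u := l n * (unitBallVolume d * radius d a s₀ n ^ d)) (by positivity)
    rw [Real.norm_eq_abs, ← sub_div, abs_div, abs_of_pos hb, div_le_iff₀ hb]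
    refine h.trans ((mul_le_mul_of_nonneg_left (hc n) (by positivity)).trans_eq ?_)
    rw [scaling, Nat.add_sub_cancel, ← hA]
    generalize poissonLower (k + 1 + 1)
      (l n * (unitBallVolume d * radius d a s₀ n ^ d)) = p
    field_simp
    ring
  have h := hdiff.add hmain
  rw [zero_add] at h
  exact h.congr fun n => by ring

/-- The intensity of a Poisson process that has, with high probability, slightly fewer than `n`
points. -/
noncomputable def reducedIntensity (a : ℕ → ℝ) (n : ℕ) : ℝ≥0 := (n - n / a n ^ 2).toNNReal

theorem coe_reducedIntensity {n : ℕ} (h : 1 ≤ a n) :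
    (reducedIntensity a n : ℝ) = n - n / a n ^ 2 :=
  Real.coe_toNNReal _ (sub_nonneg.2 (div_le_self (Nat.cast_nonneg n) (one_le_pow₀ h)))

theorem tendsto_reducedIntensity_div (ha : Tendsto a atTop atTop) :
    Tendsto (fun n : ℕ => (reducedIntensity a n : ℝ) / n) atTop (𝓝 1) := by
  have hinv : Tendsto (fun n => (a n)⁻¹) atTop (𝓝 0) := tendsto_inv_atTop_zero.comp ha
  have h := (hinv.pow 2).const_sub 1
  rw [zero_pow two_ne_zero, sub_zero] at h
  refine h.congr' ?_
  filter_upwards [ha.eventually_ge_atTop 1, eventually_ge_atTop 1] with n h1 hn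
  have hn0 : (0 : ℝ) < n := by exact_mod_cast hn
  rw [coe_reducedIntensity h1]
  field_simp

theorem tendsto_reducedIntensity_mul_radius_pow {k : ℕ} (hd : 1 ≤ d)
    (ha : Tendsto a atTop atTop)
    (ha' : Tendsto (fun n : ℕ => a n - Real.log n - ((k : ℝ) - 1) * Real.log (Real.log n))
      atTop atBot) :
    Tendsto (fun n : ℕ => reducedIntensity a n * (unitBallVolume d * radius d a s₀ n ^ d) - a n)
      atTop (𝓝 s₀) := by
  have hinv : Tendsto (fun n => (a n)⁻¹) atTop (𝓝 0) := tendsto_inv_atTop_zero.comp ha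
  have h : Tendsto (fun n => s₀ - ((a n)⁻¹ + s₀ * (a n)⁻¹ ^ 2)) atTop (𝓝 s₀) := by
    have h := (hinv.add ((hinv.pow 2).const_mul s₀)).const_sub s₀
    simpa using h
  refine h.congr' ?_
  filter_upwards [ha.eventually_ge_atTop 1, eventually_radius (s₀ := s₀) hd ha ha'] with n h1 hr
  rw [coe_reducedIntensity h1, show ((n : ℝ) - n / a n ^ 2) *
    (unitBallVolume d * radius d a s₀ n ^ d) = (1 - (a n)⁻¹ ^ 2) *
      (n * (unitBallVolume d * radius d a s₀ n ^ d)) by field_simp, hr.2.2]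
  field_simp
  ring

/-- Deviations of order `n / (a n)²` of the number of points are negligible at speed `b n`. -/
theorem eventually_mul_scaling_le (k : ℕ) (ha : Tendsto a atTop atTop) (R : ℝ) :
    ∀ᶠ n : ℕ in atTop, R * scaling k a n ≤ (n / a n ^ 2) ^ 2 / (4 * n) := by
  have h := (tendsto_pow_mul_exp_neg_comp ha (k - 1 + 4)).const_mul (4 * R)
  rw [mul_zero] at h
  filter_upwards [h.eventually_le_const one_pos, ha.eventually_gt_atTop 0, eventually_ge_atTop 1]
    with n h1 ha0 hn
  have hn0 : (0 : ℝ) < n := by exact_mod_cast hn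
  rw [scaling, le_div_iff₀ (by positivity), div_pow, le_div_iff₀ (by positivity)]
  calc _ = (n : ℝ) ^ 2 * (4 * R * (a n ^ (k - 1 + 4) * Real.exp (-a n))) := by
        rw [pow_add]; ring
    _ ≤ (n : ℝ) ^ 2 * 1 := by gcongr
    _ = _ := mul_one _

/-- The exponential moments of the binomial process have the same asymptotics as those of the
Poisson process. -/
theorem eventually_lintegral_tupleLaw_expCount {k : ℕ} (hd : 1 ≤ d) (hk : 1 ≤ k)
    (ha : Tendsto a atTop atTop)
    (ha' : Tendsto (fun n : ℕ => a n - Real.log n - ((k : ℝ) - 1) * Real.log (Real.log n))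
      atTop atBot) (t : ℝ) {ε : ℝ} (hε : 0 < ε) :
    ∀ᶠ n : ℕ in atTop,
      ENNReal.ofReal (Real.exp (scaling k a n *
        (Real.exp (-s₀) / (k - 1).factorial * (Real.exp t - 1) - ε))) ≤
        ∫⁻ m, expCount k (radius d a s₀ n) t m ∂(tupleLaw (volume : Measure (Cube d)) n) ∧
      ∫⁻ m, expCount k (radius d a s₀ n) t m ∂(tupleLaw (volume : Measure (Cube d)) n) ≤
      ENNReal.ofReal (Real.exp (scaling k a n *
        (Real.exp (-s₀) / (k - 1).factorial * (Real.exp t - 1) + ε))) := by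
  set α := Real.exp (-s₀) / ((k - 1).factorial : ℝ) with hα
  have hb := tendsto_scaling hk ha ha'
  have hl := tendsto_reducedIntensity_div ha
  have hv := tendsto_reducedIntensity_mul_radius_pow (s₀ := s₀) (d := d) hd ha ha'
  -- a small change `η` of the exponent is harmless by continuity
  obtain ⟨η, hη, hη1, hη2⟩ : ∃ η > 0, α * (Real.exp (t + η) - 1) ≤ α * (Real.exp t - 1) + ε / 4 ∧
      α * (Real.exp t - 1) - ε / 4 ≤ α * (Real.exp (t - η) - 1) := by
    have hcont : Continuous fun s => α * (Real.exp s - 1) := by fun_prop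
    obtain ⟨δ, hδ, h⟩ := Metric.continuousAt_iff.1 (hcont.continuousAt (x := t)) (ε / 4)
      (by positivity)
    have h1 := h (x := t + δ / 2) (by
      rw [Real.dist_eq, add_sub_cancel_left, abs_of_pos (by positivity)]; linarith)
    have h2 := h (x := t - δ / 2) (by
      rw [Real.dist_eq, sub_sub_cancel_left, abs_neg, abs_of_pos (by positivity)]; linarith)
    rw [Real.dist_eq, abs_lt] at h1 h2
    exact ⟨δ / 2, by positivity, by linarith, by linarith⟩
  set x := α * (Real.exp t - 1) with hx
  set C := influenceConst d k t with hC
  have hC0 : 0 ≤ C := influenceConst_nonneg d k t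
  -- at most `2 n / (a n) ^ 2` points are added
  set c : ℕ → ℝ := fun n => 2 * (n / a n ^ 2) * C with hcdef
  have hcb : ∀ n : ℕ, |c n| ≤ 2 * C * (n / a n ^ 2) := fun n => by
    rw [hcdef, abs_of_nonneg (by positivity)]
    exact le_of_eq (by ring)
  have hcb' : ∀ n : ℕ, |(-c n)| ≤ 2 * C * (n / a n ^ 2) := fun n => by rw [abs_neg]; exact hcb n
  have hup := tendsto_log_integral_exp_add_div hd hk ha ha' hl hv (t + η) hcb
  have hlo := tendsto_log_integral_exp_add_div hd hk ha ha' hl hv (t - η) hcb'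
  have h2 := tendsto_log_integral_exp_div hd hk ha ha' hl hv (2 * (t - η))
  have hinv : Tendsto (fun n => (a n)⁻¹) atTop (𝓝 0) := tendsto_inv_atTop_zero.comp ha
  have hcη : ∀ᶠ n in atTop, c n * (unitBallVolume d * radius d a s₀ n ^ d) ≤ η := by
    have h1 : Tendsto (fun n => 2 * C * ((a n)⁻¹ + s₀ * ((a n)⁻¹ * (a n)⁻¹))) atTop (𝓝 0) := by
      have h := (hinv.add ((hinv.mul hinv).const_mul s₀)).const_mul (2 * C)
      rwa [mul_zero, mul_zero, add_zero, mul_zero] at h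
    filter_upwards [h1.eventually_le_const hη, ha.eventually_gt_atTop 0,
      eventually_radius (s₀ := s₀) hd ha ha'] with n h1 ha0 hr
    refine le_of_eq_of_le ?_ h1
    calc c n * (unitBallVolume d * radius d a s₀ n ^ d) =
          2 * C / a n ^ 2 * (n * (unitBallVolume d * radius d a s₀ n ^ d)) := by
          rw [hcdef]; ring
      _ = _ := by rw [hr.2.2]; field_simp
  -- with `γ = exp (-R b n)`, the second exponential moment is as small as the lower bound to be
  -- proved
  set R := α * (Real.exp (2 * (t - η)) - 1) + 1 - (x - ε) with hR
  filter_upwards [hup.eventually_le_const (show _ < x + ε / 2 by linarith),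
    hlo.eventually_const_le (show x - ε / 2 < _ by linarith),
    h2.eventually_le_const (lt_add_one _), hcη, ha.eventually_ge_atTop 1,
    eventually_radius (s₀ := s₀) hd ha ha', eventually_ge_atTop 1,
    hb.eventually_ge_atTop (max (Real.log 2) (Real.log 4 / (ε / 2))),
    eventually_mul_scaling_le k ha (R - (x - ε) + 1), eventually_mul_scaling_le k ha 2]
    with n e1 e2 e3 e4 e5 e6 hn e7 e8 e9
  have hn0 : (0 : ℝ) < n := by exact_mod_cast hn
  obtain ⟨hr0, hr1, -⟩ := e6
  have hb1 := (le_max_left _ _).trans e7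
  have hb2 := (le_max_right _ _).trans e7
  have hlog2 := Real.log_pos one_lt_two
  have hb0 : 0 < scaling k a n := hlog2.trans_le hb1
  have hlK : (reducedIntensity a n : ℝ) + n / a n ^ 2 = n := by
    rw [coe_reducedIntensity e5]; ring
  have hK0 : 0 ≤ (n : ℝ) / a n ^ 2 := by positivity
  have hKn : (n : ℝ) / a n ^ 2 ≤ n := div_le_self hn0.le (one_le_pow₀ e5)
  have hdev := poissonMeasure_deviation_le (c := reducedIntensity a n) hn0
    (by linarith) hK0 (by linarith)
  set Q := poissonLaw (reducedIntensity a n • (volume : Measure (Cube d))) with hQ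
  have hval : ∀ s c', ∫⁻ m : FiniteMeasure (Cube d), ENNReal.ofReal (Real.exp (s *
      lowDegreeCount k (radius d a s₀ n) (m : Measure (Cube d)) +
        c' * lowVolume k (radius d a s₀ n) (m : Measure (Cube d)))) ∂Q =
      ENNReal.ofReal (∫ m : FiniteMeasure (Cube d), Real.exp (s *
      lowDegreeCount k (radius d a s₀ n) (m : Measure (Cube d)) +
        c' * lowVolume k (radius d a s₀ n) (m : Measure (Cube d))) ∂Q) := fun s c' =>
    (ofReal_integral_eq_lintegral_ofReal (integrable_exp_lowDegreeCount_add k hr0 s c' Q)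
      (ae_of_all _ fun m => (Real.exp_pos _).le)).symm
  have hpos : ∀ s c', 0 < ∫ m : FiniteMeasure (Cube d), Real.exp (s *
      lowDegreeCount k (radius d a s₀ n) (m : Measure (Cube d)) +
        c' * lowVolume k (radius d a s₀ n) (m : Measure (Cube d))) ∂Q := fun s c' =>
    integral_exp_pos (integrable_exp_lowDegreeCount_add k hr0 s c' Q)
  rw [div_le_iff₀' hb0, Real.log_le_iff_le_exp (hpos _ _)] at e1
  rw [le_div_iff₀' hb0, Real.le_log_iff_exp_le (hpos _ _)] at e2
  rw [div_le_iff₀' hb0, Real.log_le_iff_le_exp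
    (integral_exp_pos (integrable_exp_lowDegreeCount k hr0 _ Q))] at e3
  have hM2 : ∫⁻ m, expCount k (radius d a s₀ n) (2 * (t - η)) m ∂Q ≤ ENNReal.ofReal
      (Real.exp (scaling k a n * (α * (Real.exp (2 * (t - η)) - 1) + 1))) := by
    refine le_of_eq_of_le ?_ (ENNReal.ofReal_le_ofReal e3)
    exact (ofReal_integral_eq_lintegral_ofReal (integrable_exp_lowDegreeCount k hr0 _ Q)
      (ae_of_all _ fun m => (Real.exp_pos _).le)).symm
  have hfour : 4 * Real.exp (scaling k a n * (x - ε)) ≤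
      Real.exp (scaling k a n * (x - ε / 2)) := by
    rw [div_le_iff₀ (by positivity)] at hb2
    rw [show scaling k a n * (x - ε / 2) = scaling k a n * (ε / 2) + scaling k a n * (x - ε) by
      ring, Real.exp_add]
    gcongr
    exact (Real.log_le_iff_le_exp (by norm_num)).1 hb2
  have htwo : 2 * Real.exp (scaling k a n * (x + ε / 2)) ≤
      Real.exp (scaling k a n * (x + ε)) := by
    rw [div_le_iff₀ (by positivity)] at hb2
    rw [show scaling k a n * (x + ε) = scaling k a n * (ε / 2) + scaling k a n * (x + ε / 2) by
      ring, Real.exp_add]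
    gcongr
    refine le_trans (by norm_num) ((Real.log_le_iff_le_exp (by norm_num : (0 : ℝ) < 4)).1 hb2)
  have h2b : 2 ≤ Real.exp (scaling k a n) := (Real.log_le_iff_le_exp two_pos).1 hb1
  constructor
  · have hL := lintegral_poissonLaw_le_lintegral_tupleLaw k hr0 (by linarith) t hlK hK0
      (Real.exp_pos (-(R * scaling k a n))) (c := c n) le_rfl e4
    rw [← hQ, hval] at hL
    set y := ENNReal.ofReal (Real.exp (scaling k a n * (x - ε))) with hy
    -- the Poisson moment is at least `3 y`, while the two error terms are at most `y` each
    have b1 : y + (y + y) ≤ ENNReal.ofReal (∫ m : FiniteMeasure (Cube d), Real.exp ((t - η) *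
        lowDegreeCount k (radius d a s₀ n) (m : Measure (Cube d)) +
        -c n * lowVolume k (radius d a s₀ n) (m : Measure (Cube d))) ∂Q) := by
      rw [hy, ← ENNReal.ofReal_add (by positivity) (by positivity),
        ← ENNReal.ofReal_add (by positivity) (by positivity)]
      refine ENNReal.ofReal_le_ofReal (le_trans ?_ e2)
      linarith [Real.exp_pos (scaling k a n * (x - ε))]
    have b2 : ENNReal.ofReal (Real.exp (-(R * scaling k a n))) *
        ∫⁻ m, expCount k (radius d a s₀ n) (2 * (t - η)) m ∂Q ≤ y := by
      refine (mul_le_mul_right hM2 _).trans_eq ?_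
      rw [← ENNReal.ofReal_mul (Real.exp_pos _).le, ← Real.exp_add, hy, hR]
      congr 2
      ring
    have b3 : ENNReal.ofReal (Real.exp (-(R * scaling k a n)))⁻¹ *
        poissonMeasure (reducedIntensity a n)
          {j : ℕ | |(j : ℝ) - reducedIntensity a n| ≤ n / a n ^ 2}ᶜ ≤ y := by
      refine (mul_le_mul_right hdev _).trans ?_
      rw [← ENNReal.ofReal_mul (by positivity), ← Real.exp_neg, neg_neg]
      refine ENNReal.ofReal_le_ofReal ?_
      calc _ ≤ Real.exp (R * scaling k a n) *
            (2 * Real.exp (-((R - (x - ε) + 1) * scaling k a n))) := by gcongr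
        _ ≤ Real.exp (R * scaling k a n) * (Real.exp (scaling k a n) *
            Real.exp (-((R - (x - ε) + 1) * scaling k a n))) := by gcongr
        _ = _ := by
            rw [← Real.exp_add, ← Real.exp_add]
            congr 1
            ring
    have b4 := (b1.trans hL).trans (add_le_add_right (add_le_add b2 b3) _)
    exact (ENNReal.add_le_add_iff_right (by finiteness)).1 b4
  · have hU := lintegral_tupleLaw_mul_poissonMeasure_le k hr0 (by linarith) t hlK
      (c := c n) le_rfl e4
    rw [← hQ, hval] at hU
    -- the number of points is close to its mean with probability at least one half
    have hhalf : (2 : ℝ≥0∞)⁻¹ ≤ poissonMeasure (reducedIntensity a n)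
        {j : ℕ | |(j : ℝ) - reducedIntensity a n| ≤ n / a n ^ 2} := by
      have hd2 : poissonMeasure (reducedIntensity a n)
          {j : ℕ | |(j : ℝ) - reducedIntensity a n| ≤ n / a n ^ 2}ᶜ ≤ 2⁻¹ := by
        refine hdev.trans ?_
        rw [← ENNReal.ofReal_ofNat, ← ENNReal.ofReal_inv_of_pos two_pos]
        refine ENNReal.ofReal_le_ofReal ?_
        have h4 : Real.exp (-((n / a n ^ 2) ^ 2 / (4 * n))) ≤ (Real.exp (scaling k a n) ^ 2)⁻¹ := by
          rw [← Real.exp_nat_mul, ← Real.exp_neg]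
          exact Real.exp_le_exp.2 (neg_le_neg (by exact_mod_cast e9))
        have h5 : (Real.exp (scaling k a n) ^ 2)⁻¹ ≤ ((2 : ℝ) ^ 2)⁻¹ := by gcongr
        linarith
      have hsum := prob_add_prob_compl (μ := poissonMeasure (reducedIntensity a n))
        (s := {j : ℕ | |(j : ℝ) - reducedIntensity a n| ≤ n / a n ^ 2}) MeasurableSet.of_discrete
      by_contra! hlt
      have := ENNReal.add_lt_add_of_lt_of_le (by finiteness) hlt hd2
      rw [hsum, ENNReal.inv_two_add_inv_two] at this
      exact lt_irrefl _ this
    have hf := (mul_le_mul_right hhalf _).trans (hU.trans (ENNReal.ofReal_le_ofReal e1))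
    rw [← div_eq_mul_inv, ENNReal.div_le_iff two_ne_zero ENNReal.ofNat_ne_top] at hf
    refine hf.trans ?_
    rw [← ENNReal.ofReal_ofNat, ← ENNReal.ofReal_mul (Real.exp_pos _).le, mul_comm]
    exact ENNReal.ofReal_le_ofReal htwo

theorem satisfiesLDP_binomial {k : ℕ} (hd : 1 ≤ d) (hk : 1 ≤ k) (ha : Tendsto a atTop atTop)
    (ha' : Tendsto (fun n : ℕ => a n - Real.log n - ((k : ℝ) - 1) * Real.log (Real.log n))
      atTop atBot)
    {Ω : Type*} [MeasurableSpace Ω] (P : Measure Ω) [IsProbabilityMeasure P]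
    (X : ℕ → Ω → Cube d) (hX : IsIIDUniform P X) :
    SatisfiesLDP (fun n => P.map (fun ω =>
        lowDegreeCount k (radius d a s₀ n) (binomialProcess X n ω) / scaling k a n)) (scaling k a)
      (poissonRate (Real.exp (-s₀) / ((k - 1).factorial : ℝ))) := by
  have hb := tendsto_scaling hk ha ha'
  have hS : ∀ n, Measurable fun ω => ∑ i ∈ Finset.range n, pointMass (X i ω) := fun n =>
    Finset.measurable_sum _ fun i _ => measurable_pointMass.comp (hX.measurable i)
  have hSX : ∀ n ω, ((∑ i ∈ Finset.range n, pointMass (X i ω) : FiniteMeasure (Cube d)) :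
      Measure (Cube d)) = binomialProcess X n ω := fun n ω => by
    rw [FiniteMeasure.toMeasure_sum, binomialProcess]
    rfl
  have hT : ∀ n, Measurable fun ω =>
      lowDegreeCount k (radius d a s₀ n) (binomialProcess X n ω) := fun n => by
    simp_rw [← hSX]
    exact (measurable_lowDegreeCount k _).comp (hS n)
  refine HasPoissonLogMGF.satisfiesLDP (fun t ε hε => ?_) hb (by positivity)
    (Eventually.of_forall fun n => ?_)
  · filter_upwards [eventually_lintegral_tupleLaw_expCount (s₀ := s₀) (d := d) hd hk ha ha' t hε,
      hb.eventually_gt_atTop 0] with n hn hb0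
    rwa [← map_sum_pointMass_eq_tupleLaw volume hX.measurable hX.indep hX.uniform n,
      lintegral_map (measurable_expCount k _ t) (hS n),
      show ∫⁻ ω, expCount k (radius d a s₀ n) t (∑ i ∈ Finset.range n, pointMass (X i ω)) ∂P =
        ∫⁻ y, ENNReal.ofReal (Real.exp (t * (scaling k a n * y))) ∂(P.map (fun ω =>
          lowDegreeCount k (radius d a s₀ n) (binomialProcess X n ω) / scaling k a n)) from ?_]
      at hn
    rw [lintegral_map (by fun_prop) ((hT n).div_const _)]
    refine lintegral_congr fun ω => ?_
    rw [expCount, hSX, mul_div_cancel₀ _ hb0.ne']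
  · rw [Measure.map_apply ((hT n).div_const _) MeasurableSet.univ]
    exact prob_le_one

end Binomial

end KNNBalls

theorem corollary2p3 (d k : ℕ) (hd : 1 ≤ d) (hk : 1 ≤ k) (s₀ : ℝ) (a : ℕ → ℝ)
    (ha : Tendsto a atTop atTop)
    (ha' : Tendsto
      (fun n : ℕ => a n - Real.log n - ((k : ℝ) - 1) * Real.log (Real.log n)) atTop atBot) :
    (∀ {Ω : Type*} [MeasurableSpace Ω] (P : Measure Ω) [IsProbabilityMeasure P]
      (η : ℕ → Ω → Measure (KNNBalls.Cube d)),
      (∀ n : ℕ, 1 ≤ n → KNNBalls.IsPoissonProcess P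
        ((n : ℝ≥0∞) • (volume : Measure (KNNBalls.Cube d))) (η n)) →
      KNNBalls.SatisfiesLDP
        (fun n => P.map (fun ω =>
          KNNBalls.lowDegreeCount k (KNNBalls.radius d a s₀ n) (η n ω) / KNNBalls.scaling k a n))
        (KNNBalls.scaling k a)
        (KNNBalls.poissonRate (Real.exp (-s₀) / ((k - 1).factorial : ℝ)))) ∧
    (∀ {Ω : Type*} [MeasurableSpace Ω] (P : Measure Ω) [IsProbabilityMeasure P]
      (X : ℕ → Ω → KNNBalls.Cube d),
      KNNBalls.IsIIDUniform P X →
      KNNBalls.SatisfiesLDP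
        (fun n => P.map (fun ω =>
          KNNBalls.lowDegreeCount k (KNNBalls.radius d a s₀ n)
            (KNNBalls.binomialProcess X n ω) / KNNBalls.scaling k a n))
        (KNNBalls.scaling k a)
        (KNNBalls.poissonRate (Real.exp (-s₀) / ((k - 1).factorial : ℝ)))) :=
  ⟨fun P _ η hη => KNNBalls.satisfiesLDP_poisson hd hk ha ha' P η hη,
    fun P _ X hX => KNNBalls.satisfiesLDP_binomial hd hk ha ha' P X hX⟩
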